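/- Let $(V,g)$ be an oriented real Euclidean vector space of dimension $2n$ and let $\mathcal J_g$ be the set of complex structures on $V$ compatible with $g$ and the orientation, with its Riemannian metric $\eta_g(X,Y)=-\tfrac14\operatorname{tr}(XY)$. Let $\mathcal H_0=\bigwedge^\bullet(V^{\mathbb C})^*$, regarded as the algebra of functions $\psi(\theta)$ of a fermionic variable $\theta\in\Pi V$, with the Hermitian form $\langle\psi,\psi'\rangle_0=\int_{\Pi V}\bar\psi\wedge\star_0\psi'\,\varepsilon_g$, where $\star_0$ is the Hodge star of $\tfrac12g$ and the integral is the coefficient of the volume form of $g$. For $x\in V^{\mathbb C}$ put $\nabla_x=\iota_x-\tfrac12 g(x,\cdot)\wedge\cdot$ on $\mathcal H_0$, and for $J\in\mathcal J_g$ let $\mathcal H_J=\{\psi\in\mathcal H_0:\nabla_x\psi=0\ \text{for all } x\in V^{0,1}_J\}$, where $V^{0,1}_J$ is the $(-i)$-eigenspace of $J$ in $V^{\mathbb C}$. The bundle $\mathcal H\to\mathcal J_g$ with fibres $\mathcal H_J\subset\mathcal H_0$ carries the connection obtained by orthogonal projection of the trivial connection on $\mathcal J_g\times\mathcal H_0$.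 Let $\varpi_J=g(J\cdot,\cdot)\in\bigwedge^2V^*$ and $\varpi_J(\theta)=\varpi_J(\theta,\theta)=\sum_{j,k}\varpi_J(e_j,e_k)\theta^j\theta^k$ (twice the form $\varpi_J$), where $e_1,\dots,e_{2n}$ is an oriented orthonormal basis. Let $\gamma=\{J_t\}_{0\le t\le1}$ be a geodesic of $\mathcal J_g$ from $J_0$ to $J_1$, parametrised proportionally to arc length, that lies completely in the complement of the cut locus of $J_0$, and let $U^{\mathcal H}_{J_1J_0}\colon\mathcal H_{J_0}\to\mathcal H_{J_1}$ be the parallel transport along $\gamma$. Let $\psi=e^{\frac i2\varpi_{J_0}}\wedge\phi\in\mathcal H_{J_0}$ with $\phi\in\mathcal H_0$. Then $\det\frac{J_0+J_1}2>0$ and $$(U^{\mathcal H}_{J_1J_0}\psi)(\theta)=\Big(\det\tfrac{J_0+J_1}2\Big)^{-1/4}e^{\frac i4\varpi_{J_1}(\theta)}\int_{\Pi V}\exp\Big[g(\theta^{1,0}_{J_1},\chi)+\tfrac i4\varpi_{J_1}(\chi)+\tfrac i4\varpi_{J_0}(\chi)\Big]\,\phi(\chi)\,\tilde\varepsilon_g(\chi).$$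 Here $\theta$ and $\chi$ are mutually anticommuting fermionic variables in $\Pi V$, $\theta^{1,0}_{J}=\tfrac12(\theta-iJ\theta)$, $g(\theta^{1,0}_J,\chi)=\sum_k(\theta^{1,0}_J)^k\chi^k$, and $\tilde\varepsilon_g(\chi)=i^n\,d\chi^1\cdots d\chi^{2n}$ is the Berezin measure normalised by $\int_{\Pi V}\chi^1\cdots\chi^{2n}\,d\chi^1\cdots d\chi^{2n}=(-1)^{n(2n-1)}$. -/

import Mathlib

open scoped TensorProduct InnerProductSpace

noncomputable section

namespace FermionQuant

variable {V : Type*} [NormedAddCommGroup V] [InnerProductSpace ℝ V]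

/-! ### The space of compatible complex structures and its Riemannian geometry -/

/-- The space `𝒥_g` of complex structures on `V` that are compatible with the inner product and
with the orientation `o`; the orientation defined by `J` is that of a basis
`v₁, J v₁, …, vₙ, J vₙ`. -/
def compatibleJ {n : ℕ} (o : Orientation ℝ V (Fin (2 * n))) : Set (V →L[ℝ] V) :=
  {J | (∀ x, J (J x) = -x) ∧ (∀ x y, ⟪J x, J y⟫_ℝ = ⟪x, y⟫_ℝ) ∧
    ∃ B : Module.Basis (Fin (2 * n)) ℝ V, B.orientation = o ∧
      ∀ k : Fin n, B ⟨2 * k + 1, by omega⟩ = J (B ⟨2 * k, by omega⟩)}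

/-- The tangent space `T_J 𝒥_g`: skew-symmetric operators anti-commuting with `J`. -/
def tangentJ (J : V →L[ℝ] V) : Set (V →L[ℝ] V) :=
  {X | (∀ x y, ⟪X x, y⟫_ℝ = -⟪x, X y⟫_ℝ) ∧ ∀ x, X (J x) = -J (X x)}

/-- The Riemannian metric `η_g` of `𝒥_g`, which is the trace form `-¼ tr (X Y)`. The same formula
defines a Euclidean inner product on the space of all skew-symmetric operators on `V`, so that
`𝒥_g` has the metric induced from that Euclidean space. -/
def metricJ (X Y : V →L[ℝ] V) : ℝ :=
  -(1 / 4) * LinearMap.trace ℝ V (X.toLinearMap ∘ₗ Y.toLinearMap)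

/-- Length of a curve for the metric `η_g`. -/
def curveLength (c : ℝ → V →L[ℝ] V) (a b : ℝ) : ℝ :=
  ∫ t in a..b, √(metricJ (deriv c t) (deriv c t))

/-- A (complete) geodesic of `𝒥_g`: a curve in `𝒥_g` whose acceleration in the ambient Euclidean
space of skew-symmetric operators is orthogonal to `𝒥_g`, i.e. whose covariant acceleration is
zero. As `𝒥_g` is compact, every geodesic segment is a piece of such a curve. -/
def IsGeodesicJ {n : ℕ} (o : Orientation ℝ V (Fin (2 * n))) (γ : ℝ → V →L[ℝ] V) : Prop :=
  ContDiff ℝ 2 γ ∧ (∀ t, γ t ∈ compatibleJ o) ∧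
    ∀ t, ∀ X ∈ tangentJ (γ t), metricJ (deriv (deriv γ) t) X = 0

/-- `γ` is length-minimising in `𝒥_g` between `γ 0` and `γ t`. -/
def IsMinimisingJ {n : ℕ} (o : Orientation ℝ V (Fin (2 * n))) (γ : ℝ → V →L[ℝ] V) (t : ℝ) :
    Prop :=
  ∀ c : ℝ → V →L[ℝ] V, ContDiff ℝ 1 c → (∀ s ∈ Set.Icc (0 : ℝ) 1, c s ∈ compatibleJ o) →
    c 0 = γ 0 → c 1 = γ t → curveLength γ 0 t ≤ curveLength c 0 1

/-- The cut locus of `J₀` in `𝒥_g`: the points `γ T` on non-constant geodesics `γ` from `J₀` such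
that `γ` is length-minimising between `J₀` and `γ T` but fails to be so beyond `γ T`. -/
def cutLocusJ {n : ℕ} (o : Orientation ℝ V (Fin (2 * n))) (J₀ : V →L[ℝ] V) :
    Set (V →L[ℝ] V) :=
  {J | ∃ γ : ℝ → V →L[ℝ] V, IsGeodesicJ o γ ∧ γ 0 = J₀ ∧ deriv γ 0 ≠ 0 ∧
    ∃ T : ℝ, 0 < T ∧ γ T = J ∧ IsMinimisingJ o γ T ∧ ∀ t, T < t → ¬ IsMinimisingJ o γ t}

/-! ### The pre-quantum Hilbert space -/

variable (V) in
/-- `⋀ V*`, the real exterior algebra of the dual space. -/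
abbrev RealForms : Type _ := ExteriorAlgebra ℝ (Module.Dual ℝ V)

variable (V) in
/-- `ℋ₀ = ⋀ (V^ℂ)* = (⋀ V*)^ℂ`: complex forms on `V`, i.e. functions `ψ(θ)` of a fermionic
variable `θ ∈ ΠV`. The product of the ring is the wedge product. -/
abbrev Forms : Type _ := ℂ ⊗[ℝ] RealForms V

/-- A covector as a form, i.e. as a linear function of `θ`. -/
def covec (α : Module.Dual ℝ V) : Forms V := 1 ⊗ₜ[ℝ] ExteriorAlgebra.ι ℝ α

/-- `ν : V → V*`, `x ↦ g(x, ·)`. -/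
def nu : V →ₗ[ℝ] Module.Dual ℝ V := innerₗ V

/-- Contraction `ι_x` of real forms, `x ∈ V`. -/
def contractReal (x : V) : RealForms V →ₗ[ℝ] RealForms V :=
  CliffordAlgebra.contractLeft (Q := (0 : QuadraticForm ℝ (Module.Dual ℝ V)))
    (Module.Dual.eval ℝ V x)

/-- The covariant derivative `∇_x = ι_x - ½ ν(x) ∧ ·` in a real direction, linear in `x ∈ V`. -/
def covDerivReal : V →ₗ[ℝ] Module.End ℂ (Forms V) where
  toFun x := (contractReal x).baseChange ℂ - (1 / 2 : ℂ) • LinearMap.mulLeft ℂ (covec (nu x))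
  map_add' x y := by
    apply LinearMap.ext
    intro ψ
    simp [contractReal, covec, TensorProduct.tmul_add, add_mul, LinearMap.baseChange_add]
    module
  map_smul' r x := by
    apply LinearMap.ext
    intro ψ
    have h : ((r • 1 : ℂ) ⊗ₜ[ℝ] ExteriorAlgebra.ι ℝ (nu x) : Forms V)
        = r • (1 ⊗ₜ[ℝ] ExteriorAlgebra.ι ℝ (nu x)) := rfl
    simp only [contractReal, covec, map_smul, LinearMap.baseChange_smul, LinearMap.sub_apply,
      LinearMap.smul_apply, LinearMap.mulLeft_apply, RingHom.id_apply, TensorProduct.tmul_smul,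
      smul_sub, smul_mul_assoc]
    rw [smul_comm r (1 / 2 : ℂ)]

/-- The covariant derivative `∇_x` for `x ∈ V^ℂ`, by complex linear extension. -/
def covDeriv : ℂ ⊗[ℝ] V →ₗ[ℂ] Module.End ℂ (Forms V) := covDerivReal.liftBaseChange ℂ

/-- `V_J^{0,1} ⊆ V^ℂ`, the `(-i)`-eigenspace of `J`. -/
def V01 (J : V →L[ℝ] V) : Submodule ℂ (ℂ ⊗[ℝ] V) :=
  Module.End.eigenspace (J.toLinearMap.baseChange ℂ) (-Complex.I)

/-- The quantum Hilbert space `ℋ_J = {ψ ∈ ℋ₀ | ∇_x ψ = 0 for all x ∈ V_J^{0,1}}`. -/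
def quantumH (J : V →L[ℝ] V) : Submodule ℂ (Forms V) :=
  ⨅ x ∈ V01 J, LinearMap.ker (covDeriv x)

/-! ### The Hermitian form on the pre-quantum Hilbert space

From here on, `e` is an orthonormal basis of `V`, positively oriented for the orientation that is
used, so that `ε_g = e₁ ∧ ⋯ ∧ e_{2n}`. -/

variable {n : ℕ}

/-- The dual basis `e^i`. -/
def coord (e : OrthonormalBasis (Fin (2 * n)) ℝ V) (i : Fin (2 * n)) : Module.Dual ℝ V :=
  e.toBasis.coord i

/-- The volume form `e^1 ∧ ⋯ ∧ e^{2n}` of `g`. -/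
def volForm (e : OrthonormalBasis (Fin (2 * n)) ℝ V) : RealForms V :=
  (List.ofFn fun i => ExteriorAlgebra.ι ℝ (coord e i)).prod

/-- The inner product `g⁻¹` on `V*`. -/
def dualMetric (e : OrthonormalBasis (Fin (2 * n)) ℝ V) :
    Module.Dual ℝ V →ₗ[ℝ] Module.Dual ℝ (Module.Dual ℝ V) :=
  ∑ i, (Module.Dual.eval ℝ V (e i)).smulRight (Module.Dual.eval ℝ V (e i))

/-- The algebra homomorphism `⋀ V* → End (⋀ V*)` with `α ↦ ι_{α♯}`, where `♯ : V* → V` is the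
isomorphism given by the metric `½ g` (thus `2 ν⁻¹`). -/
def sharpContract (e : OrthonormalBasis (Fin (2 * n)) ℝ V) :
    RealForms V →ₐ[ℝ] Module.End ℝ (RealForms V) :=
  ExteriorAlgebra.lift ℝ
    ⟨(CliffordAlgebra.contractLeft (Q := (0 : QuadraticForm ℝ (Module.Dual ℝ V)))) ∘ₗ
        ((2 : ℝ) • dualMetric e), by
      intro α
      apply LinearMap.ext
      intro ψ
      exact CliffordAlgebra.contractLeft_contractLeft _ _⟩

/-- The Hodge star `⋆₀` of the metric `½ g`:
`⋆₀ (α₁ ∧ ⋯ ∧ α_k) = ι_{α_k♯} ⋯ ι_{α₁♯} vol`, where `vol = 2⁻ⁿ e^1 ∧ ⋯ ∧ e^{2n}` is the volume form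
of `½ g`. -/
def hodgeStar₀ (e : OrthonormalBasis (Fin (2 * n)) ℝ V) : RealForms V →ₗ[ℝ] RealForms V :=
  LinearMap.applyₗ (((2 : ℝ) ^ n)⁻¹ • volForm e) ∘ₗ (sharpContract e).toLinearMap ∘ₗ
    CliffordAlgebra.reverse

/-- The Berezin integral `∫_{ΠV} α ε_g = ⟨α^{(2n)}, ε_g⟩`, i.e. the coefficient of
`e^1 ∧ ⋯ ∧ e^{2n}` in `α`, which is `ι_{e_{2n}} ⋯ ι_{e₁} α`. -/
def berezinForm (e : OrthonormalBasis (Fin (2 * n)) ℝ V) : RealForms V →ₗ[ℝ] ℝ :=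
  ExteriorAlgebra.algebraMapInv.toLinearMap ∘ₗ
    (List.ofFn fun i : Fin (2 * n) => contractReal (e i)).reverse.prod

/-- Complex conjugation of forms. -/
def conjForm : Forms V →ₐ[ℝ] Forms V :=
  Algebra.TensorProduct.map Complex.conjAe.toAlgHom (AlgHom.id ℝ _)

/-- The Hermitian form `⟨ψ, ψ'⟩₀ = ∫_{ΠV} ψ̄ ∧ ⋆₀ ψ' ε_g` on `ℋ₀`. -/
def herm₀ (e : OrthonormalBasis (Fin (2 * n)) ℝ V) (ψ ψ' : Forms V) : ℂ :=
  (Complex.ofRealAm.toLinearMap ∘ₗ berezinForm e).liftBaseChange ℂ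
    (conjForm ψ * (hodgeStar₀ e).baseChange ℂ ψ')

/-! ### Parallel transport in the bundle of quantum Hilbert spaces -/

/-- `Ψ` is a parallel section over `γ|_[0,1]` of the bundle with fibres `ℋ_J ⊆ ℋ₀`, for the
connection obtained by orthogonal projection of the trivial connection: `Ψ t ∈ ℋ_{γ t}` and the
derivative of `Ψ` in `ℋ₀` exists and is orthogonal to `ℋ_{γ t}`. (The derivative in the finite
dimensional space `ℋ₀` is taken in coordinates, i.e. through all linear functionals.) -/
def IsParallelSection (e : OrthonormalBasis (Fin (2 * n)) ℝ V) (γ : ℝ → V →L[ℝ] V)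
    (Ψ : ℝ → Forms V) : Prop :=
  ∀ t ∈ Set.Icc (0 : ℝ) 1, Ψ t ∈ quantumH (γ t) ∧
    ∃ Ψ' : Forms V,
      (∀ l : Forms V →ₗ[ℂ] ℂ,
        HasDerivWithinAt (fun s => l (Ψ s)) (l Ψ') (Set.Icc (0 : ℝ) 1) t) ∧
      ∀ ξ ∈ quantumH (γ t), herm₀ e ξ Ψ' = 0

/-- `ψ₁` is the result of the parallel transport of `ψ₀` along `γ|_[0,1]`. -/
def IsParallelTransport (e : OrthonormalBasis (Fin (2 * n)) ℝ V) (γ : ℝ → V →L[ℝ] V)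
    (ψ₀ ψ₁ : Forms V) : Prop :=
  ∃ Ψ : ℝ → Forms V, IsParallelSection e γ Ψ ∧ Ψ 0 = ψ₀ ∧ Ψ 1 = ψ₁

/-! ### Fermionic variables and the Berezin integral over the second of two variables -/

/-- `ϖ_J(θ) = ϖ_J(θ, θ) = ∑_{j,k} ϖ_J(e_j, e_k) θ^j θ^k`, where `ϖ_J = g(J ·, ·)`. -/
def varpiVar (e : OrthonormalBasis (Fin (2 * n)) ℝ V) (J : V →L[ℝ] V) : Forms V :=
  ∑ j, ∑ k, (⟪J (e j), e k⟫_ℝ : ℂ) • (covec (coord e j) * covec (coord e k))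

/-- The two-form `ϖ_J = g(J ·, ·) = ½ ∑_{j,k} ϖ_J(e_j, e_k) e^j ∧ e^k`. -/
def varpi (e : OrthonormalBasis (Fin (2 * n)) ℝ V) (J : V →L[ℝ] V) : Forms V :=
  (1 / 2 : ℂ) • varpiVar e J

variable (V) in
/-- Functions `f(θ, χ)` of two (mutually anti-commuting) fermionic variables `θ, χ ∈ ΠV`. -/
abbrev Forms₂ : Type _ := ℂ ⊗[ℝ] ExteriorAlgebra ℝ (Module.Dual ℝ V × Module.Dual ℝ V)

/-- `f(θ)` as a function of `(θ, χ)`. -/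
def inTheta : Forms V →ₐ[ℂ] Forms₂ V :=
  Algebra.TensorProduct.map (AlgHom.id ℂ ℂ) (ExteriorAlgebra.map (LinearMap.inl ℝ _ _))

/-- `f(χ)` as a function of `(θ, χ)`. -/
def inChi : Forms V →ₐ[ℂ] Forms₂ V :=
  Algebra.TensorProduct.map (AlgHom.id ℂ ℂ) (ExteriorAlgebra.map (LinearMap.inr ℝ _ _))

/-- The coordinates `e^k(θ_J^{1,0})` of `θ_J^{1,0} = ½ (θ - i J θ)`. -/
def theta10 (e : OrthonormalBasis (Fin (2 * n)) ℝ V) (J : V →L[ℝ] V) (k : Fin (2 * n)) :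
    Forms V :=
  (1 / 2 : ℂ) • (covec (coord e k) - Complex.I • covec (coord e k ∘ₗ J.toLinearMap))

/-- `g(θ_J^{1,0}, χ)`. -/
def gThetaChi (e : OrthonormalBasis (Fin (2 * n)) ℝ V) (J : V →L[ℝ] V) : Forms₂ V :=
  ∑ k, inTheta (theta10 e J k) * inChi (covec (coord e k))

/-- The left derivative `∂/∂χ^i` of functions of `(θ, χ)`. -/
def derivChi (e : OrthonormalBasis (Fin (2 * n)) ℝ V) (i : Fin (2 * n)) :
    Module.End ℝ (ExteriorAlgebra ℝ (Module.Dual ℝ V × Module.Dual ℝ V)) :=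
  CliffordAlgebra.contractLeft
    (Q := (0 : QuadraticForm ℝ (Module.Dual ℝ V × Module.Dual ℝ V)))
    (Module.Dual.eval ℝ V (e i) ∘ₗ LinearMap.snd ℝ _ _)

/-- The integral `∫_{ΠV} f(θ, χ) dχ^1 ⋯ dχ^{2n}` over the fermionic variable `χ`, a function of
`θ`. It is `∂/∂χ^1 ⋯ ∂/∂χ^{2n} f` (which does not depend on `χ`), so that
`∫ χ^1 ⋯ χ^N dχ^1 ⋯ dχ^N = (-1)^{N(N-1)/2}` with `N = 2n`: the `dχ^i` anti-commute with the
`χ^j`. -/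
def berezinChiReal (e : OrthonormalBasis (Fin (2 * n)) ℝ V) :
    ExteriorAlgebra ℝ (Module.Dual ℝ V × Module.Dual ℝ V) →ₗ[ℝ] RealForms V :=
  (ExteriorAlgebra.map (LinearMap.fst ℝ _ _)).toLinearMap ∘ₗ
    (List.ofFn fun i : Fin (2 * n) => derivChi e i).prod

/-- The integral `∫_{ΠV} f(θ, χ) ε̃_g(χ)`, where `ε̃_g = iⁿ ε_g`. -/
def berezinChi (e : OrthonormalBasis (Fin (2 * n)) ℝ V) : Forms₂ V →ₗ[ℂ] Forms V :=
  (Complex.I ^ n) • (berezinChiReal e).baseChange ℂ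

end FermionQuant

end

open FermionQuant

namespace FermionQuant

noncomputable section

/-! A geodesic through `J₀` has the form `γ t = exp (2tA) J₀ = exp (tA) J₀ exp (-tA)` with `A` skew
and anticommuting with `J₀` (`exists_generator_of_isGeodesicJ`). Diagonalise `A²` in an orthonormal
basis `v_k` with eigenvalues `-λ_k²`. The unit vectors `γ t v_k` turn through the angles `2tλ_k`.
Comparison with arcs on the unit sphere shows that `γ` is minimising up to `t` while all `tλ_k ≤
π/2`; beyond that, reducing an angle `tλ_k` modulo `π` gives a shorter curve. Avoiding the cut locus
therefore forces `λ_k < π/2` (`lt_pi_div_two_of_notMem_cutLocusJ`), and `(J₀ + J₁)/2 = exp A · cosh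
A · J₀` has determinant `∏ cos λ_k > 0` (`det_half_add`).

The operators `∇_x` satisfy the Clifford relation `∇_x ∇_y + ∇_y ∇_x = -g(x, y)`. Hence `D = -½ ∑
∇_{A v_k} ∇_{v_k}` satisfies `[D, ∇_x] = ∇_{Ax}`, and `U t = exp (tD)` carries `ℋ_{J₀}` into `ℋ_{γ
t}` (`flow_intertwine`). Because `A` anticommutes with `γ t`, `D` maps `ℋ_{γ t}` into its orthogonal
complement (`spinOp_orthogonal`), so `U t ψ` is a parallel section. Positivity of the Hermitian form
makes it the only one with its initial value.

The Gaussian integral operator `K_J` of the formula (`kernelOp`) kills the images of `∇_{x-iJx}` by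
integration by parts (`kernelOp_covDeriv10`) and is the identity on `ℋ_J` (`kernelOp_eq_self`), its
normalisation being a Pfaffian equal to one (`pfaffian_eq_one`). Along the section followed
backwards from `J₁`, these properties and the Clifford relation let `K_{J₁}` turn the generator into
the scalar `-¼ ∑ λ_k tan (tλ_k)`. Integrating this (`kernelOp_flow`) gives `K_{J₁} ψ = (∏ cos
λ_k)^{1/4} U 1 ψ`, which is the claim. -/

/-! ### Calculus in a complexified exterior algebra -/

/-- The complexification of the exterior algebra of a real vector space. -/
abbrev CExt (M : Type*) [AddCommGroup M] [Module ℝ M] : Type _ := ℂ ⊗[ℝ] ExteriorAlgebra ℝ M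

section Calculus

variable {M N : Type*} [AddCommGroup M] [Module ℝ M] [AddCommGroup N] [Module ℝ N]

/-- The ring structure of `CExt M`. -/
abbrev ringCExt : Ring (CExt M) := inferInstance

attribute [local instance] ringCExt

/-- Negation in `CExt M`, as given by its ring structure. -/
abbrev negCExt : Neg (CExt M) := ringCExt.toNeg

attribute [local instance] negCExt

/-- The compatibility of negation with the product of `CExt M`. -/
abbrev distribNegCExt : HasDistribNeg (CExt M) :=
  @NonUnitalNonAssocRing.toHasDistribNeg _ ringCExt.toNonAssocRing.toNonUnitalNonAssocRing

/-- The additive group of the ring `CExt M`. -/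
abbrev addCommGroupCExt : AddCommGroup (CExt M) :=
  ringCExt.toNonAssocRing.toNonUnitalNonAssocRing.toAddCommGroup

attribute [local instance] distribNegCExt addCommGroupCExt

/-- A vector as an element of the complexified exterior algebra. -/
def cov : M →ₗ[ℝ] CExt M := (TensorProduct.mk ℝ ℂ (ExteriorAlgebra ℝ M) 1) ∘ₗ ExteriorAlgebra.ι ℝ

/-- Contraction by a real linear form. -/
def ctr (d : Module.Dual ℝ M) : CExt M →ₗ[ℂ] CExt M :=
  (CliffordAlgebra.contractLeft (Q := (0 : QuadraticForm ℝ M)) d).baseChange ℂ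

/-- The coefficient of degree zero. -/
def aug : CExt M →ₗ[ℂ] ℂ :=
  (Complex.ofRealAm.toLinearMap ∘ₗ
    (ExteriorAlgebra.algebraMapInv (R := ℝ) (M := M)).toLinearMap).liftBaseChange ℂ

theorem cov_apply (m : M) : cov m = (1 : ℂ) ⊗ₜ[ℝ] ExteriorAlgebra.ι ℝ m := rfl

/-- The algebra is generated from `1` by left multiplication with elements of degree one. Most
identities below are checked on these generators. -/
theorem cext_induction {P : CExt M → Prop} (one : P 1) (add : ∀ f g, P f → P g → P (f + g))
    (smul : ∀ (c : ℂ) f, P f → P (c • f)) (cov_mul : ∀ m f, P f → P (cov m * f)) (f : CExt M) :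
    P f := by
  have key : ∀ a : ExteriorAlgebra ℝ M, P ((1 : ℂ) ⊗ₜ[ℝ] a) := by
    intro a
    induction a using CliffordAlgebra.left_induction with
    | algebraMap r =>
      have := smul (r : ℂ) 1 one
      convert this using 1
      rw [Algebra.TensorProduct.one_def, TensorProduct.smul_tmul', Algebra.algebraMap_eq_smul_one,
        ← TensorProduct.smul_tmul]
      simp [Algebra.smul_def]
    | add x y hx hy => rw [TensorProduct.tmul_add]; exact add _ _ hx hy
    | ι_mul x m hx =>
      have := cov_mul m _ hx
      rwa [cov_apply, Algebra.TensorProduct.tmul_mul_tmul, one_mul] at this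
  induction f using TensorProduct.induction_on with
  | zero => simpa using smul 0 1 one
  | tmul c a => 
    have := smul c _ (key a)
    rwa [TensorProduct.smul_tmul', smul_eq_mul, mul_one] at this
  | add x y hx hy => exact add _ _ hx hy

@[simp] theorem ctr_one (d : Module.Dual ℝ M) : ctr d (1 : CExt M) = 0 := by
  simp [ctr, Algebra.TensorProduct.one_def]

theorem ctr_cov_mul (d : Module.Dual ℝ M) (m : M) (f : CExt M) :
    ctr d (cov m * f) = (d m : ℂ) • f - cov m * ctr d f := by
  induction f using TensorProduct.induction_on with
  | zero => simp
  | tmul c a =>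
    have : CliffordAlgebra.contractLeft (Q := (0 : QuadraticForm ℝ M)) d (ExteriorAlgebra.ι ℝ m * a)
      = d m • a - ExteriorAlgebra.ι ℝ m *
        CliffordAlgebra.contractLeft (Q := (0 : QuadraticForm ℝ M)) d a :=
      CliffordAlgebra.contractLeft_ι_mul _ _ _
    simp only [ctr, cov_apply, Algebra.TensorProduct.tmul_mul_tmul, one_mul,
      LinearMap.baseChange_tmul, this, TensorProduct.tmul_sub, TensorProduct.smul_tmul']
    rw [← TensorProduct.smul_tmul, Complex.real_smul, smul_eq_mul]
  | add x y hx hy => simp only [mul_add, map_add, hx, hy, smul_add]; abel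

@[simp] theorem ctr_cov (d : Module.Dual ℝ M) (m : M) : ctr d (cov m) = (d m : ℂ) • 1 := by
  simpa using ctr_cov_mul d m 1

theorem ctr_add (d d' : Module.Dual ℝ M) : ctr (d + d') = ctr d + ctr d' := by
  simp [ctr, LinearMap.baseChange_add]

theorem ctr_smul (r : ℝ) (d : Module.Dual ℝ M) : ctr (r • d) = (r : ℂ) • ctr d := by
  apply LinearMap.ext
  intro f
  induction f using TensorProduct.induction_on with
  | zero => simp
  | tmul c a =>
    simp only [ctr, LinearMap.baseChange_tmul, map_smul, LinearMap.smul_apply,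
      TensorProduct.smul_tmul']
    rw [← TensorProduct.smul_tmul, Complex.real_smul, smul_eq_mul]
  | add x y hx hy => simp only [map_add, hx, hy]

theorem ctr_ctr (d d' : Module.Dual ℝ M) (f : CExt M) : ctr d (ctr d' f) = -ctr d' (ctr d f) := by
  induction f using TensorProduct.induction_on with
  | zero => simp
  | tmul c a =>
    simp only [ctr, LinearMap.baseChange_tmul]
    rw [CliffordAlgebra.contractLeft_comm, TensorProduct.tmul_neg]
  | add x y hx hy => simp only [map_add, hx, hy, neg_add]

theorem ctr_self (d : Module.Dual ℝ M) (f : CExt M) : ctr d (ctr d f) = 0 := by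
  have h := ctr_ctr d d f
  have h2 : (2 : ℂ) • ctr d (ctr d f) = 0 := by
    rw [two_smul]; exact eq_neg_iff_add_eq_zero.mp h
  exact (smul_eq_zero.mp h2).resolve_left two_ne_zero

theorem cov_sq (m : M) : cov m * cov m = 0 := by
  simp [cov_apply, Algebra.TensorProduct.tmul_mul_tmul]

theorem cov_mul_cov (m m' : M) : cov m * cov m' = -(cov m' * cov m) := by
  have := cov_sq (m + m')
  simp only [map_add, add_mul, mul_add, cov_sq] at this
  rw [eq_neg_iff_add_eq_zero, ← this]; abel

theorem cov_smul (r : ℝ) (m : M) : cov (r • m) = (r : ℂ) • cov m := by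
  rw [map_smul]; rfl

/-- Functoriality of the complexified exterior algebra. -/
def mapC (f : M →ₗ[ℝ] N) : CExt M →ₐ[ℂ] CExt N :=
  Algebra.TensorProduct.map (AlgHom.id ℂ ℂ) (ExteriorAlgebra.map f)

@[simp] theorem mapC_cov (f : M →ₗ[ℝ] N) (m : M) : mapC f (cov m) = cov (f m) := by
  simp [mapC, cov_apply]

theorem ctr_mapC (f : M →ₗ[ℝ] N) (d : Module.Dual ℝ N) (x : CExt M) :
    ctr d (mapC f x) = mapC f (ctr (d ∘ₗ f) x) := by
  induction x using cext_induction with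
  | one => simp
  | add x y hx hy => simp only [map_add, hx, hy]
  | smul c x hx => simp only [map_smul, hx]
  | cov_mul m x hx =>
    rw [map_mul, mapC_cov, ctr_cov_mul, ctr_cov_mul, map_sub, map_smul, map_mul, mapC_cov, hx]
    rfl

@[simp] theorem ctr_zero : ctr (0 : Module.Dual ℝ M) = 0 := by simp [ctr]

@[simp] theorem aug_one : aug (1 : CExt M) = 1 := by
  simp [aug, Algebra.TensorProduct.one_def]

@[simp] theorem aug_cov_mul (m : M) (f : CExt M) : aug (cov m * f) = 0 := by
  induction f using TensorProduct.induction_on with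
  | zero => simp
  | tmul c a => simp [aug, cov_apply, ExteriorAlgebra.algebraMapInv]
  | add x y hx hy => simp [mul_add, hx, hy]

theorem aug_mapC (f : M →ₗ[ℝ] N) (x : CExt M) : aug (mapC f x) = aug x := by
  induction x using cext_induction with
  | one => simp
  | add x y hx hy => simp only [map_add, hx, hy]
  | smul c x hx => simp only [map_smul, hx]
  | cov_mul m x hx => simp

instance [FiniteDimensional ℝ M] : FiniteDimensional ℂ (CExt M) := by
  have : Module.Finite ℝ (ExteriorAlgebra ℝ M) :=
    Module.Finite.of_basis (Module.finBasis ℝ M).ExteriorAlgebra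
  infer_instance

/-! ### Quadratic elements and Gaussian exponentials -/

/-- The span of products of two vectors: even central elements. -/
def quadr (M : Type*) [AddCommGroup M] [Module ℝ M] : Submodule ℂ (CExt M) :=
  Submodule.span ℂ (Set.range fun p : M × M => cov p.1 * cov p.2)

theorem cov_mul_cov_mem_quadr (m m' : M) : cov m * cov m' ∈ quadr M :=
  Submodule.subset_span ⟨(m, m'), rfl⟩

/-- Moving a degree-one element past a product of two others costs two signs, which cancel. -/
theorem quadr_commute {G : CExt M} (hG : G ∈ quadr M) (f : CExt M) : Commute G f := by
  induction hG using Submodule.span_induction with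
  | mem x hx =>
    obtain ⟨⟨a, b⟩, rfl⟩ := hx
    induction f using cext_induction with
    | one => exact Commute.one_right _
    | add x y hx hy => exact hx.add_right hy
    | smul c x hx => exact hx.smul_right c
    | cov_mul m x hx =>
      refine Commute.mul_right ?_ hx
      show cov a * cov b * cov m = cov m * (cov a * cov b)
      rw [mul_assoc, cov_mul_cov b m, mul_neg, ← mul_assoc, cov_mul_cov a m, neg_mul, neg_neg,
        mul_assoc]
  | zero => exact Commute.zero_left _
  | add x y _ _ hx hy => exact hx.add_left hy
  | smul c x _ hx => exact hx.smul_left c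

/-- Nilpotency is what makes `IsNilpotent.exp` the true exponential series. It passes to sums
because the summands commute. -/
theorem quadr_isNilpotent {G : CExt M} (hG : G ∈ quadr M) : IsNilpotent G := by
  induction hG using Submodule.span_induction with
  | mem x hx =>
    obtain ⟨⟨a, b⟩, rfl⟩ := hx
    refine ⟨2, ?_⟩
    rw [pow_two, mul_assoc, ← mul_assoc (cov b), cov_mul_cov b a, neg_mul, mul_neg, mul_assoc,
      ← mul_assoc (cov a), cov_sq, zero_mul, neg_zero]
  | zero => exact IsNilpotent.zero
  | add x y hx _ hx' hy' => exact (quadr_commute hx y).isNilpotent_add hx' hy'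
  | smul c x _ hx => exact hx.smul c

theorem ctr_quadr_mul (d : Module.Dual ℝ M) {G : CExt M} (hG : G ∈ quadr M) (f : CExt M) :
    ctr d (G * f) = ctr d G * f + G * ctr d f := by
  induction hG using Submodule.span_induction with
  | mem x hx =>
    obtain ⟨⟨a, b⟩, rfl⟩ := hx
    simp only [mul_assoc, ctr_cov_mul, ctr_cov, mul_sub, sub_mul, smul_mul_assoc, mul_smul_comm,
      mul_one]
    abel
  | zero => simp
  | add x y _ _ hx hy => simp only [add_mul, map_add, hx, hy]; abel
  | smul c x _ hx => simp only [smul_mul_assoc, map_smul, hx, smul_add]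

theorem ctr_quadr_pow_mul (d : Module.Dual ℝ M) {G : CExt M} (hG : G ∈ quadr M) (f : CExt M)
    (k : ℕ) :
    ctr d (G ^ (k + 1) * f) = (k + 1 : ℚ) • (ctr d G * (G ^ k * f)) + G ^ (k + 1) * ctr d f := by
  induction k generalizing f with
  | zero => simp [ctr_quadr_mul d hG]
  | succ k ih =>
    rw [pow_succ, mul_assoc, ih, ctr_quadr_mul d hG]
    have h1 : G ^ (k + 1) * (ctr d G * f) = ctr d G * (G ^ (k + 1) * f) := by
      rw [← mul_assoc, ← mul_assoc, ((quadr_commute hG _).pow_left (k + 1)).eq]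
    have h2 : G ^ k * (G * f) = G ^ (k + 1) * f := by rw [pow_succ, mul_assoc]
    rw [mul_add, h1, h2, ← mul_assoc _ G]
    push_cast
    module

/-- Chain rule: as `G` is even and central, contraction acts on `exp G` like an ordinary derivation.
All integrations by parts rest on this. -/
theorem ctr_exp_mul (d : Module.Dual ℝ M) {G : CExt M} (hG : G ∈ quadr M) (f : CExt M) :
    ctr d (IsNilpotent.exp G * f)
      = ctr d G * (IsNilpotent.exp G * f) + IsNilpotent.exp G * ctr d f := by
  obtain ⟨k, hk⟩ := quadr_isNilpotent hG
  -- The exponential is expanded both to `k` and to `k + 1` terms: differentiation lowers the power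
  -- by one, so the longer sum on the left matches the shorter one on the right.
  have hk' : G ^ (k + 1) = 0 := by rw [pow_succ, hk, zero_mul]
  have e1 := IsNilpotent.exp_eq_sum hk
  have e2 := IsNilpotent.exp_eq_sum hk'
  have hs : ∀ (q : ℚ) (x : CExt M), ctr d (q • x) = q • ctr d x := fun q x => map_rat_smul _ q x
  have hL : ctr d (IsNilpotent.exp G * f) = ∑ i ∈ Finset.range (k + 1),
      ((i.factorial : ℚ)⁻¹ • ctr d (G ^ i * f)) := by
    rw [e2, Finset.sum_mul, map_sum]
    refine Finset.sum_congr rfl fun i _ => ?_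
    rw [smul_mul_assoc, hs]
  rw [hL, Finset.sum_range_succ', pow_zero, one_mul]
  have h1 : ∀ i ∈ Finset.range k, (((i + 1).factorial : ℚ)⁻¹ • ctr d (G ^ (i + 1) * f)) =
      ctr d G * (((i.factorial : ℚ)⁻¹ • G ^ i) * f) +
        (((i + 1).factorial : ℚ)⁻¹ • G ^ (i + 1)) * ctr d f := by
    intro i _
    rw [ctr_quadr_pow_mul d hG, smul_add, smul_smul, smul_mul_assoc, mul_smul_comm, smul_mul_assoc]
    congr 2
    rw [Nat.factorial_succ]; push_cast
    have : (i.factorial : ℚ) ≠ 0 := by positivity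
    have : (i + 1 : ℚ) ≠ 0 := by positivity
    field_simp
  rw [Finset.sum_congr rfl h1, Finset.sum_add_distrib, ← Finset.mul_sum, ← Finset.sum_mul, ← e1,
    add_assoc]
  congr 1
  conv_rhs => rw [e2, Finset.sum_range_succ', add_mul, Finset.sum_mul]
  simp

theorem exp_add_quadr {G H : CExt M} (hG : G ∈ quadr M) (hH : H ∈ quadr M) :
    IsNilpotent.exp (G + H) = IsNilpotent.exp G * IsNilpotent.exp H :=
  IsNilpotent.exp_add_of_commute (quadr_commute hG H) (quadr_isNilpotent hG) (quadr_isNilpotent hH)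

theorem mapC_mem_quadr (f : M →ₗ[ℝ] N) {G : CExt M} (hG : G ∈ quadr M) : mapC f G ∈ quadr N := by
  induction hG using Submodule.span_induction with
  | mem x hx =>
    obtain ⟨⟨a, b⟩, rfl⟩ := hx
    simpa using cov_mul_cov_mem_quadr (f a) (f b)
  | zero => simp
  | add x y _ _ hx hy => simpa using add_mem hx hy
  | smul c x _ hx => simpa using Submodule.smul_mem _ c hx

theorem mapC_exp (f : M →ₗ[ℝ] N) {G : CExt M} (hG : G ∈ quadr M) :
    mapC f (IsNilpotent.exp G) = IsNilpotent.exp (mapC f G) :=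
  IsNilpotent.map_exp (quadr_isNilpotent hG) _

theorem exp_commute {G : CExt M} (hG : G ∈ quadr M) (f : CExt M) :
    Commute (IsNilpotent.exp G) f := by
  obtain ⟨k, hk⟩ := quadr_isNilpotent hG
  rw [IsNilpotent.exp_eq_sum hk]
  exact Commute.sum_left _ _ _ fun i _ => ((quadr_commute hG f).pow_left i).smul_left _

end Calculus

end

end FermionQuant

namespace FermionQuant

noncomputable section

attribute [local instance] ringCExt negCExt distribNegCExt addCommGroupCExt

variable {V : Type*} [NormedAddCommGroup V] [InnerProductSpace ℝ V]

/-! ### The quantum Hilbert spaces in real terms -/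

/-- Contraction `ι_x` of complex forms by a real vector. -/
def iota (x : V) : Forms V →ₗ[ℂ] Forms V := ctr (Module.Dual.eval ℝ V x)

theorem iota_add (x y : V) : iota (x + y) = iota x + iota y := by
  simp only [iota, map_add, ctr_add]

theorem iota_smul (r : ℝ) (x : V) : iota (r • x) = (r : ℂ) • iota x := by
  simp only [iota, map_smul, ctr_smul]

theorem iota_cov_mul (x : V) (α : Module.Dual ℝ V) (f : Forms V) :
    iota x (cov α * f) = (α x : ℂ) • f - cov α * iota x f := ctr_cov_mul _ _ _

theorem iota_cov (x : V) (α : Module.Dual ℝ V) : iota x (cov α) = (α x : ℂ) • 1 := ctr_cov _ _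

@[simp] theorem iota_one (x : V) : iota x (1 : Forms V) = 0 := ctr_one _

theorem iota_iota (x y : V) (f : Forms V) : iota x (iota y f) = -iota y (iota x f) := ctr_ctr _ _ _

theorem iota_self (x : V) (f : Forms V) : iota x (iota x f) = 0 := ctr_self _ _

theorem covDerivReal_apply (x : V) (ψ : Forms V) :
    covDerivReal x ψ = iota x ψ - (1 / 2 : ℂ) • (cov (nu x) * ψ) := rfl

theorem covDerivReal_smul (r : ℝ) (x : V) (ψ : Forms V) :
    covDerivReal (r • x) ψ = (r : ℂ) • covDerivReal x ψ := by
  rw [map_smul]; rfl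

theorem nu_apply (x y : V) : nu x y = ⟪x, y⟫_ℝ := rfl

/-- Contractions anticommute among themselves, and so do wedge products; the two mixed
anticommutators of `ι` with `-½ ν` each contribute `-½ g(x, y)`. -/
theorem covDerivReal_clifford (x y : V) (ψ : Forms V) :
    covDerivReal x (covDerivReal y ψ) + covDerivReal y (covDerivReal x ψ)
      = -(⟪x, y⟫_ℝ : ℂ) • ψ := by
  have h := cov_mul_cov (nu x) (nu y)
  have h' : cov (nu x) * (cov (nu y) * ψ) = -(cov (nu y) * (cov (nu x) * ψ)) := by
    rw [← mul_assoc, h, neg_mul, mul_assoc]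
  simp only [covDerivReal_apply, map_sub, map_smul, iota_cov_mul, h',
    nu_apply, iota_iota x y, real_inner_comm x y, smul_sub, smul_neg, smul_smul]
  module

/-- `V_J^{0,1}` consists of combinations of the vectors `x + iJx` with `x` real, so real directions
suffice. -/
theorem mem_quantumH_iff {J : V →L[ℝ] V} (hJ : ∀ x, J (J x) = -x) (ψ : Forms V) :
    ψ ∈ quantumH J ↔ ∀ x, covDerivReal x ψ + Complex.I • covDerivReal (J x) ψ = 0 := by
  have hc : ∀ (c : ℂ) (x : V), covDeriv (c ⊗ₜ[ℝ] x) ψ = c • covDerivReal x ψ := by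
    intro c x; simp [covDeriv]
  simp only [quantumH, Submodule.mem_iInf, LinearMap.mem_ker]
  constructor
  · intro h x
    have hx : (1 : ℂ) ⊗ₜ[ℝ] x + Complex.I ⊗ₜ[ℝ] (J x) ∈ V01 J := by
      rw [V01, Module.End.mem_eigenspace_iff]
      simp only [map_add, LinearMap.baseChange_tmul, ContinuousLinearMap.coe_coe, hJ, smul_add,
        TensorProduct.smul_tmul', smul_eq_mul, neg_mul, Complex.I_mul_I, neg_neg, mul_one,
        TensorProduct.tmul_neg, TensorProduct.neg_tmul]
      abel
    have := h _ hx
    rwa [map_add, LinearMap.add_apply, hc, hc, one_smul] at this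
  · intro h z hz
    -- The map `w ↦ w + iJw` doubles every element of `V_J^{0,1}`, so vanishing along its image is
    -- enough.
    have key : ∀ w : ℂ ⊗[ℝ] V,
        covDeriv (w + Complex.I • (J.toLinearMap.baseChange ℂ w)) ψ = 0 := by
      intro w
      induction w using TensorProduct.induction_on with
      | zero => simp
      | tmul c x =>
        rw [map_add, LinearMap.add_apply, map_smul, LinearMap.baseChange_tmul, LinearMap.smul_apply,
          hc, hc, smul_comm Complex.I c, ← smul_add]
        exact (congrArg (c • ·) (h x)).trans (smul_zero c)
      | add x y hx hy =>
        have : (x + y) + Complex.I • (J.toLinearMap.baseChange ℂ (x + y)) =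
          (x + Complex.I • (J.toLinearMap.baseChange ℂ x)) +
          (y + Complex.I • (J.toLinearMap.baseChange ℂ y)) := by
          rw [map_add, smul_add]; abel
        rw [this, map_add, LinearMap.add_apply, hx, hy, add_zero]
    rw [V01, Module.End.mem_eigenspace_iff] at hz
    have h2 := key z
    rw [hz, smul_smul, mul_neg, Complex.I_mul_I, neg_neg, one_smul, ← two_smul ℂ, map_smul,
      LinearMap.smul_apply] at h2
    exact (smul_eq_zero.mp h2).resolve_left two_ne_zero

/-! ### Forms annihilated by the contractions along an eigenspace -/

section Number

variable {n : ℕ} (e : OrthonormalBasis (Fin (2 * n)) ℝ V)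

theorem sum_smul_cov_coord (α : Module.Dual ℝ V) :
    ∑ k, (α (e k) : ℂ) • cov (coord e k) = (cov α : Forms V) := by
  have : α = ∑ k, α (e k) • coord e k := by
    apply LinearMap.ext
    intro x
    conv_lhs => rw [← e.toBasis.sum_repr x]
    simp [coord, mul_comm]
  conv_rhs => rw [this]
  rw [map_sum]
  exact Finset.sum_congr rfl fun k _ => (cov_smul _ _).symm

theorem sum_inner_smul_cov_coord (x : V) :
    ∑ k, (⟪x, e k⟫_ℝ : ℂ) • cov (coord e k) = (cov (nu x) : Forms V) :=
  sum_smul_cov_coord e (nu x)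

theorem sum_coord_smul_cov_coord (x : V) :
    ∑ k, (coord e k x : ℂ) • cov (coord e k) = (cov (nu x) : Forms V) := by
  rw [← sum_inner_smul_cov_coord e x]
  refine Finset.sum_congr rfl fun k _ => ?_
  have : coord e k x = ⟪x, e k⟫_ℝ := by
    rw [real_inner_comm]; simp [coord, OrthonormalBasis.repr_apply_apply]
  rw [this]

/-- The complex covector `a α + b α ∘ J`. -/
def covAffine (J : V →L[ℝ] V) (a b : ℂ) (α : Module.Dual ℝ V) : Forms V :=
  a • cov α + b • cov (α ∘ₗ J.toLinearMap)

/-- The derivation of `⋀ V*` that extends `α ↦ a α + b α ∘ J`. -/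
def numberOp (J : V →L[ℝ] V) (a b : ℂ) : Module.End ℂ (Forms V) :=
  ∑ k, LinearMap.mulLeft ℂ (cov (coord e k)) ∘ₗ (a • iota (e k) + b • iota (J (e k)))

variable {e} {J : V →L[ℝ] V} {a b : ℂ}

theorem numberOp_apply (f : Forms V) : numberOp e J a b f =
    ∑ k, cov (coord e k) * (a • iota (e k) f + b • iota (J (e k)) f) := by
  simp [numberOp]

@[simp] theorem numberOp_one : numberOp e J a b 1 = 0 := by
  simp [numberOp_apply]

theorem numberOp_cov_mul (α : Module.Dual ℝ V) (f : Forms V) :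
    numberOp e J a b (cov α * f) = covAffine J a b α * f + cov α * numberOp e J a b f := by
  have h1 := sum_smul_cov_coord e α
  have h2 := sum_smul_cov_coord e (α ∘ₗ J.toLinearMap)
  have h3 : covAffine J a b α * f = ∑ k, (a • (α (e k) : ℂ) • (cov (coord e k) * f) +
      b • ((α ∘ₗ J.toLinearMap) (e k) : ℂ) • (cov (coord e k) * f)) := by
    rw [covAffine, ← h1, ← h2, add_mul, Finset.smul_sum, Finset.smul_sum, Finset.sum_mul,
      Finset.sum_mul, ← Finset.sum_add_distrib]
    simp only [smul_mul_assoc]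
  rw [h3, numberOp_apply, numberOp_apply, Finset.mul_sum, ← Finset.sum_add_distrib]
  refine Finset.sum_congr rfl fun k _ => ?_
  have h : ∀ g : Forms V, cov (coord e k) * (cov α * g) = -(cov α * (cov (coord e k) * g)) := by
    intro g; rw [← mul_assoc, cov_mul_cov, neg_mul, mul_assoc]
  simp only [iota_cov_mul, smul_sub, mul_add, mul_sub, mul_smul_comm, h, smul_smul,
    LinearMap.comp_apply, ContinuousLinearMap.coe_coe, smul_neg]
  module

/-- Since `α ∘ J ∘ J = -α`, the pairs `(a, b)` multiply formally like `a + bi`. -/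
theorem covAffine_covAffine_eq (hJ : ∀ x, J (J x) = -x) (a b c d : ℂ) (α : Module.Dual ℝ V) :
    a • covAffine J c d α + b • covAffine J c d (α ∘ₗ J.toLinearMap)
      = covAffine J (a * c - b * d) (a * d + b * c) α := by
  have h : (α ∘ₗ J.toLinearMap) ∘ₗ J.toLinearMap = -α := by
    apply LinearMap.ext; intro x; simp [hJ]
  simp only [covAffine, h, map_neg, smul_add, smul_smul, smul_neg]
  module

theorem numberOp_covAffine_mul (hJ : ∀ x, J (J x) = -x) (c d : ℂ) (α : Module.Dual ℝ V)
    (f : Forms V) :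
    numberOp e J a b (covAffine J c d α * f)
      = covAffine J (c * a - d * b) (c * b + d * a) α * f
        + covAffine J c d α * numberOp e J a b f := by
  rw [← covAffine_covAffine_eq hJ]
  conv_lhs => rw [covAffine]
  simp only [add_mul, smul_mul_assoc, map_add, map_smul, numberOp_cov_mul, smul_add]
  conv_rhs => rw [covAffine]
  simp only [add_mul, smul_mul_assoc, covAffine, smul_add]
  abel

/-- The hypotheses `h1` and `h2` say that `a + bJ` is idempotent, so every covector splits into a
part fixed by it and a part killed by it. `numberOp` counts the factors of the first kind; its
kernel is thus generated from `1` by covectors of the second kind. -/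
theorem mem_of_numberOp_eq_zero (hJ : ∀ x, J (J x) = -x) (h1 : a * a - b * b = a)
    (h2 : a * b + b * a = b) {S : Submodule ℂ (Forms V)} (hone : 1 ∈ S)
    (hmul : ∀ α, ∀ f ∈ S, covAffine J (1 - a) (-b) α * f ∈ S) {f : Forms V}
    (hf : numberOp e J a b f = 0) : f ∈ S := by
  set N := numberOp e J a b with hN
  set S' : Submodule ℂ (Forms V) := S ⊓ LinearMap.ker N with hS'
  have hone' : 1 ∈ S' := ⟨hone, numberOp_one⟩
  have e0 : ∀ α, covAffine J ((1 - a) * a - -b * b) ((1 - a) * b + -b * a) α = 0 := by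
    intro α
    have r1 : (1 - a) * a - -b * b = 0 := by linear_combination -h1
    have r2 : (1 - a) * b + -b * a = 0 := by linear_combination -h2
    rw [r1, r2]; simp [covAffine]
  have hr : ∀ α g, N (covAffine J (1 - a) (-b) α * g) = covAffine J (1 - a) (-b) α * N g := by
    intro α g
    rw [hN, numberOp_covAffine_mul hJ, e0, zero_mul, zero_add]
  have hc : ∀ α g, N (covAffine J a b α * g) = covAffine J a b α * g + covAffine J a b α * N g := by
    intro α g
    rw [hN, numberOp_covAffine_mul hJ, h1, h2]
  have hmul' : ∀ α, ∀ f ∈ S', covAffine J (1 - a) (-b) α * f ∈ S' := by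
    rintro α f ⟨hf1, hf2⟩
    refine ⟨hmul α f hf1, ?_⟩
    exact LinearMap.mem_ker.mpr (by rw [hr, LinearMap.mem_ker.mp hf2, mul_zero])
  -- The span of eigenvectors with eigenvalues `1, 2, …`: forms with some factor of the first kind.
  set E : Submodule ℂ (Forms V) := ⨆ k : ℕ, N.eigenspace ((k : ℂ) + 1) with hE
  have hEr : ∀ α, ∀ f ∈ E, covAffine J (1 - a) (-b) α * f ∈ E := by
    intro α f hf
    induction hf using Submodule.iSup_induction' with
    | mem k g hg =>
      refine Submodule.mem_iSup_of_mem k ?_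
      rw [Module.End.mem_eigenspace_iff] at hg ⊢
      rw [hr, hg, mul_smul_comm]
    | zero => rw [mul_zero]; exact zero_mem _
    | add x y _ _ hx hy => rw [mul_add]; exact add_mem hx hy
  have hEc : ∀ α, ∀ f ∈ E, covAffine J a b α * f ∈ E := by
    intro α f hf
    induction hf using Submodule.iSup_induction' with
    | mem k g hg =>
      refine Submodule.mem_iSup_of_mem (k + 1) ?_
      rw [Module.End.mem_eigenspace_iff] at hg ⊢
      rw [hc, hg, mul_smul_comm]
      push_cast
      module
    | zero => rw [mul_zero]; exact zero_mem _
    | add x y _ _ hx hy => rw [mul_add]; exact add_mem hx hy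
  have hS'c : ∀ α, ∀ f ∈ S', covAffine J a b α * f ∈ E := by
    rintro α f ⟨_, hf2⟩
    refine Submodule.mem_iSup_of_mem 0 ?_
    rw [Module.End.mem_eigenspace_iff, hc, LinearMap.mem_ker.mp hf2]
    simp
  have hsplit : ∀ α : Module.Dual ℝ V,
      cov α = covAffine J (1 - a) (-b) α + covAffine J a b α := by
    intro α; simp only [covAffine]; module
  have htop : ∀ g : Forms V, g ∈ S' ⊔ E := by
    intro g
    induction g using cext_induction with
    | one => exact Submodule.mem_sup_left hone'
    | add f g hf hg => exact add_mem hf hg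
    | smul c f hf => exact Submodule.smul_mem _ c hf
    | cov_mul m f hf =>
      obtain ⟨s, hs, t, ht, rfl⟩ := Submodule.mem_sup.mp hf
      rw [hsplit, mul_add, add_mul, add_mul]
      refine add_mem (add_mem (Submodule.mem_sup_left (hmul' _ _ hs))
        (Submodule.mem_sup_right (hS'c _ _ hs)))
        (Submodule.mem_sup_right (add_mem (hEr _ _ ht) (hEc _ _ ht)))
  obtain ⟨s, hs, t, ht, rfl⟩ := Submodule.mem_sup.mp (htop f)
  have ht0 : t ∈ N.eigenspace 0 := by
    rw [Module.End.mem_eigenspace_iff, zero_smul]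
    rw [map_add, LinearMap.mem_ker.mp hs.2, zero_add] at hf
    exact hf
  -- Eigenspaces for distinct eigenvalues are independent, so a component of `E` lying in the kernel
  -- vanishes.
  have hdis := (Module.End.eigenspaces_iSupIndep N) 0
  have hle : E ≤ ⨆ j, ⨆ (_ : j ≠ (0 : ℂ)), N.eigenspace j := by
    refine iSup_le fun k => ?_
    exact le_iSup₂_of_le ((k : ℂ) + 1) (Nat.cast_add_one_ne_zero k) le_rfl
  have : t = 0 := (Submodule.disjoint_def.mp hdis) t ht0 (hle ht)
  rw [this, add_zero]
  exact hs.1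

/-- A form annihilated by all contractions is a scalar. -/
theorem eq_aug_smul_one_of_iota_eq_zero (e : OrthonormalBasis (Fin (2 * n)) ℝ V)
    (hJ : ∀ x, J (J x) = -x) {f : Forms V} (hf : ∀ k, iota (e k) f = 0) : f = aug f • 1 := by
  -- For `a = 1`, `b = 0` the idempotent is the identity: `numberOp` is the degree, and no covector
  -- of the second kind is left.
  have hN : numberOp e J 1 0 f = 0 := by simp [numberOp_apply, hf]
  have h : f ∈ Submodule.span ℂ {(1 : Forms V)} := by
    refine mem_of_numberOp_eq_zero hJ (by ring) (by ring)
      (Submodule.mem_span_singleton_self _) (fun α g _ => ?_) hN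
    simp [covAffine]
  obtain ⟨c, rfl⟩ := Submodule.mem_span_singleton.mp h
  rw [map_smul, aug_one, smul_eq_mul, mul_one]

theorem iota_eq_sum (e : OrthonormalBasis (Fin (2 * n)) ℝ V) (x : V) (f : Forms V) :
    iota x f = ∑ k, (⟪e k, x⟫_ℝ : ℂ) • iota (e k) f := by
  conv_lhs => rw [← e.sum_repr' x]
  simp only [iota, map_sum]
  have : ∀ (s : Finset (Fin (2 * n))) (d : Fin (2 * n) → Module.Dual ℝ (Module.Dual ℝ V)),
      ctr (∑ k ∈ s, d k) f = ∑ k ∈ s, ctr (d k) f := by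
    intro s d
    induction s using Finset.cons_induction with
    | empty => simp
    | cons k s hk ih => rw [Finset.sum_cons, Finset.sum_cons, ctr_add, LinearMap.add_apply, ih]
  rw [this]
  refine Finset.sum_congr rfl fun k _ => ?_
  rw [map_smul, ctr_smul, LinearMap.smul_apply]

end Number

end

end FermionQuant

namespace FermionQuant

noncomputable section

attribute [local instance] ringCExt negCExt distribNegCExt addCommGroupCExt

variable {V : Type*} [NormedAddCommGroup V] [InnerProductSpace ℝ V]

/-! ### The Berezin integral -/

section ListProd

variable {W : Type*} [AddCommGroup W] [Module ℂ W]

theorem list_prod_anticommute {l : List (Module.End ℂ W)} {T : Module.End ℂ W}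
    (h : ∀ d ∈ l, ∀ f, d (T f) = -T (d f)) (f : W) :
    l.prod (T f) = (-1 : ℂ) ^ l.length • T (l.prod f) := by
  induction l with
  | nil => simp
  | cons d l ih =>
    rw [List.prod_cons, Module.End.mul_apply, ih fun d' hd' => h d' (List.mem_cons_of_mem _ hd'),
      map_smul, h d List.mem_cons_self, List.length_cons, Module.End.mul_apply, pow_succ]
    module

/-- `T` moves to the right, up to sign, until it meets its own occurrence, where its square
vanishes. -/
theorem list_prod_absorb {l : List (Module.End ℂ W)} {T : Module.End ℂ W} (hT : T ∈ l)
    (h : ∀ d ∈ l, ∀ f, d (T f) = -T (d f)) (hsq : ∀ f, T (T f) = 0) (f : W) :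
    T (l.prod f) = 0 := by
  induction l with
  | nil => simp at hT
  | cons d l ih =>
    rw [List.prod_cons, Module.End.mul_apply]
    by_cases hd : T = d
    · rw [← hd, hsq]
    · have hT' : T ∈ l := (List.mem_cons.mp hT).resolve_left hd
      rw [← neg_eq_zero, ← h d List.mem_cons_self,
        ih hT' fun d' hd' => h d' (List.mem_cons_of_mem _ hd'), map_zero]

end ListProd

variable {n : ℕ} (e : OrthonormalBasis (Fin (2 * n)) ℝ V)

/-- The derivative `∂/∂χ` in direction `x`, on complex functions of `(θ, χ)`. -/
def dChi (x : V) : Forms₂ V →ₗ[ℂ] Forms₂ V :=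
  ctr (Module.Dual.eval ℝ V x ∘ₗ LinearMap.snd ℝ _ _)

/-- The derivative `∂/∂θ` in direction `x`, on complex functions of `(θ, χ)`. -/
def dTheta (x : V) : Forms₂ V →ₗ[ℂ] Forms₂ V :=
  ctr (Module.Dual.eval ℝ V x ∘ₗ LinearMap.fst ℝ _ _)

theorem inTheta_eq : (inTheta : Forms V →ₐ[ℂ] Forms₂ V) = mapC (LinearMap.inl ℝ _ _) := rfl

theorem inChi_eq : (inChi : Forms V →ₐ[ℂ] Forms₂ V) = mapC (LinearMap.inr ℝ _ _) := rfl

theorem dChi_inChi (x : V) (f : Forms V) : dChi x (inChi f) = inChi (iota x f) := by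
  rw [dChi, inChi_eq, ctr_mapC]; rfl

theorem dTheta_inChi (x : V) (f : Forms V) : dTheta x (inChi f) = 0 := by
  rw [dTheta, inChi_eq, ctr_mapC]
  have : (Module.Dual.eval ℝ V x ∘ₗ LinearMap.fst ℝ _ _) ∘ₗ
      LinearMap.inr ℝ (Module.Dual ℝ V) (Module.Dual ℝ V) = 0 := by ext; simp
  rw [this]; simp

theorem inTheta_cov (α : Module.Dual ℝ V) : inTheta (cov α) = cov (α, 0) := by
  rw [inTheta_eq, mapC_cov]; rfl

theorem inChi_cov (α : Module.Dual ℝ V) : inChi (cov α) = cov (0, α) := by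
  rw [inChi_eq, mapC_cov]; rfl

theorem dChi_inTheta_cov_mul (x : V) (α : Module.Dual ℝ V) (f : Forms₂ V) :
    dChi x (inTheta (cov α) * f) = -(inTheta (cov α) * dChi x f) := by
  rw [inTheta_cov, dChi, ctr_cov_mul]; simp

theorem dTheta_inTheta_cov_mul (x : V) (α : Module.Dual ℝ V) (f : Forms₂ V) :
    dTheta x (inTheta (cov α) * f) = (α x : ℂ) • f - inTheta (cov α) * dTheta x f := by
  rw [inTheta_cov, dTheta, ctr_cov_mul]; simp

theorem dChi_add (x y : V) : dChi (x + y) = dChi x + dChi y := by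
  simp only [dChi, map_add, LinearMap.add_comp, ctr_add]

theorem dChi_smul (r : ℝ) (x : V) : dChi (r • x) = (r : ℂ) • dChi x := by
  simp only [dChi, map_smul, LinearMap.smul_comp, ctr_smul]

theorem baseChange_list_prod {W : Type*} [AddCommGroup W] [Module ℝ W]
    (l : List (Module.End ℝ W)) :
    l.prod.baseChange ℂ = (l.map fun d => (d.baseChange ℂ : Module.End ℂ (ℂ ⊗[ℝ] W))).prod := by
  induction l with
  | nil => exact LinearMap.baseChange_id (R := ℝ) (M := W) (A := ℂ)
  | cons d l ih =>
    rw [List.prod_cons, List.map_cons, List.prod_cons, ← ih]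
    exact LinearMap.baseChange_comp (A := ℂ) (M := W) (N := W) l.prod d

theorem berezinChi_apply (f : Forms₂ V) : berezinChi e f =
    Complex.I ^ n • mapC (LinearMap.fst ℝ _ _) ((List.ofFn fun i => dChi (e i)).prod f) := by
  have h := baseChange_list_prod (List.ofFn fun i => derivChi e i)
  rw [List.map_ofFn] at h
  rw [berezinChi, LinearMap.smul_apply, berezinChiReal, LinearMap.baseChange_comp,
    LinearMap.comp_apply, h]
  rfl

variable {e}

theorem dChi_dChi (x y : V) (f : Forms₂ V) : dChi x (dChi y f) = -dChi y (dChi x f) := ctr_ctr _ _ _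

theorem neg_one_pow_length_ofFn {W : Type*} (g : Fin (2 * n) → W) :
    (-1 : ℂ) ^ (List.ofFn g).length = 1 := by
  rw [List.length_ofFn, pow_mul]; simp

/-- The integral already contains every `∂/∂χ^i`, so one more derivative gives zero. This is the
source of integration by parts. -/
theorem berezinChi_dChi (x : V) (f : Forms₂ V) : berezinChi e (dChi x f) = 0 := by
  have key : ∀ i, berezinChi e (dChi (e i) f) = 0 := by
    intro i
    have hanti : ∀ d ∈ (List.ofFn fun i => (dChi (e i) : Module.End ℂ (Forms₂ V))),
        ∀ f, d (dChi (e i) f) = -dChi (e i) (d f) := by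
      intro d hd f
      obtain ⟨j, rfl⟩ := (List.mem_ofFn' _ _).mp hd
      exact dChi_dChi _ _ _
    rw [berezinChi_apply, list_prod_anticommute hanti, list_prod_absorb _ hanti]
    · simp
    · intro f; exact ctr_self _ f
    · exact (List.mem_ofFn' _ _).mpr ⟨i, rfl⟩
  have hx : ∀ s : Finset (Fin (2 * n)), berezinChi e (dChi (∑ i ∈ s, ⟪e i, x⟫_ℝ • e i) f) = 0 := by
    intro s
    induction s using Finset.cons_induction with
    | empty =>
      have := dChi_smul 0 x
      rw [zero_smul] at this
      rw [Finset.sum_empty, this]; simp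
    | cons k s hk ih =>
      rw [Finset.sum_cons, dChi_add, LinearMap.add_apply, map_add, ih, dChi_smul,
        LinearMap.smul_apply, map_smul, key, smul_zero, add_zero]
  simpa [e.sum_repr'] using hx Finset.univ

/-- No sign appears, because the number `2n` of derivatives is even. -/
theorem berezinChi_inTheta_cov_mul (α : Module.Dual ℝ V) (f : Forms₂ V) :
    berezinChi e (inTheta (cov α) * f) = cov α * berezinChi e f := by
  have h := list_prod_anticommute (l := List.ofFn fun i => (dChi (e i) : Module.End ℂ (Forms₂ V)))
    (T := LinearMap.mulLeft ℂ (inTheta (cov α))) (by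
      intro d hd f
      obtain ⟨j, rfl⟩ := (List.mem_ofFn' _ _).mp hd
      exact dChi_inTheta_cov_mul _ _ _) f
  rw [neg_one_pow_length_ofFn, one_smul] at h
  rw [LinearMap.mulLeft_apply, LinearMap.mulLeft_apply] at h
  rw [berezinChi_apply, h, map_mul, inTheta_cov, mapC_cov, berezinChi_apply, mul_smul_comm]
  rfl

theorem iota_berezinChi (x : V) (f : Forms₂ V) :
    iota x (berezinChi e f) = berezinChi e (dTheta x f) := by
  have h := list_prod_anticommute (l := List.ofFn fun i => (dChi (e i) : Module.End ℂ (Forms₂ V)))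
    (T := dTheta x) (by
      intro d hd f
      obtain ⟨j, rfl⟩ := (List.mem_ofFn' _ _).mp hd
      exact ctr_ctr _ _ _) f
  rw [neg_one_pow_length_ofFn, one_smul] at h
  rw [berezinChi_apply, berezinChi_apply, h, map_smul, iota, ctr_mapC, dTheta]

/-- The degree-zero coefficient can be read off after setting `θ = 0`, which leaves an integral in
`χ` alone. -/
theorem aug_berezinChi (f : Forms₂ V) : aug (berezinChi e f) =
    Complex.I ^ n * aug ((List.ofFn fun i => iota (e i)).prod (mapC (LinearMap.snd ℝ _ _) f)) := by
  have key : ∀ l : List V, mapC (LinearMap.snd ℝ _ _) ((l.map fun x => dChi x).prod f)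
      = (l.map fun x => iota x).prod (mapC (LinearMap.snd ℝ _ _) f) := by
    intro l
    induction l with
    | nil => simp
    | cons x l ih =>
      rw [List.map_cons, List.prod_cons, Module.End.mul_apply, List.map_cons, List.prod_cons,
        Module.End.mul_apply, ← ih, iota, ctr_mapC, dChi]
  have := key (List.ofFn e)
  rw [List.map_ofFn, List.map_ofFn] at this
  rw [berezinChi_apply, map_smul, aug_mapC, smul_eq_mul, ← aug_mapC (LinearMap.snd ℝ _ _)]
  congr 2

/-! ### Quadratic exponents -/

theorem coord_apply (k : Fin (2 * n)) (x : V) : coord e k x = ⟪e k, x⟫_ℝ := by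
  simp [coord, OrthonormalBasis.repr_apply_apply]

theorem varpiVar_mem_quadr (J : V →L[ℝ] V) : varpiVar e J ∈ quadr (Module.Dual ℝ V) :=
  Submodule.sum_mem _ fun _ _ => Submodule.sum_mem _ fun _ _ =>
    Submodule.smul_mem _ _ (cov_mul_cov_mem_quadr _ _)

theorem inChi_mem_quadr {G : Forms V} (hG : G ∈ quadr (Module.Dual ℝ V)) :
    inChi G ∈ quadr (Module.Dual ℝ V × Module.Dual ℝ V) := mapC_mem_quadr _ hG

theorem gThetaChi_mem_quadr (J : V →L[ℝ] V) :
    gThetaChi e J ∈ quadr (Module.Dual ℝ V × Module.Dual ℝ V) := by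
  refine Submodule.sum_mem _ fun k _ => ?_
  have h : ∀ α β : Module.Dual ℝ V, inTheta (cov α) * inChi (cov β) ∈
      quadr (Module.Dual ℝ V × Module.Dual ℝ V) := by
    intro α β; rw [inTheta_cov, inChi_cov]; exact cov_mul_cov_mem_quadr _ _
  have : theta10 e J k = (1 / 2 : ℂ) • (cov (coord e k) -
    Complex.I • cov (coord e k ∘ₗ J.toLinearMap)) := rfl
  rw [this, map_smul, map_sub, map_smul, smul_mul_assoc, sub_mul, smul_mul_assoc]
  exact Submodule.smul_mem _ _ (sub_mem (h _ _) (Submodule.smul_mem _ _ (h _ _)))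

/-- The covector `g(x + i J x, ·)`. -/
def cov01 (J : V →L[ℝ] V) (x : V) : Forms V := cov (nu x) + Complex.I • cov (nu (J x))

/-- The covector `g(x - i J x, ·)`. -/
def cov10 (J : V →L[ℝ] V) (x : V) : Forms V := cov (nu x) - Complex.I • cov (nu (J x))

variable {J : V →L[ℝ] V} 

theorem skew_of_isometry (hJ : ∀ x, J (J x) = -x) (hg : ∀ x y, ⟪J x, J y⟫_ℝ = ⟪x, y⟫_ℝ) (x y : V) :
    ⟪J x, y⟫_ℝ = -⟪x, J y⟫_ℝ := by
  have := hg x (J y)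
  rw [hJ, inner_neg_right] at this
  linarith

theorem nu_comp (hs : ∀ x y, ⟪J x, y⟫_ℝ = -⟪x, J y⟫_ℝ) (x : V) :
    (nu x) ∘ₗ J.toLinearMap = -nu (J x) := by
  apply LinearMap.ext; intro y
  simp [nu_apply, hs]

theorem cov01_J (hJ : ∀ x, J (J x) = -x) (x : V) :
    cov01 J (J x) = -Complex.I • cov01 J x := by
  simp only [cov01, hJ, map_neg, smul_neg, smul_add, smul_smul, neg_mul, Complex.I_mul_I]
  module

/-- By skewness the two slots of the form contribute equally, whence the factor `2`. -/
theorem iota_varpiVar (hs : ∀ x y, ⟪J x, y⟫_ℝ = -⟪x, J y⟫_ℝ) (x : V) :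
    iota x (varpiVar e J) = (2 : ℂ) • cov (nu (J x)) := by
  have h0 : ∀ j k, iota x (cov (coord e j) * cov (coord e k)) =
      (coord e j x : ℂ) • cov (coord e k) - (coord e k x : ℂ) • cov (coord e j) := by
    intro j k
    rw [iota_cov_mul, iota_cov, mul_smul_comm, mul_one]
  have h : ∀ y : V, (cov (nu y) : Forms V) = ∑ k, (⟪y, e k⟫_ℝ : ℂ) • cov (coord e k) :=
    fun y => (sum_inner_smul_cov_coord e y).symm
  have hv : varpiVar e J = ∑ j, ∑ k, (⟪J (e j), e k⟫_ℝ : ℂ) • (cov (coord e j) * cov (coord e k)) :=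
    rfl
  rw [hv]
  simp only [map_sum, map_smul, h0, smul_sub, Finset.sum_sub_distrib]
  have h1 : ∑ j, ∑ k, (⟪J (e j), e k⟫_ℝ : ℂ) • (coord e j x : ℂ) • cov (coord e k)
      = (cov (nu (J x)) : Forms V) := by
    rw [Finset.sum_comm, h]
    refine Finset.sum_congr rfl fun k _ => ?_
    simp only [smul_smul, ← Finset.sum_smul]
    congr 1
    conv_rhs => rw [← e.sum_repr' x]
    simp [sum_inner, inner_smul_left, coord_apply, mul_comm]
  have h2 : ∑ j, ∑ k, (⟪J (e j), e k⟫_ℝ : ℂ) • (coord e k x : ℂ) • cov (coord e j)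
      = -(cov (nu (J x)) : Forms V) := by
    rw [h, ← Finset.sum_neg_distrib]
    refine Finset.sum_congr rfl fun j _ => ?_
    simp only [smul_smul, ← Finset.sum_smul]
    rw [← neg_smul]
    congr 1
    rw [hs x, real_inner_comm]
    conv_rhs => rw [← e.sum_repr' x]
    simp [inner_sum, inner_smul_right, coord_apply, mul_comm]
  rw [h1, h2, two_smul, sub_neg_eq_add]

theorem dChi_gThetaChi (hs : ∀ x y, ⟪J x, y⟫_ℝ = -⟪x, J y⟫_ℝ) (x : V) :
    dChi x (gThetaChi e J) = (-1 / 2 : ℂ) • inTheta (cov01 J x) := by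
  have h0 : ∀ α β : Module.Dual ℝ V, dChi x (inTheta (cov α) * inChi (cov β)) =
      -((β x : ℂ) • inTheta (cov α)) := by
    intro α β
    rw [dChi_inTheta_cov_mul, dChi_inChi, iota_cov, map_smul, map_one, mul_smul_comm, mul_one]
  have hv : gThetaChi e J = ∑ k, inTheta ((1 / 2 : ℂ) • (cov (coord e k) -
    Complex.I • cov (coord e k ∘ₗ J.toLinearMap))) * inChi (cov (coord e k)) := rfl
  have h1 : ∑ k, (coord e k x : ℂ) • cov (coord e k ∘ₗ J.toLinearMap) = (-cov (nu (J x)) : Forms V) := by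
    have : -nu (J x) = ∑ k, (coord e k x : ℝ) • (coord e k ∘ₗ J.toLinearMap) := by
      rw [← nu_comp hs]
      apply LinearMap.ext; intro y
      have := e.sum_inner_mul_inner x (J y)
      simp [nu_apply, ← this, coord_apply, real_inner_comm]
    rw [← map_neg, this, map_sum]
    exact Finset.sum_congr rfl fun k _ => (cov_smul _ _).symm
  rw [hv]
  simp only [map_sum, map_smul, map_sub, smul_mul_assoc, sub_mul, h0]
  have : cov01 J x = ∑ k, ((coord e k x : ℂ) • cov (coord e k) -
      Complex.I • (coord e k x : ℂ) • cov (coord e k ∘ₗ J.toLinearMap)) := by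
    rw [Finset.sum_sub_distrib, ← Finset.smul_sum, h1, sum_coord_smul_cov_coord, cov01, smul_neg,
      sub_neg_eq_add]
  rw [this, map_sum, Finset.smul_sum]
  refine Finset.sum_congr rfl fun k _ => ?_
  simp only [map_sub, map_smul]
  module

theorem dTheta_gThetaChi (x : V) :
    dTheta x (gThetaChi e J) = (1 / 2 : ℂ) • inChi (cov10 J x) := by
  have h0 : ∀ α β : Module.Dual ℝ V, dTheta x (inTheta (cov α) * inChi (cov β)) =
      (α x : ℂ) • inChi (cov β) := by
    intro α β
    rw [dTheta_inTheta_cov_mul, dTheta_inChi, mul_zero, sub_zero]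
  have hv : gThetaChi e J = ∑ k, inTheta ((1 / 2 : ℂ) • (cov (coord e k) -
    Complex.I • cov (coord e k ∘ₗ J.toLinearMap))) * inChi (cov (coord e k)) := rfl
  rw [hv]
  simp only [map_sum, map_smul, map_sub, smul_mul_assoc, sub_mul, h0]
  have : cov10 J x = ∑ k, ((coord e k x : ℂ) • cov (coord e k) -
      Complex.I • (coord e k (J x) : ℂ) • cov (coord e k)) := by
    rw [Finset.sum_sub_distrib, ← Finset.smul_sum, sum_coord_smul_cov_coord,
      sum_coord_smul_cov_coord, cov10]
  rw [this, map_sum, Finset.smul_sum]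
  refine Finset.sum_congr rfl fun k _ => ?_
  simp only [map_sub, map_smul, LinearMap.comp_apply, ContinuousLinearMap.coe_coe]

end

end FermionQuant

namespace FermionQuant

noncomputable section

attribute [local instance] ringCExt negCExt distribNegCExt addCommGroupCExt

variable {V : Type*} [NormedAddCommGroup V] [InnerProductSpace ℝ V]

/-! ### The reproducing kernel of a quantum Hilbert space -/

variable {n : ℕ} (e : OrthonormalBasis (Fin (2 * n)) ℝ V) (J : V →L[ℝ] V)

/-- The exponent `g(θ^{1,0}, χ) + c ϖ_J(χ)`. -/
def kernelExponent (c : ℂ) : Forms₂ V := gThetaChi e J + c • inChi (varpiVar e J)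

/-- The integral operator `ψ ↦ e^{i/4 ϖ_J(θ)} ∫ exp(g(θ^{1,0}, χ) + i/4 ϖ_J(χ)) ψ(χ) ε̃(χ)`. -/
def kernelOp : Module.End ℂ (Forms V) :=
  LinearMap.mulLeft ℂ (IsNilpotent.exp ((Complex.I / 4) • varpiVar e J)) ∘ₗ berezinChi e ∘ₗ
    LinearMap.mulLeft ℂ (IsNilpotent.exp (kernelExponent e J (Complex.I / 4))) ∘ₗ
      inChi.toLinearMap

variable {e J}

theorem kernelOp_apply (ψ : Forms V) : kernelOp e J ψ =
    IsNilpotent.exp ((Complex.I / 4) • varpiVar e J) *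
      berezinChi e (IsNilpotent.exp (kernelExponent e J (Complex.I / 4)) * inChi ψ) := rfl

theorem kernelExponent_mem_quadr (c : ℂ) :
    kernelExponent e J c ∈ quadr (Module.Dual ℝ V × Module.Dual ℝ V) :=
  add_mem (gThetaChi_mem_quadr J) (Submodule.smul_mem _ _ (inChi_mem_quadr (varpiVar_mem_quadr J)))

theorem dChi_exp_mul (x : V) (c : ℂ) (f : Forms₂ V) :
    dChi x (IsNilpotent.exp (kernelExponent e J c) * f) =
      dChi x (kernelExponent e J c) * (IsNilpotent.exp (kernelExponent e J c) * f) +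
        IsNilpotent.exp (kernelExponent e J c) * dChi x f :=
  ctr_exp_mul _ (kernelExponent_mem_quadr c) f

theorem exp_kernelExponent_mul_comm (c : ℂ) (f g : Forms₂ V) :
    f * (IsNilpotent.exp (kernelExponent e J c) * g) =
      IsNilpotent.exp (kernelExponent e J c) * (f * g) := by
  rw [← mul_assoc, ← mul_assoc, (exp_commute (kernelExponent_mem_quadr c) f).eq]

section

variable (hs : ∀ x y, ⟪J x, y⟫_ℝ = -⟪x, J y⟫_ℝ)
include hs

theorem dChi_kernelExponent (c : ℂ) (x : V) : dChi x (kernelExponent e J c) =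
    (-1 / 2 : ℂ) • inTheta (cov01 J x) + (2 * c) • inChi (cov (nu (J x))) := by
  rw [kernelExponent, map_add, dChi_gThetaChi hs, map_smul, dChi_inChi, iota_varpiVar hs, map_smul,
    smul_smul, mul_comm c]

/-- The identity `cov01 J (J x) = -i cov01 J x` cancels the `θ` terms along `x - iJx`. -/
theorem dChi10_kernelExponent (hJ : ∀ x, J (J x) = -x) (c : ℂ) (x : V) :
    dChi x (kernelExponent e J c) - Complex.I • dChi (J x) (kernelExponent e J c) =
      (2 * Complex.I * c) • inChi (cov10 J x) := by
  rw [dChi_kernelExponent hs, dChi_kernelExponent hs, cov01_J hJ, hJ]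
  simp only [cov10, map_neg, map_sub, map_smul, smul_add, smul_sub, smul_neg, smul_smul]
  have h : Complex.I * (-1 / 2 * -Complex.I) = -1 / 2 := by
    linear_combination (1 / 2 : ℂ) * Complex.I_mul_I
  have h2 : 2 * Complex.I * c * Complex.I = -(2 * c) := by
    linear_combination (2 * c) * Complex.I_mul_I
  rw [h, h2]
  module

theorem dChi01_kernelExponent (hJ : ∀ x, J (J x) = -x) (c : ℂ) (x : V) :
    dChi x (kernelExponent e J c) + Complex.I • dChi (J x) (kernelExponent e J c) =
      (-2 * Complex.I * c) • inChi (cov01 J x) - inTheta (cov01 J x) := by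
  rw [dChi_kernelExponent hs, dChi_kernelExponent hs, cov01_J hJ, hJ, map_smul inTheta]
  simp only [cov01, map_neg, map_add, map_smul inChi, smul_add, smul_neg, smul_smul]
  have h : Complex.I * (-1 / 2 * -Complex.I) = -1 / 2 := by
    linear_combination (1 / 2 : ℂ) * Complex.I_mul_I
  have h2 : -2 * Complex.I * c * Complex.I = 2 * c := by
    linear_combination (-2 * c) * Complex.I_mul_I
  rw [h, h2]
  module

/-- Integration by parts: at `c = i/4` the coefficient `2ic` equals `-½`, that of the wedge term in
`∇`, so the integrand is a total `χ` derivative. -/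
theorem kernelOp_covDeriv10 (hJ : ∀ x, J (J x) = -x) (x : V) (ψ : Forms V) :
    kernelOp e J (covDerivReal x ψ - Complex.I • covDerivReal (J x) ψ) = 0 := by
  set G := kernelExponent e J (Complex.I / 4) with hG
  have h1 : IsNilpotent.exp G *
      inChi (covDerivReal x ψ - Complex.I • covDerivReal (J x) ψ) =
      dChi x (IsNilpotent.exp G * inChi ψ) -
        Complex.I • dChi (J x) (IsNilpotent.exp G * inChi ψ) := by
    have h := dChi10_kernelExponent (e := e) hs hJ (Complex.I / 4) x
    have h' : 2 * Complex.I * (Complex.I / 4) = -1 / 2 := by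
      linear_combination (1 / 2 : ℂ) * Complex.I_mul_I
    rw [h', ← hG] at h
    have e1 : dChi x (IsNilpotent.exp G * inChi ψ) -
        Complex.I • dChi (J x) (IsNilpotent.exp G * inChi ψ) =
        (dChi x G - Complex.I • dChi (J x) G) * (IsNilpotent.exp G * inChi ψ) +
        IsNilpotent.exp G * (inChi (iota x ψ - Complex.I • iota (J x) ψ)) := by
      rw [hG, dChi_exp_mul, dChi_exp_mul, dChi_inChi, dChi_inChi, map_sub, map_smul, sub_mul,
        mul_sub, smul_add, smul_mul_assoc, mul_smul_comm]
      abel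
    have e2 : covDerivReal x ψ - Complex.I • covDerivReal (J x) ψ =
        (-1 / 2 : ℂ) • (cov10 J x * ψ) + (iota x ψ - Complex.I • iota (J x) ψ) := by
      simp only [covDerivReal_apply, cov10, sub_mul, smul_mul_assoc]
      module
    rw [e1, h, smul_mul_assoc, hG, exp_kernelExponent_mul_comm, ← map_mul, e2, map_add, mul_add,
      map_smul, mul_smul_comm]
  rw [kernelOp_apply, ← hG, h1, map_sub, map_smul, berezinChi_dChi, berezinChi_dChi]
  simp

/-- At `c = i/2` the derivative of the exponent along `y + iJy` is the covector `cov01 J y` in `χ`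
minus the same covector in `θ`. Integration by parts therefore moves this factor from `χ` to `θ`. -/
theorem berezinChi_exp_cov01_mul (hJ : ∀ x, J (J x) = -x) (y : V) {φ : Forms V}
    (hφ : iota y φ + Complex.I • iota (J y) φ = 0) :
    berezinChi e (IsNilpotent.exp (kernelExponent e J (Complex.I / 2)) * inChi (cov01 J y * φ)) =
      cov01 J y *
        berezinChi e (IsNilpotent.exp (kernelExponent e J (Complex.I / 2)) * inChi φ) := by
  set G := kernelExponent e J (Complex.I / 2) with hG
  have h := dChi01_kernelExponent (e := e) hs hJ (Complex.I / 2) y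
  have h' : -2 * Complex.I * (Complex.I / 2) = 1 := by
    linear_combination -Complex.I_mul_I
  rw [h', one_smul, ← hG] at h
  have e1 : dChi y (IsNilpotent.exp G * inChi φ) +
      Complex.I • dChi (J y) (IsNilpotent.exp G * inChi φ) =
      (dChi y G + Complex.I • dChi (J y) G) * (IsNilpotent.exp G * inChi φ) +
      IsNilpotent.exp G * (inChi (iota y φ + Complex.I • iota (J y) φ)) := by
    rw [hG, dChi_exp_mul, dChi_exp_mul, dChi_inChi, dChi_inChi, map_add, map_smul, add_mul,
      mul_add, smul_add, smul_mul_assoc, mul_smul_comm]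
    abel
  rw [hφ, map_zero, mul_zero, add_zero, h, sub_mul, exp_kernelExponent_mul_comm, ← map_mul] at e1
  have e2 := congrArg (berezinChi e) e1
  rw [map_add, map_smul, berezinChi_dChi, berezinChi_dChi, smul_zero, add_zero, map_sub,
    eq_comm, sub_eq_zero] at e2
  rw [e2, cov01, map_add, map_smul, add_mul, smul_mul_assoc, map_add, map_smul,
    berezinChi_inTheta_cov_mul, berezinChi_inTheta_cov_mul, add_mul, smul_mul_assoc]

/-- The `θ` derivatives of the Gaussian are combinations of its `χ` derivatives, so the integral
does not depend on `θ`; its value at `θ = 0` is the Pfaffian in `hP`. -/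
theorem berezinChi_exp_kernelExponent (hJ : ∀ x, J (J x) = -x)
    (hP : Complex.I ^ n * aug ((List.ofFn fun i => iota (e i)).prod
      (IsNilpotent.exp ((Complex.I / 2) • varpiVar e J))) = 1) :
    berezinChi e (IsNilpotent.exp (kernelExponent e J (Complex.I / 2))) = 1 := by
  set G := kernelExponent e J (Complex.I / 2) with hG
  have hGq := kernelExponent_mem_quadr (e := e) (J := J) (Complex.I / 2)
  rw [← hG] at hGq
  have hexp : ∀ d, ctr d (IsNilpotent.exp G) = ctr d G * IsNilpotent.exp G := by
    intro d
    have := ctr_exp_mul d hGq 1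
    rwa [ctr_one, mul_zero, add_zero, mul_one] at this
  have hz : ∀ x, berezinChi e (inChi (cov10 J x) * IsNilpotent.exp G) = 0 := by
    intro x
    have h := dChi10_kernelExponent (e := e) hs hJ (Complex.I / 2) x
    have h' : 2 * Complex.I * (Complex.I / 2) = -1 := by
      linear_combination Complex.I_mul_I
    rw [h', ← hG] at h
    have h2 := congrArg (fun f => berezinChi e (f * IsNilpotent.exp G)) h
    simp only [sub_mul, smul_mul_assoc] at h2
    rw [dChi, dChi, ← hexp, ← hexp, map_sub, map_smul, map_smul] at h2
    have h3 := berezinChi_dChi (e := e) x (IsNilpotent.exp G)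
    have h4 := berezinChi_dChi (e := e) (J x) (IsNilpotent.exp G)
    rw [dChi] at h3 h4
    rw [h3, h4, smul_zero, sub_zero] at h2
    exact (smul_eq_zero.mp h2.symm).resolve_left (by norm_num)
  have hi : ∀ k, iota (e k) (berezinChi e (IsNilpotent.exp G)) = 0 := by
    intro k
    rw [iota_berezinChi, dTheta, hexp]
    have : ctr (Module.Dual.eval ℝ V (e k) ∘ₗ LinearMap.fst ℝ _ _) G
        = (1 / 2 : ℂ) • inChi (cov10 J (e k)) := by
      have h5 := dTheta_gThetaChi (e := e) (J := J) (e k)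
      have h6 := dTheta_inChi (e k) (varpiVar e J)
      rw [dTheta] at h5 h6
      rw [hG, kernelExponent, map_add, map_smul, h5, h6, smul_zero, add_zero]
    rw [this, smul_mul_assoc, map_smul, hz, smul_zero]
  rw [eq_aug_smul_one_of_iota_eq_zero e hJ hi, aug_berezinChi, mapC_exp _ hGq]
  have hsnd : mapC (LinearMap.snd ℝ _ _) G = (Complex.I / 2) • varpiVar e J := by
    have h7 : ∀ f : Forms V, mapC (LinearMap.snd ℝ _ _) (inChi f) = f := by
      intro f
      induction f using cext_induction with
      | one => simp
      | add x y hx hy => simp only [map_add, hx, hy]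
      | smul c x hx => simp only [map_smul, hx]
      | cov_mul m x hx =>
        rw [map_mul, map_mul, hx, inChi_cov, mapC_cov]; rfl
    have h8 : ∀ α : Module.Dual ℝ V, mapC (LinearMap.snd ℝ _ _) (inTheta (cov α)) = 0 := by
      intro α
      rw [inTheta_cov, mapC_cov]; exact map_zero _
    have h9 : mapC (LinearMap.snd ℝ _ _) (gThetaChi e J) = 0 := by
      have hv : gThetaChi e J = ∑ k, inTheta ((1 / 2 : ℂ) • (cov (coord e k) -
        Complex.I • cov (coord e k ∘ₗ J.toLinearMap))) * inChi (cov (coord e k)) := rfl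
      rw [hv, map_sum]
      refine Finset.sum_eq_zero fun k _ => ?_
      rw [map_mul, map_smul, map_smul, map_sub, map_sub, map_smul, map_smul, h8, h8]
      simp
    rw [hG, kernelExponent, map_add, map_smul, h7, h9, zero_add]
  rw [hsnd, hP, one_smul]

/-- Forms killed by all `ι_{x+iJx}` are generated from `1` by the covectors `cov01 J y`; the
integral fixes `1` and commutes with these multiplications. -/
theorem berezinChi_exp_mul_of_holomorphic (hJ : ∀ x, J (J x) = -x)
    (hP : Complex.I ^ n * aug ((List.ofFn fun i => iota (e i)).prod
      (IsNilpotent.exp ((Complex.I / 2) • varpiVar e J))) = 1) {φ : Forms V}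
    (hφ : ∀ x, iota x φ + Complex.I • iota (J x) φ = 0) :
    berezinChi e (IsNilpotent.exp (kernelExponent e J (Complex.I / 2)) * inChi φ) = φ := by
  set G := kernelExponent e J (Complex.I / 2) with hG
  -- The idempotent `α ↦ ½ (α + i α ∘ J)` is the one whose number operator contracts along `x +
  -- iJx`.
  have hN : numberOp e J (1 / 2) (Complex.I / 2) φ = 0 := by
    rw [numberOp_apply]
    refine Finset.sum_eq_zero fun k _ => ?_
    have h : (1 / 2 : ℂ) • iota (e k) φ + (Complex.I / 2) • iota (J (e k)) φ =
        (1 / 2 : ℂ) • (iota (e k) φ + Complex.I • iota (J (e k)) φ) := by module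
    rw [h, hφ, smul_zero, mul_zero]
  -- Holomorphy is part of `S`, because moving a covector out of the integral requires it.
  let S : Submodule ℂ (Forms V) := 
    (⨅ x, LinearMap.ker (iota x + Complex.I • iota (J x))) ⊓
      LinearMap.eqLocus (berezinChi e ∘ₗ LinearMap.mulLeft ℂ (IsNilpotent.exp G) ∘ₗ
        inChi.toLinearMap) LinearMap.id
  have hS : ∀ f, f ∈ S ↔ (∀ x, iota x f + Complex.I • iota (J x) f = 0) ∧
      berezinChi e (IsNilpotent.exp G * inChi f) = f := by
    intro f
    simp only [S, Submodule.mem_inf, Submodule.mem_iInf, LinearMap.mem_ker, LinearMap.mem_eqLocus]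
    rfl
  have hmem : φ ∈ S := by
    refine mem_of_numberOp_eq_zero hJ ?_ ?_ ?_ ?_ hN
    · linear_combination (-1 / 4 : ℂ) * Complex.I_mul_I
    · ring
    · rw [hS]
      refine ⟨by simp, ?_⟩
      rw [map_one, mul_one, hG]
      exact berezinChi_exp_kernelExponent hs hJ hP
    · intro α f hf
      rw [hS] at hf
      obtain ⟨y, rfl⟩ : ∃ y, nu y = α := by
        refine ⟨∑ k, α (e k) • e k, ?_⟩
        apply LinearMap.ext
        intro x
        conv_rhs => rw [← e.sum_repr' x]
        simp [nu_apply, mul_comm]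
      have hc : covAffine J (1 - 1 / 2) (-(Complex.I / 2)) (nu y) = (1 / 2 : ℂ) • cov01 J y := by
        rw [covAffine, nu_comp hs, cov01, map_neg]
        module
      rw [hc, smul_mul_assoc]
      refine Submodule.smul_mem _ _ ((hS _).mpr ⟨fun x => ?_, ?_⟩)
      · have h1 : ∀ z : V, iota z (cov01 J y * f) =
            ((⟪y, z⟫_ℝ : ℂ) + Complex.I * (⟪J y, z⟫_ℝ : ℂ)) • f - cov01 J y * iota z f := by
          intro z
          rw [cov01, add_mul, smul_mul_assoc, map_add, map_smul, iota_cov_mul, iota_cov_mul,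
            add_mul, smul_mul_assoc, nu_apply, nu_apply]
          module
        have h2 : (⟪y, x⟫_ℝ : ℂ) + Complex.I * (⟪J y, x⟫_ℝ : ℂ) +
            Complex.I * ((⟪y, J x⟫_ℝ : ℂ) + Complex.I * (⟪J y, J x⟫_ℝ : ℂ)) = 0 := by
          rw [hs y x, hs y (J x), hJ, inner_neg_right]
          push_cast
          linear_combination (⟪y, x⟫_ℝ : ℂ) * Complex.I_mul_I
        have h3 : iota x (cov01 J y * f) + Complex.I • iota (J x) (cov01 J y * f) =
            ((⟪y, x⟫_ℝ : ℂ) + Complex.I * (⟪J y, x⟫_ℝ : ℂ) +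
            Complex.I * ((⟪y, J x⟫_ℝ : ℂ) + Complex.I * (⟪J y, J x⟫_ℝ : ℂ))) • f -
            cov01 J y * (iota x f + Complex.I • iota (J x) f) := by
          rw [h1, h1]
          conv_rhs => rw [mul_add (cov01 J y), mul_smul_comm]
          module
        rw [h3, h2, hf.1, zero_smul, mul_zero, sub_zero]
      · rw [hG, berezinChi_exp_cov01_mul hs hJ y (hf.1 y), ← hG, hf.2]
  exact ((hS φ).mp hmem).2

/-- Multiplication by `exp (-Q)` turns `∇_{x+iJx}` into `ι_{x+iJx}`, so it makes elements of `ℋ_J`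
holomorphic. The factor `exp Q` left over raises the constant of the kernel from `i/4` to `i/2`,
where the reproducing property applies. -/
theorem kernelOp_eq_self (hJ : ∀ x, J (J x) = -x)
    (hP : Complex.I ^ n * aug ((List.ofFn fun i => iota (e i)).prod
      (IsNilpotent.exp ((Complex.I / 2) • varpiVar e J))) = 1) {ψ : Forms V}
    (hψ : ψ ∈ quantumH J) : kernelOp e J ψ = ψ := by
  rw [mem_quantumH_iff hJ] at hψ
  set Q := (Complex.I / 4) • varpiVar e J with hQ
  have hQq : Q ∈ quadr (Module.Dual ℝ V) := Submodule.smul_mem _ _ (varpiVar_mem_quadr J)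
  set φ := IsNilpotent.exp (-Q) * ψ with hφ
  have hψφ : ψ = IsNilpotent.exp Q * φ := by
    rw [hφ, ← mul_assoc, IsNilpotent.exp_mul_exp_neg_self (quadr_isNilpotent hQq), one_mul]
  have hiQ : ∀ x, iota x Q = (Complex.I / 2) • cov (nu (J x)) := by
    intro x
    rw [hQ, map_smul, iota_varpiVar hs, smul_smul]
    congr 1; ring
  have hhol : ∀ x, iota x φ + Complex.I • iota (J x) φ = 0 := by
    intro x
    have h1 : ∀ y, iota y φ = IsNilpotent.exp (-Q) *
        (iota y ψ - (Complex.I / 2) • (cov (nu (J y)) * ψ)) := by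
      intro y
      have hq' : -Q ∈ quadr (Module.Dual ℝ V) := neg_mem hQq
      have h2 : iota y φ = iota y (-Q) * (IsNilpotent.exp (-Q) * ψ) +
        IsNilpotent.exp (-Q) * iota y ψ := ctr_exp_mul _ hq' ψ
      rw [h2, map_neg, hiQ, ← mul_assoc _ (IsNilpotent.exp (-Q)), ← (exp_commute hq' _).eq,
        mul_assoc, ← mul_add]
      congr 1
      rw [neg_mul, smul_mul_assoc]
      abel
    rw [h1, h1, ← mul_smul_comm Complex.I (IsNilpotent.exp (-Q)), ← mul_add, hJ]
    have h4 : iota x ψ - (Complex.I / 2) • (cov (nu (J x)) * ψ) +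
        Complex.I • (iota (J x) ψ - (Complex.I / 2) • (cov (nu (-x)) * ψ)) =
        covDerivReal x ψ + Complex.I • covDerivReal (J x) ψ := by
      have h5 : Complex.I * (Complex.I / 2) = -1 / 2 := by
        linear_combination (1 / 2 : ℂ) * Complex.I_mul_I
      simp only [covDerivReal_apply, map_neg, neg_mul, smul_sub, smul_neg, smul_smul, h5]
      module
    rw [h4, hψ, mul_zero]
  have hexp : IsNilpotent.exp (kernelExponent e J (Complex.I / 4)) * inChi ψ =
      IsNilpotent.exp (kernelExponent e J (Complex.I / 2)) * inChi φ := by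
    have h6 : kernelExponent e J (Complex.I / 2) =
        kernelExponent e J (Complex.I / 4) + inChi Q := by
      rw [kernelExponent, kernelExponent, hQ, map_smul]
      module
    rw [h6, exp_add_quadr (kernelExponent_mem_quadr _) (inChi_mem_quadr hQq), hψφ, map_mul,
      mul_assoc, inChi_eq, mapC_exp _ hQq]
  rw [kernelOp_apply, hexp, berezinChi_exp_mul_of_holomorphic hs hJ hP hhol, ← hQ, ← hψφ]

end

end

end FermionQuant

namespace FermionQuant

noncomputable section

attribute [local instance] ringCExt negCExt distribNegCExt addCommGroupCExt

variable {V : Type*} [NormedAddCommGroup V] [InnerProductSpace ℝ V]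

/-! ### Normalisation of the kernel: the Pfaffian of a complex structure -/

/-! ### The orientation defined by a complex structure -/

section Orientation

variable {W : Type*} [AddCommGroup W] [Module ℝ W]

/-- A real linear map that commutes with a complex structure has non-negative determinant. -/
theorem det_nonneg_of_commute_complex {J L : W →ₗ[ℝ] W} (hJ : ∀ x, J (J x) = -x)
    (hL : ∀ x, L (J x) = J (L x)) : 0 ≤ LinearMap.det L := by
  have hJ' : (J : Module.End ℝ W) * J = -1 := LinearMap.ext fun x => hJ x
  -- `J` makes `W` a complex vector space on which `L` is complex linear; the real determinant is
  -- then the squared modulus of the complex one.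
  let _ : Module ℂ W := Module.compHom W (Complex.liftAux (J : Module.End ℝ W) hJ').toRingHom
  have hsmul : ∀ (c : ℂ) (x : W), c • x = c.re • x + c.im • J x := by
    intro c x
    change (Complex.liftAux (J : Module.End ℝ W) hJ' c) x = _
    simp [Complex.liftAux_apply]
  have : IsScalarTower ℝ ℂ W := ⟨fun r c x => by
    simp [hsmul, smul_add, mul_smul]⟩
  let L' : W →ₗ[ℂ] W :=
    { toFun := L
      map_add' := L.map_add
      map_smul' := by
        intro c x
        simp [hsmul, hL] }
  have h : L = L'.restrictScalars ℝ := rfl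
  rw [h, LinearMap.det_restrictScalars, Algebra.norm_complex_apply]
  exact Complex.normSq_nonneg _

theorem ext_of_adapted {n : ℕ} (B : Module.Basis (Fin (2 * n)) ℝ W) {W' : Type*} [AddCommGroup W']
    [Module ℝ W'] {f g : W →ₗ[ℝ] W'} (h0 : ∀ k : Fin n, f (B ⟨2 * k, by omega⟩) = g (B ⟨2 * k, by omega⟩))
    (h1 : ∀ k : Fin n, f (B ⟨2 * k + 1, by omega⟩) = g (B ⟨2 * k + 1, by omega⟩)) : f = g := by
  refine B.ext fun i => ?_
  rcases Nat.even_or_odd' i.val with ⟨k, hk | hk⟩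
  · have : i = ⟨2 * (⟨k, by omega⟩ : Fin n).val, by simp; omega⟩ := Fin.ext hk
    rw [this]; exact h0 ⟨k, by omega⟩
  · have : i = ⟨2 * (⟨k, by omega⟩ : Fin n).val + 1, by simp; omega⟩ := Fin.ext hk
    rw [this]; exact h1 ⟨k, by omega⟩

/-- The transition map between adapted bases commutes with `J`, so its determinant is positive. -/
theorem adapted_orientation_eq {n : ℕ} {J : W →ₗ[ℝ] W} (hJ : ∀ x, J (J x) = -x)
    (B B' : Module.Basis (Fin (2 * n)) ℝ W)
    (hB : ∀ k : Fin n, B ⟨2 * k + 1, by omega⟩ = J (B ⟨2 * k, by omega⟩))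
    (hB' : ∀ k : Fin n, B' ⟨2 * k + 1, by omega⟩ = J (B' ⟨2 * k, by omega⟩)) :
    B.orientation = B'.orientation := by
  set L := B.equiv B' (Equiv.refl _) with hL
  have hLB : ∀ i, L (B i) = B' i := fun i => by simp [hL]
  have hcomm : ∀ x, L.toLinearMap (J x) = J (L.toLinearMap x) := by
    have : L.toLinearMap ∘ₗ J = J ∘ₗ L.toLinearMap := by
      refine ext_of_adapted B (fun k => ?_) fun k => ?_
      · simp only [LinearMap.comp_apply, LinearEquiv.coe_coe]
        rw [← hB, hLB, hLB, hB']
      · simp only [LinearMap.comp_apply, LinearEquiv.coe_coe]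
        rw [hB, hJ, map_neg, ← hB, hLB, hLB, hB', hJ]
    exact fun x => LinearMap.congr_fun this x
  have hpos : 0 < LinearMap.det L.toLinearMap :=
    lt_of_le_of_ne (det_nonneg_of_commute_complex hJ hcomm) (LinearEquiv.isUnit_det' L).ne_zero.symm
  have hmap : B' = B.map L := by
    refine Module.Basis.eq_of_apply_eq fun i => ?_
    rw [Module.Basis.map_apply, hLB]
  rw [hmap]
  exact ((B.orientation_comp_linearEquiv_eq_iff_det_pos L).mpr hpos).symm

end Orientation

/-! ### Orthonormal bases adapted to a complex structure -/

section Adapted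

variable {J : V →L[ℝ] V}

/-- The vectors `g i` and `J (g i)` span at most `2m < 2n` dimensions, so a unit vector `v`
orthogonal to all of them exists; skewness makes `J v` orthogonal to `v` and to each `g i`. -/
theorem exists_adapted_family [FiniteDimensional ℝ V] {n : ℕ} (hn : Module.finrank ℝ V = 2 * n)
    (hs : ∀ x y, ⟪J x, y⟫_ℝ = -⟪x, J y⟫_ℝ) (m : ℕ) (hm : m ≤ n) :
    ∃ g : Fin m → V, Orthonormal ℝ g ∧ ∀ i j, ⟪J (g i), g j⟫_ℝ = 0 := by
  induction m with
  | zero => exact ⟨Fin.elim0, ⟨fun i => i.elim0, fun i => i.elim0⟩, fun i => i.elim0⟩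
  | succ m ih =>
    obtain ⟨g, hg, hgJ⟩ := ih (by omega)
    set U : Submodule ℝ V := Submodule.span ℝ (Set.range (Sum.elim g fun i => J (g i))) with hU
    have hlt : Module.finrank ℝ U < Module.finrank ℝ V := by
      have h := finrank_range_le_card (R := ℝ) (Sum.elim g fun i => J (g i))
      rw [Set.finrank, ← hU] at h
      simp only [Fintype.card_sum, Fintype.card_fin] at h
      omega
    have hne : Uᗮ ≠ ⊥ := by
      intro h
      have := Submodule.orthogonal_eq_bot_iff.mp h
      rw [this, finrank_top] at hlt
      exact lt_irrefl _ hlt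
    obtain ⟨w, hw, hw0⟩ := Submodule.exists_mem_ne_zero_of_ne_bot hne
    set v := ‖w‖⁻¹ • w with hv
    have hv1 : ‖v‖ = 1 := norm_smul_inv_norm (𝕜 := ℝ) hw0
    have hvU : ∀ u ∈ U, ⟪u, v⟫_ℝ = 0 := by
      intro u hu
      rw [hv, inner_smul_right, (Submodule.mem_orthogonal _ _).mp hw u hu, mul_zero]
    have hvg : ∀ i, ⟪g i, v⟫_ℝ = 0 := fun i => hvU _ (Submodule.subset_span ⟨Sum.inl i, rfl⟩)
    have hvJ : ∀ i, ⟪J (g i), v⟫_ℝ = 0 := fun i => hvU _ (Submodule.subset_span ⟨Sum.inr i, rfl⟩)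
    have hvv : ⟪J v, v⟫_ℝ = 0 := by
      have := hs v v
      have h2 := real_inner_comm v (J v)
      linarith
    refine ⟨Fin.cons v g, ⟨?_, ?_⟩, ?_⟩
    · intro i
      induction i using Fin.cases with
      | zero => exact hv1
      | succ i => exact hg.1 i
    · intro i j hij
      induction i using Fin.cases with
      | zero =>
        induction j using Fin.cases with
        | zero => exact absurd rfl hij
        | succ j => rw [Fin.cons_zero, Fin.cons_succ, real_inner_comm]; exact hvg j
      | succ i =>
        induction j using Fin.cases with
        | zero => exact hvg i
        | succ j => exact hg.2 fun h => hij (congrArg Fin.succ h)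
    · intro i j
      induction i using Fin.cases with
      | zero =>
        induction j using Fin.cases with
        | zero => exact hvv
        | succ j =>
          rw [Fin.cons_zero, Fin.cons_succ, hs, real_inner_comm, hvJ, neg_zero]
      | succ i =>
        induction j using Fin.cases with
        | zero => exact hvJ i
        | succ j => exact hgJ i j

theorem exists_adapted_basis [FiniteDimensional ℝ V] {n : ℕ} (hn : Module.finrank ℝ V = 2 * n)
    (hJ : ∀ x, J (J x) = -x) (hs : ∀ x y, ⟪J x, y⟫_ℝ = -⟪x, J y⟫_ℝ) :
    ∃ f : OrthonormalBasis (Fin (2 * n)) ℝ V,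
      ∀ k : Fin n, f ⟨2 * k + 1, by omega⟩ = J (f ⟨2 * k, by omega⟩) := by
  obtain ⟨g, hg, hgJ⟩ := exists_adapted_family hn hs n le_rfl
  set F : Fin (2 * n) → V := fun i =>
    if i.val % 2 = 0 then g ⟨i / 2, by omega⟩ else J (g ⟨i / 2, by omega⟩) with hF
  have hJJ : ∀ x y, ⟪J x, J y⟫_ℝ = ⟪x, y⟫_ℝ := by
    intro x y; rw [hs, hJ, inner_neg_right, neg_neg]
  have hgg : ∀ i j, ⟪g i, g j⟫_ℝ = if i = j then 1 else 0 := orthonormal_iff_ite.mp hg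
  have hgJ' : ∀ i j, ⟪g i, J (g j)⟫_ℝ = 0 := by
    intro i j; rw [real_inner_comm, hgJ]
  have hon : Orthonormal ℝ F := by
    rw [orthonormal_iff_ite]
    intro i j
    simp only [hF]
    split_ifs with h1 h2 h3 h3 h2 h3 h3
    · subst h3; rw [hgg, if_pos rfl]
    · rw [hgg, if_neg]; intro h; apply h3; ext; have := congrArg Fin.val h; simp at this; omega
    · omega
    · exact hgJ' _ _
    · omega
    · exact hgJ _ _
    · subst h3; rw [hJJ, hgg, if_pos rfl]
    · rw [hJJ, hgg, if_neg]; intro h; apply h3; ext; have := congrArg Fin.val h; simp at this; omega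
  have hcard : Fintype.card (Fin (2 * n)) = Module.finrank ℝ V := by rw [hn, Fintype.card_fin]
  refine ⟨OrthonormalBasis.mk hon
    (hon.linearIndependent.span_eq_top_of_card_eq_finrank' hcard).ge, fun k => ?_⟩
  rw [OrthonormalBasis.coe_mk]
  simp only [hF]
  have e1 : (2 * (k : ℕ) + 1) / 2 = k := by omega
  simp [e1]

end Adapted

/-! ### Evaluation of the Pfaffian -/

section Pfaffian

variable {n : ℕ} {J : V →L[ℝ] V}

/-- A top-degree alternating map is a multiple of the determinant, which is `1` between orthonormal
bases of equal orientation. -/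
theorem alternating_eq_of_orientation_eq {N : Type*} [AddCommGroup N] [Module ℝ N]
    (G : V [⋀^Fin (2 * n)]→ₗ[ℝ] N) (e f : OrthonormalBasis (Fin (2 * n)) ℝ V)
    (h : e.toBasis.orientation = f.toBasis.orientation) : G e = G f := by
  have key : G = (LinearMap.toSpanSingleton ℝ N (G f)).compAlternatingMap f.toBasis.det := by
    refine Module.Basis.ext_alternating f.toBasis fun v hv => ?_
    obtain ⟨σ, rfl⟩ : ∃ σ : Equiv.Perm (Fin (2 * n)), ⇑σ = v :=
      ⟨Equiv.ofBijective v (Finite.injective_iff_bijective.mp hv), rfl⟩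
    have h1 : (fun i => f.toBasis (σ i)) = f.toBasis ∘ σ := rfl
    rw [h1, LinearMap.compAlternatingMap_apply, AlternatingMap.map_perm, AlternatingMap.map_perm,
      Module.Basis.det_self, OrthonormalBasis.coe_toBasis]
    rcases Int.units_eq_one_or (Equiv.Perm.sign σ) with hσ | hσ <;>
      simp [hσ, LinearMap.toSpanSingleton_apply]
  have hdet : f.toBasis.det e = 1 :=
    f.det_to_matrix_orthonormalBasis_of_same_orientation e h.symm
  conv_lhs => rw [key]
  rw [LinearMap.compAlternatingMap_apply, hdet, LinearMap.toSpanSingleton_apply, one_smul]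

/-- Contraction as a real linear map of the direction. -/
def iotaₗ : V →ₗ[ℝ] Module.End ℂ (Forms V) where
  toFun := iota
  map_add' := iota_add
  map_smul' r x := by rw [iota_smul]; rfl

/-- Contractions anticommute and square to zero, so their ordered product is alternating in the
vectors. This permits replacing `e` by a basis adapted to `J`. -/
theorem iota_list_prod_eq_of_orientation_eq (e f : OrthonormalBasis (Fin (2 * n)) ℝ V)
    (h : e.toBasis.orientation = f.toBasis.orientation) :
    (List.ofFn fun i => (iota (e i) : Module.End ℂ (Forms V))).prod =
      (List.ofFn fun i => (iota (f i) : Module.End ℂ (Forms V))).prod := by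
  let Φ : ExteriorAlgebra ℝ V →ₐ[ℝ] Module.End ℂ (Forms V) :=
    ExteriorAlgebra.lift ℝ ⟨iotaₗ, fun x => LinearMap.ext fun f => iota_self x f⟩
  have h1 : ∀ v : Fin (2 * n) → V,
      Φ.toLinearMap.compAlternatingMap (ExteriorAlgebra.ιMulti ℝ (2 * n)) v =
      (List.ofFn fun i => (iota (v i) : Module.End ℂ (Forms V))).prod := by
    intro v
    rw [LinearMap.compAlternatingMap_apply, ExteriorAlgebra.ιMulti_apply, AlgHom.toLinearMap_apply,
      map_list_prod, List.map_ofFn]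
    congr 2
    funext i
    simp only [Function.comp_apply, Φ, ExteriorAlgebra.lift_ι_apply]
    rfl
  rw [← h1, ← h1]
  exact alternating_eq_of_orientation_eq _ e f h

theorem aug_exp_quadr {G : Forms V} (hG : G ∈ quadr (Module.Dual ℝ V)) :
    aug (IsNilpotent.exp G) = 1 := by
  rw [← aug_mapC (0 : Module.Dual ℝ V →ₗ[ℝ] Module.Dual ℝ V), mapC_exp _ hG]
  have : mapC (0 : Module.Dual ℝ V →ₗ[ℝ] Module.Dual ℝ V) G = 0 := by
    induction hG using Submodule.span_induction with
    | mem x hx =>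
      obtain ⟨⟨a, b⟩, rfl⟩ := hx
      simp
    | zero => simp
    | add x y _ _ hx hy => simp [hx, hy]
    | smul c x _ hx => simp [hx]
  rw [this, IsNilpotent.exp_zero, aug_one]

/-- The pair `ι_{g i} ι_{J (g i)}` multiplies `exp Q` by `-i - ν(g i) ν(J (g i))`. For distinct
indices the vectors are orthogonal, so contractions pass the factors produced by the other pairs. -/
theorem iota_pairs_exp (hJ : ∀ x, J (J x) = -x) {Q : Forms V}
    (hQ : Q ∈ quadr (Module.Dual ℝ V)) (hQJ : ∀ x, iota x Q = Complex.I • cov (nu (J x)))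
    {ι : Type*} (g : ι → V) (hg : Orthonormal ℝ g) (hgJ : ∀ i j, ⟪J (g i), g j⟫_ℝ = 0)
    (hs : ∀ x y, ⟪J x, y⟫_ℝ = -⟪x, J y⟫_ℝ)
    {l : List ι} (hl : l.Nodup) :
    (l.map fun i => (iota (g i) * iota (J (g i)) : Module.End ℂ (Forms V))).prod
        (IsNilpotent.exp Q) =
      (l.map fun i => LinearMap.mulLeft ℂ
        (-Complex.I • (1 : Forms V) - cov (nu (g i)) * cov (nu (J (g i))))).prod
          (IsNilpotent.exp Q) := by
  have hexp : ∀ x, iota x (IsNilpotent.exp Q) =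
      Complex.I • (cov (nu (J x)) * IsNilpotent.exp Q) := by
    intro x
    have := ctr_exp_mul (Module.Dual.eval ℝ V x) hQ 1
    rw [ctr_one, mul_zero, add_zero, mul_one] at this
    rw [iota, this, ← smul_mul_assoc, ← hQJ]
    rfl
  have hpass : ∀ (l : List ι) (x : V) (_ : ∀ j ∈ l, ⟪g j, x⟫_ℝ = 0 ∧ ⟪J (g j), x⟫_ℝ = 0)
      (F : Forms V), iota x ((l.map fun i => LinearMap.mulLeft ℂ
        (-Complex.I • (1 : Forms V) - cov (nu (g i)) * cov (nu (J (g i))))).prod F) =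
      (l.map fun i => LinearMap.mulLeft ℂ
        (-Complex.I • (1 : Forms V) - cov (nu (g i)) * cov (nu (J (g i))))).prod (iota x F) := by
    intro l x
    induction l with
    | nil => intro _ F; simp
    | cons j l ih =>
      intro h F
      obtain ⟨h1, h2⟩ := h j List.mem_cons_self
      rw [List.map_cons, List.prod_cons, Module.End.mul_apply, Module.End.mul_apply,
        ← ih fun j' hj' => h j' (List.mem_cons_of_mem _ hj'), LinearMap.mulLeft_apply,
        LinearMap.mulLeft_apply, sub_mul, sub_mul, map_sub, mul_assoc, mul_assoc, iota_cov_mul,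
        iota_cov_mul, nu_apply, nu_apply, h1, h2, smul_mul_assoc, one_mul, map_smul,
        smul_mul_assoc, one_mul]
      simp
  induction l with
  | nil => simp
  | cons i l ih =>
    have hil : i ∉ l := (List.nodup_cons.mp hl).1
    have hne : ∀ j ∈ l, ⟪g j, g i⟫_ℝ = 0 := fun j hj => hg.2 fun h => hil (h ▸ hj)
    have hJJ : ∀ x y, ⟪J x, J y⟫_ℝ = ⟪x, y⟫_ℝ := by
      intro x y; rw [hs, hJ, inner_neg_right, neg_neg]
    rw [List.map_cons, List.prod_cons, Module.End.mul_apply, ih (List.nodup_cons.mp hl).2,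
      Module.End.mul_apply, hpass l (J (g i)), hpass l (g i)]
    · rw [List.map_cons, List.prod_cons]
      have hone : iota (g i) (iota (J (g i)) (IsNilpotent.exp Q)) =
          (-Complex.I • (1 : Forms V) - cov (nu (g i)) * cov (nu (J (g i)))) *
            IsNilpotent.exp Q := by
        have hn : ⟪g i, g i⟫_ℝ = 1 := by rw [real_inner_self_eq_norm_sq, hg.1]; norm_num
        rw [hexp, hJ, map_neg, map_neg, neg_mul, smul_neg, map_neg, map_smul, iota_cov_mul, hexp, nu_apply,
          hn, sub_mul, mul_smul_comm, smul_sub, smul_smul, smul_mul_assoc, one_mul, mul_assoc]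
        rw [smul_smul Complex.I Complex.I, Complex.I_mul_I]
        push_cast
        module
      rw [hone, Module.End.mul_apply]
      have hcomm : ∀ (l : List ι) (G : Forms V) (_ : ∀ f, Commute G f) (F : Forms V),
          (l.map fun i => LinearMap.mulLeft ℂ
            (-Complex.I • (1 : Forms V) - cov (nu (g i)) * cov (nu (J (g i))))).prod (G * F) =
          G * (l.map fun i => LinearMap.mulLeft ℂ
            (-Complex.I • (1 : Forms V) - cov (nu (g i)) * cov (nu (J (g i))))).prod F := by
        intro l G hG F
        induction l with
        | nil => simp
        | cons j l ih =>
          rw [List.map_cons, List.prod_cons, Module.End.mul_apply, ih, Module.End.mul_apply,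
            LinearMap.mulLeft_apply, LinearMap.mulLeft_apply, ← mul_assoc, ← mul_assoc, (hG _).eq]
      rw [hcomm l, LinearMap.mulLeft_apply]
      intro f
      exact ((Commute.one_left f).smul_left _).sub_left
        (quadr_commute (cov_mul_cov_mem_quadr _ _) f)
    · exact fun j hj => ⟨hne j hj, hgJ j i⟩
    · exact fun j hj => ⟨by rw [real_inner_comm, hgJ], by rw [hJJ]; exact hne j hj⟩

/-- In an adapted basis each of the `n` pairs contributes `-i` in degree zero, and `iⁿ (-i)ⁿ = 1`.
Compatibility of `J` with the orientation fixes the sign. -/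
theorem pfaffian_eq_one {o : Orientation ℝ V (Fin (2 * n))} (hJo : J ∈ compatibleJ o)
    {e : OrthonormalBasis (Fin (2 * n)) ℝ V} (he : e.toBasis.orientation = o) :
    Complex.I ^ n * aug ((List.ofFn fun i => iota (e i)).prod
      (IsNilpotent.exp ((Complex.I / 2) • varpiVar e J))) = 1 := by
  obtain ⟨hJ, hiso, B, hBo, hB⟩ := hJo
  have hs := skew_of_isometry hJ hiso
  have : FiniteDimensional ℝ V := e.toBasis.finiteDimensional_of_finite
  have hfr : Module.finrank ℝ V = 2 * n := by
    rw [Module.finrank_eq_card_basis e.toBasis, Fintype.card_fin]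
  obtain ⟨f, hf⟩ := exists_adapted_basis hfr hJ hs
  have hor : e.toBasis.orientation = f.toBasis.orientation := by
    rw [he, ← hBo]
    exact adapted_orientation_eq (J := J.toLinearMap) hJ B f.toBasis hB (by simpa using hf)
  rw [iota_list_prod_eq_of_orientation_eq e f hor]
  set Q := (Complex.I / 2) • varpiVar e J with hQdef
  have hQ : Q ∈ quadr (Module.Dual ℝ V) := Submodule.smul_mem _ _ (varpiVar_mem_quadr J)
  have hQJ : ∀ x, iota x Q = Complex.I • cov (nu (J x)) := by
    intro x
    rw [hQdef, map_smul, iota_varpiVar hs, smul_smul]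
    congr 1; ring
  set g : Fin n → V := fun k => f ⟨2 * k, by omega⟩ with hg
  have hgo : Orthonormal ℝ g :=
    f.orthonormal.comp _ fun a b hab => by
      have := congrArg Fin.val hab
      ext; simpa using this
  have hgJ : ∀ i j, ⟪J (g i), g j⟫_ℝ = 0 := by
    intro i j
    rw [hg]
    simp only
    rw [← hf]
    refine f.orthonormal.2 fun h => ?_
    have := congrArg Fin.val h
    simp only at this
    omega
  have hlist : (List.ofFn fun i => (iota (f i) : Module.End ℂ (Forms V))).prod =
      ((List.finRange n).map fun i =>
        (iota (g i) * iota (J (g i)) : Module.End ℂ (Forms V))).prod := by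
    rw [List.ofFn_mul', List.prod_flatten, List.map_ofFn, List.ofFn_eq_map]
    congr 2
    funext i
    simp [hg, hf]
  rw [hlist, iota_pairs_exp hJ hQ hQJ g hgo hgJ hs (List.nodup_finRange n)]
  have haug : ∀ l : List (Fin n), aug ((l.map fun i => LinearMap.mulLeft ℂ
      (-Complex.I • (1 : Forms V) - cov (nu (g i)) * cov (nu (J (g i))))).prod
        (IsNilpotent.exp Q)) = (-Complex.I) ^ l.length := by
    intro l
    induction l with
    | nil => simpa using aug_exp_quadr hQ
    | cons i l ih =>
      rw [List.map_cons, List.prod_cons, Module.End.mul_apply, LinearMap.mulLeft_apply, sub_mul,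
        map_sub, mul_assoc, aug_cov_mul, smul_mul_assoc, one_mul, map_smul, ih, List.length_cons,
        pow_succ, smul_eq_mul]
      ring
  rw [haug, List.length_finRange, ← mul_pow]
  simp

end Pfaffian

end

end FermionQuant

namespace FermionQuant

noncomputable section

attribute [local instance] ringCExt negCExt distribNegCExt addCommGroupCExt

/-! ### The Hermitian form -/

/-! ### The grade involution and the graded Leibniz rule -/

section Involution

variable {M : Type*} [AddCommGroup M] [Module ℝ M]

/-- The grade involution. -/
def gradeInv : CExt M →ₐ[ℂ] CExt M := mapC (-LinearMap.id)

@[simp] theorem gradeInv_cov (m : M) : gradeInv (cov m) = -cov m := by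
  rw [gradeInv, mapC_cov]; simp

theorem gradeInv_gradeInv (f : CExt M) : gradeInv (gradeInv f) = f := by
  induction f using cext_induction with
  | one => simp
  | add x y hx hy => simp only [map_add, hx, hy]
  | smul c x hx => simp only [map_smul, hx]
  | cov_mul m x hx => rw [map_mul, map_mul, hx]; simp

theorem ctr_neg (d : Module.Dual ℝ M) : ctr (-d) = -ctr d := by
  have h : -d = (-1 : ℝ) • d := by ext; simp
  rw [h, ctr_smul]
  apply LinearMap.ext; intro f
  simp

theorem ctr_gradeInv (d : Module.Dual ℝ M) (f : CExt M) :
    ctr d (gradeInv f) = -gradeInv (ctr d f) := by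
  have h : d ∘ₗ (-LinearMap.id) = -d := by ext; simp
  rw [gradeInv, ctr_mapC, h, ctr_neg, LinearMap.neg_apply, map_neg]

theorem mul_cov (f : CExt M) (m : M) : f * cov m = cov m * gradeInv f := by
  induction f using cext_induction with
  | one => simp
  | add x y hx hy => simp only [add_mul, map_add, mul_add, hx, hy]
  | smul c x hx => simp only [map_smul, smul_mul_assoc, mul_smul_comm, hx]
  | cov_mul m' x hx =>
    rw [mul_assoc, hx, map_mul, gradeInv_cov, neg_mul, mul_neg, ← mul_assoc, ← mul_assoc,
      cov_mul_cov m', neg_mul]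

theorem ctr_mul (d : Module.Dual ℝ M) (f g : CExt M) :
    ctr d (f * g) = ctr d f * g + gradeInv f * ctr d g := by
  induction f using cext_induction with
  | one => simp
  | add x y hx hy => simp only [add_mul, map_add, hx, hy]; abel
  | smul c x hx => simp only [map_smul, smul_mul_assoc, hx, smul_add]
  | cov_mul m x hx =>
    rw [mul_assoc, ctr_cov_mul, hx, ctr_cov_mul, map_mul, gradeInv_cov, sub_mul, mul_add, neg_mul,
      smul_mul_assoc, mul_assoc, neg_mul, mul_assoc]
    abel

theorem aug_gradeInv (f : CExt M) : aug (gradeInv f) = aug f := aug_mapC _ _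

end Involution

variable {V : Type*} [NormedAddCommGroup V] [InnerProductSpace ℝ V]

theorem conjForm_smul (c : ℂ) (f : Forms V) :
    conjForm (c • f) = (starRingEnd ℂ c) • conjForm f := by
  induction f using TensorProduct.induction_on with
  | zero => simp
  | tmul d a => simp [conjForm, TensorProduct.smul_tmul']
  | add x y hx hy => simp only [smul_add, map_add, hx, hy]

theorem conjForm_cov (α : Module.Dual ℝ V) : conjForm (cov α) = (cov α : Forms V) := by
  simp [conjForm, cov_apply]

theorem conjForm_iota (x : V) (f : Forms V) : conjForm (iota x f) = iota x (conjForm f) := by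
  induction f using cext_induction with
  | one => simp
  | add x y hx hy => simp only [map_add, hx, hy]
  | smul c x hx => simp only [map_smul, conjForm_smul, hx]
  | cov_mul m f hf =>
    rw [iota_cov_mul, map_sub, conjForm_smul, map_mul, map_mul, hf, conjForm_cov, iota_cov_mul]
    simp

theorem aug_conjForm (f : Forms V) : aug (conjForm f) = starRingEnd ℂ (aug f) := by
  induction f using cext_induction with
  | one => simp
  | add x y hx hy => simp only [map_add, hx, hy]
  | smul c x hx => simp only [map_smul, conjForm_smul, hx, smul_eq_mul, map_mul]
  | cov_mul m f hf => rw [map_mul, conjForm_cov, aug_cov_mul, aug_cov_mul, map_zero]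

variable {n : ℕ} (e : OrthonormalBasis (Fin (2 * n)) ℝ V)

/-- The complex linear Berezin integral of forms. -/
def berezinC : Forms V →ₗ[ℂ] ℂ :=
  aug ∘ₗ (List.ofFn fun i => (iota (e i) : Module.End ℂ (Forms V))).reverse.prod

/-- The complex linear Hodge star. -/
def starC : Forms V →ₗ[ℂ] Forms V := (hodgeStar₀ e).baseChange ℂ

/-- The volume form as a complex form. -/
def volC : Forms V := (List.ofFn fun i => (cov (coord e i) : Forms V)).prod

theorem herm₀_eq (ψ ψ' : Forms V) : herm₀ e ψ ψ' = berezinC e (conjForm ψ * starC e ψ') := by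
  have h : (Complex.ofRealAm.toLinearMap ∘ₗ berezinForm e).liftBaseChange ℂ = berezinC e := by
    have h1 : ((List.ofFn fun i => contractReal (e i)).reverse.prod).baseChange ℂ
        = (List.ofFn fun i => (iota (e i) : Module.End ℂ (Forms V))).reverse.prod := by
      rw [baseChange_list_prod, List.map_reverse, List.map_ofFn]
      rfl
    rw [berezinC, ← h1]
    apply LinearMap.ext
    intro f
    induction f using TensorProduct.induction_on with
    | zero => simp
    | tmul c a => simp [berezinForm, aug]
    | add x y hx hy => simp only [map_add, hx, hy]
  rw [herm₀, h]
  rfl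

variable {e}

theorem berezinC_gradeInv (f : Forms V) : berezinC e (gradeInv f) = berezinC e f := by
  have h := list_prod_anticommute
    (l := (List.ofFn fun i => (iota (e i) : Module.End ℂ (Forms V))).reverse)
    (T := (gradeInv : Forms V →ₐ[ℂ] Forms V).toLinearMap) (by
      intro d hd f
      obtain ⟨j, rfl⟩ := (List.mem_ofFn' _ _).mp (List.mem_reverse.mp hd)
      exact ctr_gradeInv _ _) f
  rw [List.length_reverse, neg_one_pow_length_ofFn, one_smul] at h
  rw [berezinC, LinearMap.comp_apply, LinearMap.comp_apply, ← aug_gradeInv]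
  conv_rhs => rw [← aug_gradeInv]
  rw [aug_gradeInv]
  exact congrArg aug h

theorem exists_nu_eq (e : OrthonormalBasis (Fin (2 * n)) ℝ V) (α : Module.Dual ℝ V) :
    ∃ y, nu y = α := by
  refine ⟨∑ k, α (e k) • e k, ?_⟩
  apply LinearMap.ext
  intro x
  conv_rhs => rw [← e.sum_repr' x]
  simp [nu_apply, mul_comm]

theorem berezinC_iota (x : V) (f : Forms V) : berezinC e (iota x f) = 0 := by
  have key : ∀ i, berezinC e (iota (e i) f) = 0 := by
    intro i
    have hanti : ∀ d ∈ (List.ofFn fun i => (iota (e i) : Module.End ℂ (Forms V))).reverse,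
        ∀ f, d (iota (e i) f) = -iota (e i) (d f) := by
      intro d hd f
      obtain ⟨j, rfl⟩ := (List.mem_ofFn' _ _).mp (List.mem_reverse.mp hd)
      exact iota_iota _ _ _
    rw [berezinC, LinearMap.comp_apply, list_prod_anticommute hanti, list_prod_absorb _ hanti]
    · simp
    · exact iota_self _
    · exact List.mem_reverse.mpr ((List.mem_ofFn' _ _).mpr ⟨i, rfl⟩)
  rw [iota_eq_sum e, map_sum]
  exact Finset.sum_eq_zero fun k _ => by rw [map_smul, key, smul_zero]

theorem volC_eq : volC e = (1 : ℂ) ⊗ₜ[ℝ] volForm e := by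
  have h := map_list_prod (Algebra.TensorProduct.includeRight :
    RealForms V →ₐ[ℝ] ℂ ⊗[ℝ] RealForms V) (List.ofFn fun i => ExteriorAlgebra.ι ℝ (coord e i))
  rw [List.map_ofFn] at h
  exact h.symm

theorem cov_mul_volC (α : Module.Dual ℝ V) : cov α * volC e = 0 := by
  rw [← sum_smul_cov_coord e α, Finset.sum_mul]
  refine Finset.sum_eq_zero fun k _ => ?_
  rw [smul_mul_assoc, volC_eq, cov_apply, Algebra.TensorProduct.tmul_mul_tmul, volForm,
    ExteriorAlgebra.ι_mul_prod_list, TensorProduct.tmul_zero, smul_zero]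

theorem mul_volC (f : Forms V) : f * volC e = aug f • volC e := by
  induction f using cext_induction with
  | one => simp
  | add x y hx hy => simp only [add_mul, map_add, add_smul, hx, hy]
  | smul c x hx => rw [smul_mul_assoc, hx, map_smul, smul_assoc]
  | cov_mul m f hf => rw [mul_assoc, hf, mul_smul_comm, cov_mul_volC, aug_cov_mul]; simp

theorem berezinC_volC : berezinC e (volC e) = 1 := by
  have h1 : ∀ (l : List (Fin (2 * n))) (i) (_ : i ∉ l),
      iota (e i) (l.map fun i => (cov (coord e i) : Forms V)).prod = 0 := by
    intro l i
    induction l with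
    | nil => intro _; simp
    | cons j l ih =>
      intro hi
      rw [List.mem_cons, not_or] at hi
      rw [List.map_cons, List.prod_cons, iota_cov_mul, ih hi.2, coord_apply,
        e.orthonormal.2 (Ne.symm hi.1)]
      simp
  have h2 : ∀ (l : List (Fin (2 * n))) (_ : l.Nodup),
      (l.map fun i => (iota (e i) : Module.End ℂ (Forms V))).reverse.prod
        (l.map fun i => (cov (coord e i) : Forms V)).prod = 1 := by
    intro l
    induction l with
    | nil => intro _; simp
    | cons j l ih =>
      intro hl
      rw [List.nodup_cons] at hl
      have hn : ⟪e j, e j⟫_ℝ = 1 := by rw [real_inner_self_eq_norm_sq, e.orthonormal.1]; norm_num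
      rw [List.map_cons, List.map_cons, List.reverse_cons, List.prod_append, List.prod_singleton,
        List.prod_cons, Module.End.mul_apply, iota_cov_mul, h1 l j hl.1, coord_apply, hn, mul_zero,
        sub_zero, Complex.ofReal_one, one_smul, ih hl.2]
  have h3 := h2 (List.finRange (2 * n)) (List.nodup_finRange _)
  rw [← List.ofFn_eq_map, ← List.ofFn_eq_map] at h3
  rw [berezinC, LinearMap.comp_apply, volC, h3, aug_one]

theorem dualMetric_nu (x : V) : dualMetric e (nu x) = Module.Dual.eval ℝ V x := by
  apply LinearMap.ext
  intro α
  have h : ∀ i, ⟪x, e i⟫_ℝ * α (e i) = α (⟪e i, x⟫_ℝ • e i) := by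
    intro i; rw [map_smul, smul_eq_mul, real_inner_comm]
  simp only [dualMetric, LinearMap.sum_apply, LinearMap.smulRight_apply, LinearMap.smul_apply,
    Module.Dual.eval_apply, nu_apply, smul_eq_mul, h]
  rw [← map_sum, e.sum_repr']

/-- The star reverses its argument, so a last factor becomes the outermost contraction; the factor
`2` is due to the metric `½ g`. -/
theorem starC_mul_cov (f : Forms V) (x : V) :
    starC e (f * cov (nu x)) = (2 : ℂ) • iota x (starC e f) := by
  induction f using TensorProduct.induction_on with
  | zero => simp
  | tmul c a =>
    have h : hodgeStar₀ e (a * ExteriorAlgebra.ι ℝ (nu x)) =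
        (2 : ℝ) • contractReal x (hodgeStar₀ e a) := by
      have h1 : CliffordAlgebra.reverse (a * ExteriorAlgebra.ι ℝ (nu x)) =
          ExteriorAlgebra.ι ℝ (nu x) * CliffordAlgebra.reverse a := by
        rw [CliffordAlgebra.reverse.map_mul]
        congr 1
        exact CliffordAlgebra.reverse_ι _
      simp only [hodgeStar₀, LinearMap.comp_apply, h1, AlgHom.toLinearMap_apply, map_mul,
        LinearMap.applyₗ_apply_apply, Module.End.mul_apply]
      rw [sharpContract, ExteriorAlgebra.lift_ι_apply]
      simp only [LinearMap.comp_apply, LinearMap.smul_apply, dualMetric_nu, map_smul]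
      exact smul_comm _ _ _
    rw [starC, cov_apply, Algebra.TensorProduct.tmul_mul_tmul, mul_one, LinearMap.baseChange_tmul,
      LinearMap.baseChange_tmul, h, iota, ctr, LinearMap.baseChange_tmul, TensorProduct.tmul_smul]
    rfl
  | add f g hf hg => simp only [add_mul, map_add, hf, hg, smul_add]

theorem starC_one : starC e 1 = ((2 : ℂ) ^ n)⁻¹ • volC e := by
  rw [starC, Algebra.TensorProduct.one_def, LinearMap.baseChange_tmul, volC_eq,
    TensorProduct.smul_tmul', smul_eq_mul, mul_one, hodgeStar₀]
  simp only [LinearMap.comp_apply, AlgHom.toLinearMap_apply, LinearMap.applyₗ_apply_apply,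
    CliffordAlgebra.reverse.map_one, map_one, Module.End.one_apply]
  rw [← TensorProduct.smul_tmul, Complex.real_smul]
  push_cast
  rw [mul_one]

theorem cov_mul_eq (m : Module.Dual ℝ V) (f : Forms V) : cov m * f = gradeInv f * cov m := by
  rw [mul_cov, gradeInv_gradeInv]

theorem gradeInv_volC : gradeInv (volC e) = volC e := by
  have h : ∀ l : List (Module.Dual ℝ V), gradeInv (l.map fun α => (cov α : Forms V)).prod =
      (-1 : ℂ) ^ l.length • (l.map fun α => (cov α : Forms V)).prod := by
    intro l
    induction l with
    | nil => simp
    | cons α l ih =>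
      rw [List.map_cons, List.prod_cons, map_mul, ih, gradeInv_cov, neg_mul, List.length_cons,
        mul_smul_comm, pow_succ]
      module
  have := h (List.ofFn (coord e))
  rw [List.map_ofFn, neg_one_pow_length_ofFn, one_smul] at this
  exact this

/-- The star sends degree `k` to degree `2n - k` and so preserves parity. -/
theorem starC_gradeInv (f : Forms V) : starC e (gradeInv f) = gradeInv (starC e f) := by
  have key : ∀ f : Forms V, starC e (gradeInv f) = gradeInv (starC e f) ∧ 
      starC e f = gradeInv (starC e (gradeInv f)) := by
    intro f
    induction f using cext_induction with
    | one => simp [starC_one, gradeInv_volC]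
    | add x y hx hy =>
      constructor
      · simp only [map_add, hx.1, hy.1]
      · simp only [map_add, ← hx.2, ← hy.2]
    | smul c x hx =>
      constructor
      · simp only [map_smul, hx.1]
      · simp only [map_smul, ← hx.2]
    | cov_mul m f hf =>
      obtain ⟨y, rfl⟩ := exists_nu_eq e m
      have h1 : starC e (gradeInv (cov (nu y) * f)) =
          gradeInv (starC e (cov (nu y) * f)) := by
        rw [cov_mul_eq, map_mul, gradeInv_gradeInv, gradeInv_cov, mul_neg, map_neg, starC_mul_cov,
          starC_mul_cov, hf.1, map_smul, iota, ctr_gradeInv, map_neg, gradeInv_gradeInv, smul_neg]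
      exact ⟨h1, by rw [h1, gradeInv_gradeInv]⟩
  exact (key f).1

theorem herm₀_add_right (ψ f g : Forms V) : herm₀ e ψ (f + g) = herm₀ e ψ f + herm₀ e ψ g := by
  simp only [herm₀_eq, map_add, mul_add]

theorem herm₀_smul_right (c : ℂ) (ψ f : Forms V) : herm₀ e ψ (c • f) = c * herm₀ e ψ f := by
  simp only [herm₀_eq, map_smul, mul_smul_comm, smul_eq_mul]

theorem herm₀_add_left (f g ψ : Forms V) : herm₀ e (f + g) ψ = herm₀ e f ψ + herm₀ e g ψ := by
  simp only [herm₀_eq, map_add, add_mul]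

theorem herm₀_smul_left (c : ℂ) (f ψ : Forms V) :
    herm₀ e (c • f) ψ = starRingEnd ℂ c * herm₀ e f ψ := by
  simp only [herm₀_eq, conjForm_smul, smul_mul_assoc, map_smul, smul_eq_mul]

theorem herm₀_zero_right (ψ : Forms V) : herm₀ e ψ 0 = 0 := by
  simp [herm₀_eq]

theorem herm₀_zero_left (ψ : Forms V) : herm₀ e 0 ψ = 0 := by
  simp [herm₀_eq]

theorem herm₀_sub_right (ψ f g : Forms V) : herm₀ e ψ (f - g) = herm₀ e ψ f - herm₀ e ψ g := by
  simp only [herm₀_eq, map_sub, mul_sub]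

theorem herm₀_sub_left (f g ψ : Forms V) : herm₀ e (f - g) ψ = herm₀ e f ψ - herm₀ e g ψ := by
  simp only [herm₀_eq, map_sub, sub_mul]

/-- The integral of a contraction vanishes; expanding it by the graded Leibniz rule shows that `ν(x)
∧` and `2 ι_x` are adjoint. -/
theorem herm₀_cov_right (ψ ψ' : Forms V) (x : V) :
    herm₀ e ψ (cov (nu x) * ψ') = 2 * herm₀ e (iota x ψ) ψ' := by
  rw [herm₀_eq, herm₀_eq, cov_mul_eq, starC_mul_cov, starC_gradeInv, mul_smul_comm, map_smul,
    smul_eq_mul, conjForm_iota]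
  congr 1
  have h := berezinC_iota (e := e) x (gradeInv (conjForm ψ) * gradeInv (starC e ψ'))
  rw [iota, ctr_mul, gradeInv_gradeInv, map_add, add_eq_zero_iff_neg_eq, ctr_gradeInv, neg_mul,
    map_neg, neg_neg, ← map_mul, berezinC_gradeInv] at h
  exact h.symm

theorem herm₀_one_right (ψ : Forms V) :
    herm₀ e ψ 1 = ((2 : ℂ) ^ n)⁻¹ * starRingEnd ℂ (aug ψ) := by
  rw [herm₀_eq, starC_one, mul_smul_comm, mul_volC, map_smul, map_smul, berezinC_volC, aug_conjForm,
    smul_eq_mul, smul_eq_mul, mul_one]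

/-- The mirror adjointness is proved by induction and not by symmetry, since `herm₀_conj` is deduced
from the two versions together. -/
theorem herm₀_cov_left (ψ ψ' : Forms V) (x : V) :
    herm₀ e (cov (nu x) * ψ) ψ' = 2 * herm₀ e ψ (iota x ψ') := by
  induction ψ' using cext_induction generalizing ψ with
  | one => rw [herm₀_one_right, aug_cov_mul, iota_one, herm₀_zero_right]; simp
  | add f g hf hg => rw [map_add, herm₀_add_right, herm₀_add_right, hf, hg, mul_add]
  | smul c f hf => rw [map_smul, herm₀_smul_right, herm₀_smul_right, hf]; ring
  | cov_mul m f hf =>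
    obtain ⟨y, rfl⟩ := exists_nu_eq e m
    rw [herm₀_cov_right, iota_cov_mul, iota_cov_mul, herm₀_sub_left, herm₀_smul_left,
      herm₀_sub_right, herm₀_smul_right, hf, herm₀_cov_right, nu_apply, nu_apply,
      real_inner_comm, Complex.conj_ofReal]

theorem herm₀_one_left (ψ : Forms V) : herm₀ e 1 ψ = ((2 : ℂ) ^ n)⁻¹ * aug ψ := by
  induction ψ using cext_induction with
  | one => rw [herm₀_one_right]; simp
  | add f g hf hg => rw [map_add, herm₀_add_right, hf, hg, mul_add]
  | smul c f hf => rw [map_smul, herm₀_smul_right, hf, smul_eq_mul]; ring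
  | cov_mul m f hf =>
    obtain ⟨y, rfl⟩ := exists_nu_eq e m
    rw [herm₀_cov_right, iota_one, herm₀_zero_left, aug_cov_mul]; simp

theorem herm₀_conj (ψ ψ' : Forms V) : starRingEnd ℂ (herm₀ e ψ ψ') = herm₀ e ψ' ψ := by
  induction ψ' using cext_induction generalizing ψ with
  | one => rw [herm₀_one_right, herm₀_one_left]; simp [map_ofNat (starRingEnd ℂ) 2]
  | add f g hf hg => rw [herm₀_add_right, herm₀_add_left, map_add, hf, hg]
  | smul c f hf => rw [herm₀_smul_right, herm₀_smul_left, map_mul, hf]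
  | cov_mul m f hf =>
    obtain ⟨y, rfl⟩ := exists_nu_eq e m
    rw [herm₀_cov_right, herm₀_cov_left, map_mul, hf, map_ofNat]

/-- `ι_x` and `½ ν(x) ∧` are adjoint to each other, so their difference is skew. -/
theorem herm₀_covDerivReal (x : V) (ψ ψ' : Forms V) :
    herm₀ e ψ (covDerivReal x ψ') = -herm₀ e (covDerivReal x ψ) ψ' := by
  have h1 := herm₀_cov_right (e := e) ψ ψ' x
  have h2 := herm₀_cov_left (e := e) ψ ψ' x
  have h3 : starRingEnd ℂ (1 / 2 : ℂ) = 1 / 2 := by simp [map_ofNat (starRingEnd ℂ) 2]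
  rw [covDerivReal_apply, covDerivReal_apply, herm₀_sub_right, herm₀_sub_left, herm₀_smul_right,
    herm₀_smul_left, h1, h2, h3]
  ring

/-- Writing `ψ = ν(x) ∧ a + b` with `ι_x a = ι_x b = 0` gives `⟨ψ, ψ⟩ = 2⟨a, a⟩ + ⟨b, b⟩`. The
induction is on the number of basis covectors that may occur in `ψ`; with none left, `ψ` is a
scalar. -/
theorem herm₀_self_pos {J : V →L[ℝ] V} (hJ : ∀ x, J (J x) = -x) (ψ : Forms V) :
    0 ≤ (herm₀ e ψ ψ).re ∧ ((herm₀ e ψ ψ).re = 0 → ψ = 0) := by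
  have key : ∀ m : ℕ, ∀ ψ : Forms V, (∀ k : Fin (2 * n), m ≤ k → iota (e k) ψ = 0) →
      0 ≤ (herm₀ e ψ ψ).re ∧ ((herm₀ e ψ ψ).re = 0 → ψ = 0) := by
    intro m
    induction m with
    | zero =>
      intro ψ h
      have hψ := eq_aug_smul_one_of_iota_eq_zero e hJ fun k => h k (Nat.zero_le _)
      have h2 : herm₀ e ψ ψ = (((2 : ℝ) ^ n)⁻¹ * Complex.normSq (aug ψ) : ℝ) := by
        conv_lhs => rw [hψ]
        rw [herm₀_smul_left, herm₀_one_left, map_smul, aug_one, smul_eq_mul, mul_one]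
        push_cast
        rw [Complex.normSq_eq_conj_mul_self]
        ring
      rw [h2, Complex.ofReal_re]
      refine ⟨mul_nonneg (by positivity) (Complex.normSq_nonneg _), fun h0 => ?_⟩
      have h3 : aug ψ = 0 := by
        rw [← Complex.normSq_eq_zero]
        exact (mul_eq_zero.mp h0).resolve_left (by positivity)
      rw [hψ, h3, zero_smul]
    | succ m ih =>
      intro ψ h
      by_cases hm : m < 2 * n
      · set x := e ⟨m, hm⟩ with hx
        set a := iota x ψ with ha
        -- This projects `ψ` onto its part without `ν(x)`.
        set b := iota x (cov (nu x) * ψ) with hb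
        have hn : ⟪x, x⟫_ℝ = 1 := by rw [real_inner_self_eq_norm_sq, e.orthonormal.1]; norm_num
        have hab : ψ = cov (nu x) * a + b := by
          rw [hb, iota_cov_mul, nu_apply, hn, Complex.ofReal_one, one_smul]; abel
        have hh : herm₀ e ψ ψ = 2 * herm₀ e a a + herm₀ e b b := by
          have e1 : herm₀ e ψ ψ = herm₀ e ψ (cov (nu x) * a) + herm₀ e ψ b := by
            conv_lhs => rw [hab]
            rw [← hab, ← herm₀_add_right, ← hab]
          have e2 : herm₀ e ψ b = herm₀ e b b := by
            conv_lhs => rw [hab]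
            rw [herm₀_add_left, herm₀_cov_left]
            have : iota x b = 0 := iota_self _ _
            rw [this, herm₀_zero_right]; simp
          rw [e1, e2, herm₀_cov_right]
        have hka : ∀ k : Fin (2 * n), m ≤ k → iota (e k) a = 0 := by
          intro k hk
          rcases Nat.lt_or_ge m k with hlt | hge
          · rw [ha, iota_iota, h k hlt]; simp
          · have : k = ⟨m, hm⟩ := Fin.ext (le_antisymm hge hk)
            rw [this]; exact iota_self _ _
        have hkb : ∀ k : Fin (2 * n), m ≤ k → iota (e k) b = 0 := by
          intro k hk
          rcases Nat.lt_or_ge m k with hlt | hge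
          · have hne : (⟨m, hm⟩ : Fin (2 * n)) ≠ k := fun hh => by
              have := congrArg Fin.val hh; simp at this; omega
            rw [hb, iota_iota, iota_cov_mul, h k hlt, nu_apply, e.orthonormal.2 hne]; simp
          · have : k = ⟨m, hm⟩ := Fin.ext (le_antisymm hge hk)
            rw [this]; exact iota_self _ _
        obtain ⟨pa, za⟩ := ih a hka
        obtain ⟨pb, zb⟩ := ih b hkb
        have hre : (herm₀ e ψ ψ).re = 2 * (herm₀ e a a).re + (herm₀ e b b).re := by
          rw [hh]; simp
        rw [hre]
        refine ⟨by positivity, fun h0 => ?_⟩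
        rw [hab, za (by linarith), zb (by linarith)]
        simp
      · exact ih ψ fun k hk => absurd (lt_of_le_of_lt hk k.2) hm
  exact key (2 * n) ψ fun k hk => absurd k.2 (by omega)

end

end FermionQuant

namespace FermionQuant

noncomputable section

/-! ### One-parameter groups of endomorphisms -/

section Flow

variable {W : Type*} [AddCommGroup W] [Module ℂ W] [FiniteDimensional ℂ W]

theorem eq_of_forall_dual {x y : W} (h : ∀ l : W →ₗ[ℂ] ℂ, l x = l y) : x = y := by
  rw [← sub_eq_zero, ← Module.forall_dual_apply_eq_zero_iff ℂ]
  intro l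
  rw [map_sub, h, sub_self]

omit [FiniteDimensional ℂ W] in
-- The exponential is formed in a normed algebra isomorphic to the endomorphisms. Derivatives are
-- stated through linear functionals, so the chosen norm does not appear in the result.
theorem exists_flow_of_algEquiv {R : Type*} [NormedRing R] [NormedAlgebra ℂ R] [CompleteSpace R]
    [FiniteDimensional ℂ R] (φ : R ≃ₐ[ℂ] Module.End ℂ W) (T : Module.End ℂ W) :
    ∃ U : ℝ → Module.End ℂ W, U 0 = 1 ∧ (∀ s t, U (s + t) = U s * U t) ∧
    (∀ (ψ : W) (l : W →ₗ[ℂ] ℂ) (t : ℝ), HasDerivAt (fun s => l (U s ψ)) (l (T (U t ψ))) t) ∧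
    ∀ (S : Module.End ℂ W) (l : Module.End ℂ W →ₗ[ℂ] ℂ) (t : ℝ),
      HasDerivAt (fun s => l (U (-s) * S * U s)) (l (U (-t) * (S * T - T * S) * U t)) t := by
  have hl : ∀ (l : R →ₗ[ℂ] ℂ) {f : ℝ → R} {f' : R} {t : ℝ}, HasDerivAt f f' t →
      HasDerivAt (fun s => l (f s)) (l f') t := fun l f f' t hf =>
    ((l.toContinuousLinearMap.restrictScalars ℝ).hasFDerivAt (x := f t)).comp_hasDerivAt t hf
  have : FiniteDimensional ℝ R := FiniteDimensional.complexToReal R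
  obtain ⟨M, rfl⟩ := φ.surjective T
  have hd := fun t : ℝ => hasDerivAt_exp_smul_const' (𝕂 := ℝ) M t
  have hdneg : ∀ t : ℝ, HasDerivAt (fun s : ℝ => NormedSpace.exp ((-s) • M))
      (-(NormedSpace.exp ((-t) • M) * M)) t := by
    intro t
    have h := hasDerivAt_exp_smul_const (𝕂 := ℝ) (-M) t
    simpa only [smul_neg, neg_smul, mul_neg] using h
  refine ⟨fun t => φ (NormedSpace.exp (t • M)), by simp, fun s t => ?_, fun ψ l t => ?_,
    fun S l t => ?_⟩
  · have hc : Commute (s • M) (t • M) := ((Commute.refl M).smul_left s).smul_right t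
    let _ : NormedAlgebra ℚ R := NormedAlgebra.restrictScalars ℚ ℂ R
    change φ (NormedSpace.exp ((s + t) • M)) = _
    rw [add_smul, NormedSpace.exp_add_of_commute hc, map_mul]
  · refine (hl (l ∘ₗ LinearMap.applyₗ ψ ∘ₗ φ.toLinearEquiv.toLinearMap) (hd t)).congr_deriv ?_
    change l (φ (M * NormedSpace.exp (t • M)) ψ) = _
    rw [map_mul]
    rfl
  · obtain ⟨S, rfl⟩ := φ.surjective S
    have h := hl (l ∘ₗ φ.toLinearEquiv.toLinearMap) (((hdneg t).mul_const S).mul (hd t))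
    have e2 : (fun s : ℝ => l (φ (NormedSpace.exp ((-s) • M)) * φ S * φ (NormedSpace.exp (s • M))))
        = fun s : ℝ => l (φ (NormedSpace.exp ((-s) • M) * S * NormedSpace.exp (s • M))) := by
      funext s
      rw [map_mul φ, map_mul φ]
    change HasDerivAt (fun s : ℝ =>
      l (φ (NormedSpace.exp ((-s) • M)) * φ S * φ (NormedSpace.exp (s • M)))) _ t
    rw [e2]
    refine HasDerivAt.congr_deriv h ?_
    change l (φ _) = l (φ _ * (φ S * φ M - φ M * φ S) * φ _)
    rw [← map_mul φ, ← map_mul φ, ← map_sub φ, ← map_mul φ, ← map_mul φ]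
    refine congrArg (fun x => l (φ x)) ?_
    noncomm_ring

section

attribute [local instance] Matrix.linftyOpNormedRing Matrix.linftyOpNormedAlgebra

theorem exists_flow (T : Module.End ℂ W) : ∃ U : ℝ → Module.End ℂ W, U 0 = 1 ∧
    (∀ s t, U (s + t) = U s * U t) ∧
    (∀ (ψ : W) (l : W →ₗ[ℂ] ℂ) (t : ℝ), HasDerivAt (fun s => l (U s ψ)) (l (T (U t ψ))) t) ∧
    ∀ (S : Module.End ℂ W) (l : Module.End ℂ W →ₗ[ℂ] ℂ) (t : ℝ),
      HasDerivAt (fun s => l (U (-s) * S * U s)) (l (U (-t) * (S * T - T * S) * U t)) t :=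
  exists_flow_of_algEquiv (R := Matrix (Fin (Module.finrank ℂ W)) (Fin (Module.finrank ℂ W)) ℂ)
    (Matrix.toLinAlgEquiv (Module.finBasis ℂ W)) T

end

end Flow

attribute [local instance] ringCExt negCExt distribNegCExt addCommGroupCExt

variable {V : Type*} [NormedAddCommGroup V] [InnerProductSpace ℝ V]

/-! ### The spin representation of skew-symmetric operators -/

section Spin

variable {n : ℕ} (v : OrthonormalBasis (Fin (2 * n)) ℝ V) (A : V →L[ℝ] V)

/-- The quadratic operator `-½ ∑ ∇_{A v_k} ∇_{v_k}`. -/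
def spinOp : Module.End ℂ (Forms V) :=
  (-1 / 2 : ℂ) • ∑ k, covDerivReal (A (v k)) * covDerivReal (v k)

variable {v A}

theorem spinOp_apply (ψ : Forms V) : spinOp v A ψ =
    (-1 / 2 : ℂ) • ∑ k, covDerivReal (A (v k)) (covDerivReal (v k) ψ) := by
  simp [spinOp]

theorem spinOp_neg (ψ : Forms V) : spinOp v (-A) ψ = -spinOp v A ψ := by
  rw [spinOp_apply, spinOp_apply, ← smul_neg, ← Finset.sum_neg_distrib]
  congr 1
  refine Finset.sum_congr rfl fun k _ => ?_
  rw [neg_apply, map_neg]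
  rfl

theorem covDerivReal_neg (x : V) (ψ : Forms V) : covDerivReal (-x) ψ = -covDerivReal x ψ := by
  rw [map_neg]; rfl

theorem covDerivReal_add (x y : V) (ψ : Forms V) :
    covDerivReal (x + y) ψ = covDerivReal x ψ + covDerivReal y ψ := by
  rw [map_add]; rfl

theorem sum_smul_covDerivReal (c : Fin (2 * n) → ℝ) (w : Fin (2 * n) → V) (ψ : Forms V) :
    ∑ k, (c k : ℂ) • covDerivReal (w k) ψ = covDerivReal (∑ k, c k • w k) ψ := by
  rw [map_sum, LinearMap.sum_apply]
  exact Finset.sum_congr rfl fun k _ => (covDerivReal_smul _ _ _).symm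

/-- Moving `∇_x` through each product by the Clifford relation leaves `∑ (g(A v_k, x) ∇_{v_k} -
g(v_k, x) ∇_{A v_k}) = -2 ∇_{Ax}`, which the prefactor `-½` normalises. -/
theorem spinOp_comm (hA : ∀ x y, ⟪A x, y⟫_ℝ = -⟪x, A y⟫_ℝ) (x : V) (ψ : Forms V) :
    spinOp v A (covDerivReal x ψ) - covDerivReal x (spinOp v A ψ) = covDerivReal (A x) ψ := by
  have h1 : ∀ k, covDerivReal (A (v k)) (covDerivReal (v k) (covDerivReal x ψ)) -
      covDerivReal x (covDerivReal (A (v k)) (covDerivReal (v k) ψ)) =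
      ((⟪A (v k), x⟫_ℝ : ℝ) : ℂ) • covDerivReal (v k) ψ -
        ((⟪v k, x⟫_ℝ : ℝ) : ℂ) • covDerivReal (A (v k)) ψ := by
    intro k
    have e1 := covDerivReal_clifford (v k) x ψ
    have e2 := covDerivReal_clifford (A (v k)) x (covDerivReal (v k) ψ)
    rw [← eq_sub_iff_add_eq] at e1
    rw [← eq_sub_iff_add_eq'] at e2
    rw [e1, e2, map_sub, map_smul]
    module
  rw [spinOp_apply, spinOp_apply, map_smul, map_sum, ← smul_sub, ← Finset.sum_sub_distrib,
    Finset.sum_congr rfl fun k _ => h1 k, Finset.sum_sub_distrib, sum_smul_covDerivReal,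
    sum_smul_covDerivReal]
  have e3 : ∑ k, ⟪A (v k), x⟫_ℝ • v k = -A x := by
    rw [← v.sum_repr' (-A x)]
    refine Finset.sum_congr rfl fun k _ => ?_
    rw [hA, inner_neg_right]
  have e4 : ∑ k, ⟪v k, x⟫_ℝ • A (v k) = A x := by
    conv_rhs => rw [← v.sum_repr' x, map_sum]
    exact Finset.sum_congr rfl fun k _ => (map_smul _ _ _).symm
  rw [e3, e4, covDerivReal_neg]
  module

/-- The operator `U (-s) ∇_{exp (sA) x} U s` is constant in `s`: the motion of the direction cancels
the commutator with the generator. -/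
theorem flow_intertwine (hA : ∀ x y, ⟪A x, y⟫_ℝ = -⟪x, A y⟫_ℝ)
    {U : ℝ → Module.End ℂ (Forms V)} (hU0 : U 0 = 1) (hUadd : ∀ s t, U (s + t) = U s * U t)
    (hU : ∀ (S : Module.End ℂ (Forms V)) (l : Module.End ℂ (Forms V) →ₗ[ℂ] ℂ) (t : ℝ),
      HasDerivAt (fun s => l (U (-s) * S * U s))
        (l (U (-t) * (S * spinOp v A - spinOp v A * S) * U t)) t)
    (t : ℝ) (x : V) (ψ : Forms V) :
    covDerivReal (NormedSpace.exp (t • A) x) (U t ψ) = U t (covDerivReal x ψ) := by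
  have : FiniteDimensional ℝ V := v.toBasis.finiteDimensional_of_finite
  have hcomm : ∀ y, covDerivReal y * spinOp v A - spinOp v A * covDerivReal y =
      (-1 : ℂ) • covDerivReal (A y) := by
    intro y
    apply LinearMap.ext; intro ψ
    have := spinOp_comm (v := v) hA y ψ
    simp only [LinearMap.sub_apply, Module.End.mul_apply, LinearMap.smul_apply]
    rw [← this]; module
  have hE : ∀ (s : ℝ), HasDerivAt (fun s : ℝ => NormedSpace.exp (s • A) x)
      (A (NormedSpace.exp (s • A) x)) s := by
    intro s
    have h := (hasDerivAt_exp_smul_const' (𝕂 := ℝ) A s)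
    have h2 := h.clm_apply (hasDerivAt_const s x)
    simpa using h2
  -- In a fixed basis the product rule involves only scalar coefficients and conjugates of fixed
  -- operators.
  have hexp : ∀ y : V, (covDerivReal y : Module.End ℂ (Forms V)) =
      ∑ k, ((⟪v k, y⟫_ℝ : ℝ) : ℂ) • covDerivReal (v k) := by
    intro y
    conv_lhs => rw [← v.sum_repr' y, map_sum]
    refine Finset.sum_congr rfl fun k _ => ?_
    rw [map_smul]; rfl
  have key : ∀ (l : Module.End ℂ (Forms V) →ₗ[ℂ] ℂ) (t : ℝ),
      HasDerivAt (fun s => l (U (-s) * covDerivReal (NormedSpace.exp (s • A) x) * U s)) 0 t := by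
    intro l t
    have e1 : (fun s => l (U (-s) * covDerivReal (NormedSpace.exp (s • A) x) * U s)) =
        fun s => ∑ k, ((⟪v k, NormedSpace.exp (s • A) x⟫_ℝ : ℝ) : ℂ) *
          l (U (-s) * covDerivReal (v k) * U s) := by
      funext s
      rw [hexp, Finset.mul_sum, Finset.sum_mul, map_sum]
      refine Finset.sum_congr rfl fun k _ => ?_
      rw [mul_smul_comm, smul_mul_assoc, map_smul, smul_eq_mul]
    have hk : ∀ k, HasDerivAt (fun s => ((⟪v k, NormedSpace.exp (s • A) x⟫_ℝ : ℝ) : ℂ) *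
          l (U (-s) * covDerivReal (v k) * U s))
        (((⟪v k, A (NormedSpace.exp (t • A) x)⟫_ℝ : ℝ) : ℂ) *
          l (U (-t) * covDerivReal (v k) * U t) +
          ((⟪v k, NormedSpace.exp (t • A) x⟫_ℝ : ℝ) : ℂ) *
          l (U (-t) * ((-1 : ℂ) • covDerivReal (A (v k))) * U t)) t := by
      intro k
      have h1 : HasDerivAt (fun s => ⟪v k, NormedSpace.exp (s • A) x⟫_ℝ)
          ⟪v k, A (NormedSpace.exp (t • A) x)⟫_ℝ t := by
        have := (hasDerivAt_const t (v k)).inner ℝ (hE t)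
        simpa using this
      have h2 := hU (covDerivReal (v k)) l t
      rw [hcomm] at h2
      exact h1.ofReal_comp.mul h2
    rw [e1]
    have h3 := HasDerivAt.fun_sum fun k (_ : k ∈ Finset.univ) => hk k
    refine h3.congr_deriv ?_
    set y := NormedSpace.exp (t • A) x
    have h4 : ∑ k, ((⟪v k, y⟫_ℝ : ℝ) : ℂ) • covDerivReal (A (v k)) =
        (covDerivReal (A y) : Module.End ℂ (Forms V)) := by
      conv_rhs => rw [← v.sum_repr' y, map_sum, map_sum]
      refine Finset.sum_congr rfl fun k _ => ?_
      rw [map_smul, map_smul]; rfl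
    have h5 : ∀ k, ((⟪v k, A y⟫_ℝ : ℝ) : ℂ) * l (U (-t) * covDerivReal (v k) * U t) +
        ((⟪v k, y⟫_ℝ : ℝ) : ℂ) * l (U (-t) * ((-1 : ℂ) • covDerivReal (A (v k))) * U t) =
        l (U (-t) * (((⟪v k, A y⟫_ℝ : ℝ) : ℂ) • covDerivReal (v k)) * U t) -
        l (U (-t) * (((⟪v k, y⟫_ℝ : ℝ) : ℂ) • covDerivReal (A (v k))) * U t) := by
      intro k
      simp only [mul_smul_comm, smul_mul_assoc, map_smul, smul_eq_mul]
      ring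
    rw [Finset.sum_congr rfl fun k _ => h5 k, Finset.sum_sub_distrib, ← map_sum, ← map_sum,
      ← Finset.sum_mul, ← Finset.sum_mul, ← Finset.mul_sum, ← Finset.mul_sum, h4, ← hexp, sub_self]
  have hconst : U (-t) * covDerivReal (NormedSpace.exp (t • A) x) * U t = covDerivReal x := by
    refine eq_of_forall_dual fun l => ?_
    have h1 := is_const_of_deriv_eq_zero (fun s => (key l s).differentiableAt)
      (fun s => (key l s).deriv) t 0
    rw [h1]
    simp [hU0]
  have hUinv : U t * U (-t) = 1 := by rw [← hUadd, add_neg_cancel, hU0]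
  rw [← hconst, Module.End.mul_apply, Module.End.mul_apply, ← Module.End.mul_apply (U t), hUinv,
    Module.End.one_apply]

/-- The form `β(x, y) = ⟨∇_{Ax} ξ, ∇_y ψ⟩` satisfies `β(Jx, Jx) = -β(x, x)`, since `A` anticommutes
with `J`. Its trace is also invariant under the orthogonal map `J`, hence zero, and this trace is
the product in question up to a factor. -/
theorem spinOp_orthogonal {e : OrthonormalBasis (Fin (2 * n)) ℝ V} {J : V →L[ℝ] V}
    (hJ : ∀ x, J (J x) = -x) (hg : ∀ x y, ⟪J x, J y⟫_ℝ = ⟪x, y⟫_ℝ)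
    (hA : ∀ x, A (J x) = -J (A x)) {ξ ψ : Forms V}
    (hξ : ξ ∈ quantumH J) (hψ : ψ ∈ quantumH J) : herm₀ e ξ (spinOp v A ψ) = 0 := by
  rw [mem_quantumH_iff hJ] at hξ hψ
  have hs := skew_of_isometry hJ hg
  set β : V → V → ℂ := fun x y => herm₀ e (covDerivReal (A x) ξ) (covDerivReal y ψ) with hβ
  have hβJ : ∀ x, β (J x) (J x) = -β x x := by
    intro x
    have e1 : covDerivReal (J x) ψ = Complex.I • covDerivReal x ψ := by
      rw [eq_neg_of_add_eq_zero_left (hψ x), smul_neg, smul_smul, Complex.I_mul_I]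
      module
    have e2 : covDerivReal (A (J x)) ξ = (-Complex.I) • covDerivReal (A x) ξ := by
      rw [hA, covDerivReal_neg, eq_neg_of_add_eq_zero_left (hξ (A x)), smul_neg, smul_smul,
        neg_mul, Complex.I_mul_I]
      module
    simp only [hβ]
    rw [e1, e2, herm₀_smul_left, herm₀_smul_right]
    simp only [map_neg, Complex.conj_I, neg_neg]
    linear_combination herm₀ e (covDerivReal (A x) ξ) (covDerivReal x ψ) * Complex.I_mul_I
  have hsum : ∀ x y, β x y = ∑ k, ((⟪v k, x⟫_ℝ : ℝ) : ℂ) * β (v k) y := by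
    intro x y
    have hx : covDerivReal (A x) ξ = ∑ k, ((⟪v k, x⟫_ℝ : ℝ) : ℂ) • covDerivReal (A (v k)) ξ := by
      rw [sum_smul_covDerivReal]
      congr 2
      conv_lhs => rw [← v.sum_repr' x, map_sum]
      exact Finset.sum_congr rfl fun k _ => map_smul _ _ _
    simp only [hβ]
    rw [hx, herm₀_eq, map_sum, Finset.sum_mul, map_sum]
    refine Finset.sum_congr rfl fun k _ => ?_
    rw [conjForm_smul, smul_mul_assoc, map_smul, smul_eq_mul, Complex.conj_ofReal, herm₀_eq]
  have hsum' : ∀ x y, β x y = ∑ k, ((⟪v k, y⟫_ℝ : ℝ) : ℂ) * β x (v k) := by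
    intro x y
    have hy : covDerivReal y ψ = ∑ k, ((⟪v k, y⟫_ℝ : ℝ) : ℂ) • covDerivReal (v k) ψ := by
      rw [sum_smul_covDerivReal, v.sum_repr' y]
    simp only [hβ]
    rw [hy, herm₀_eq, map_sum, Finset.mul_sum, map_sum]
    refine Finset.sum_congr rfl fun k _ => ?_
    rw [map_smul, mul_smul_comm, map_smul, smul_eq_mul, herm₀_eq]
  have hinv : ∑ k, β (J (v k)) (J (v k)) = ∑ k, β (v k) (v k) := by
    have h1 : ∀ k, β (J (v k)) (J (v k)) =
        ∑ j, -(((⟪J (v j), v k⟫_ℝ : ℝ) : ℂ) * β (v j) (J (v k))) := by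
      intro k
      rw [hsum]
      refine Finset.sum_congr rfl fun j _ => ?_
      rw [hs (v j) (v k)]; push_cast; ring
    rw [Finset.sum_congr rfl fun k _ => h1 k, Finset.sum_comm]
    refine Finset.sum_congr rfl fun j _ => ?_
    rw [hsum' (v j) (v j), Finset.sum_neg_distrib]
    have h2 : ∀ y, ∑ k, ((⟪y, v k⟫_ℝ : ℝ) : ℂ) * β (v j) (J (v k)) = β (v j) (J y) := by
      intro y
      have hy : covDerivReal (J y) ψ = ∑ k, ((⟪y, v k⟫_ℝ : ℝ) : ℂ) • covDerivReal (J (v k)) ψ := by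
        rw [sum_smul_covDerivReal]
        congr 2
        conv_lhs => rw [← v.sum_repr' y, map_sum]
        refine Finset.sum_congr rfl fun k _ => ?_
        rw [map_smul, real_inner_comm]
      simp only [hβ]
      rw [hy, herm₀_eq, map_sum, Finset.mul_sum, map_sum]
      refine Finset.sum_congr rfl fun k _ => ?_
      rw [map_smul, mul_smul_comm, map_smul, smul_eq_mul, herm₀_eq]
    rw [h2, ← hsum' (v j) (v j), hJ]
    simp only [hβ]
    have h3 : covDerivReal (-v j) ψ = (-1 : ℂ) • covDerivReal (v j) ψ := by
      rw [covDerivReal_neg]; module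
    rw [h3, herm₀_smul_right]
    ring
  have hzero : ∑ k, β (v k) (v k) = 0 := by
    rw [Finset.sum_congr rfl fun k _ => hβJ (v k), Finset.sum_neg_distrib] at hinv
    linear_combination (-1 / 2 : ℂ) * hinv
  have h3 : herm₀ e ξ (∑ k, covDerivReal (A (v k)) (covDerivReal (v k) ψ)) =
      ∑ k, -β (v k) (v k) := by
    rw [herm₀_eq, map_sum, Finset.mul_sum, map_sum]
    refine Finset.sum_congr rfl fun k _ => ?_
    rw [← herm₀_eq, herm₀_covDerivReal]
  rw [spinOp_apply, herm₀_smul_right, h3, Finset.sum_neg_distrib, hzero]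
  simp

end Spin

end

end FermionQuant

namespace FermionQuant

noncomputable section

attribute [local instance] ringCExt negCExt distribNegCExt addCommGroupCExt

variable {V : Type*} [NormedAddCommGroup V] [InnerProductSpace ℝ V]

/-! ### One-parameter groups of operators on `V` -/

section OneParameter

variable (A : V →L[ℝ] V)

/-- The one-parameter group `exp (t A)`. -/
def flow (t : ℝ) : V →L[ℝ] V := NormedSpace.exp (t • A)

variable {A} [FiniteDimensional ℝ V]

omit [FiniteDimensional ℝ V] in
theorem flow_zero : flow A 0 = 1 := by simp [flow]

theorem flow_add (s t : ℝ) : flow A (s + t) = flow A s * flow A t := by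
  have : CompleteSpace V := FiniteDimensional.complete ℝ V
  let _ : NormedAlgebra ℚ (V →L[ℝ] V) := NormedAlgebra.restrictScalars ℚ ℝ _
  have hc : Commute (s • A) (t • A) := ((Commute.refl A).smul_left s).smul_right t
  rw [flow, add_smul, NormedSpace.exp_add_of_commute hc, flow, flow]

theorem flow_add_apply (s t : ℝ) (x : V) : flow A (s + t) x = flow A s (flow A t x) := by
  rw [flow_add]; rfl

theorem flow_neg_apply (t : ℝ) (x : V) : flow A t (flow A (-t) x) = x := by
  rw [← flow_add_apply, add_neg_cancel, flow_zero]; rfl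

theorem flow_neg_apply' (t : ℝ) (x : V) : flow A (-t) (flow A t x) = x := by
  rw [← flow_add_apply, neg_add_cancel, flow_zero]; rfl

theorem hasDerivAt_flow (t : ℝ) : HasDerivAt (flow A) (A * flow A t) t := by
  have : CompleteSpace V := FiniteDimensional.complete ℝ V
  exact hasDerivAt_exp_smul_const' (𝕂 := ℝ) A t

theorem hasDerivAt_flow_apply (t : ℝ) (x : V) :
    HasDerivAt (fun s => flow A s x) (A (flow A t x)) t := by
  have h := (hasDerivAt_flow (A := A) t).clm_apply (hasDerivAt_const t x)
  simpa using h

omit [FiniteDimensional ℝ V] in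
theorem flow_neg_operator (t : ℝ) : flow (-A) t = flow A (-t) := by
  simp [flow]

theorem contDiff_flow {m : WithTop ℕ∞} : ContDiff ℝ m (flow A) := by
  have : CompleteSpace V := FiniteDimensional.complete ℝ V
  refine contDiff_iff_contDiffAt.2 fun t => ?_
  exact (NormedSpace.exp_analytic (𝕂 := ℝ) (t • A)).contDiffAt.comp t
    (contDiff_id.smul contDiff_const).contDiffAt

theorem eq_flow_of_hasDerivAt {y : ℝ → V} (hy : ∀ t, HasDerivAt y (A (y t)) t) (t : ℝ) :
    y t = flow A t (y 0) := by
  have : CompleteSpace V := FiniteDimensional.complete ℝ V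
  have hd : ∀ s, HasDerivAt (fun s => flow (-A) s (y s)) 0 s := by
    intro s
    have h1 : HasDerivAt (flow (-A)) (flow (-A) s * (-A)) s :=
      hasDerivAt_exp_smul_const (𝕂 := ℝ) (-A) s
    have h := h1.clm_apply (hy s)
    refine h.congr_deriv ?_
    simp
  have h1 := is_const_of_deriv_eq_zero (fun s => (hd s).differentiableAt)
    (fun s => (hd s).deriv) t 0
  rw [flow_zero, flow_neg_operator] at h1
  have h2 := congrArg (flow A t) h1
  rw [flow_neg_apply] at h2
  exact h2

/-- The right-hand side solves `y' = A y`. For `lam = 0` the quotient is `0` by convention, which is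
the correct value because `h0` then gives `A v = 0`. -/
theorem flow_apply_of_sq {v : V} {lam : ℝ} (hv : A (A v) = -(lam ^ 2) • v)
    (h0 : lam = 0 → A v = 0) (t : ℝ) :
    flow A t v = Real.cos (t * lam) • v + (Real.sin (t * lam) / lam) • A v := by
  have key := eq_flow_of_hasDerivAt (A := A)
    (y := fun t => Real.cos (t * lam) • v + (Real.sin (t * lam) / lam) • A v) (fun t => ?_) t
  · simpa using key.symm
  · have hm : HasDerivAt (fun t : ℝ => t * lam) lam t := by
      simpa using (hasDerivAt_id t).mul_const lam
    have h := (hm.cos.smul_const v).add ((hm.sin.div_const lam).smul_const (A v))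
    refine h.congr_deriv ?_
    rw [map_add, map_smul, map_smul, hv, smul_smul]
    rcases eq_or_ne lam 0 with h' | h'
    · simp [h0 h', h']
    · field_simp
      module

/-- Both sides solve `y' = A y` with the same initial value. -/
theorem flow_anticomm {J : V →L[ℝ] V} (hA : ∀ x, A (J x) = -J (A x)) (t : ℝ) (x : V) :
    flow A t (J x) = J (flow A (-t) x) := by
  have key := eq_flow_of_hasDerivAt (A := A) (y := fun t => J (flow (-A) t x)) (fun t => ?_) t
  · rw [flow_neg_operator] at key
    rw [key, flow_zero]; rfl
  · have h := J.hasFDerivAt.comp_hasDerivAt t (hasDerivAt_flow_apply (A := -A) t x)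
    refine h.congr_deriv ?_
    rw [hA]; simp

theorem inner_flow (hA : ∀ x y, ⟪A x, y⟫_ℝ = -⟪x, A y⟫_ℝ) (t : ℝ) (x y : V) :
    ⟪flow A t x, flow A t y⟫_ℝ = ⟪x, y⟫_ℝ := by
  have hd : ∀ s, HasDerivAt (fun s => ⟪flow A s x, flow A s y⟫_ℝ) 0 s := by
    intro s
    refine ((hasDerivAt_flow_apply s x).inner ℝ (hasDerivAt_flow_apply s y)).congr_deriv ?_
    rw [hA]; ring
  have h1 := is_const_of_deriv_eq_zero (fun s => (hd s).differentiableAt)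
    (fun s => (hd s).deriv) t 0
  rw [h1, flow_zero]; rfl

theorem det_flow_pos (t : ℝ) : 0 < (flow A t).det := by
  have h : flow A t = flow A (t / 2) * flow A (t / 2) := by
    rw [← flow_add, add_halves]
  have h1 : (flow A t).det = (flow A (t / 2)).det ^ 2 := by
    rw [h, sq]
    exact LinearMap.det_comp (flow A (t / 2)).toLinearMap (flow A (t / 2)).toLinearMap
  have h2 : (flow A (t / 2)).det * (flow A (-(t / 2))).det = 1 := by
    rw [ContinuousLinearMap.det, ContinuousLinearMap.det, ← LinearMap.det_comp]
    have : (flow A (t / 2)).toLinearMap ∘ₗ (flow A (-(t / 2))).toLinearMap = LinearMap.id :=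
      LinearMap.ext fun x => flow_neg_apply _ _
    rw [this, LinearMap.det_id]
  rw [h1]
  have : (flow A (t / 2)).det ≠ 0 := left_ne_zero_of_mul_eq_one h2
  positivity

end OneParameter

/-! ### The kernel operator along a spin flow -/

section KernelFlow

variable {n : ℕ} {e v : OrthonormalBasis (Fin (2 * n)) ℝ V} {A J : V →L[ℝ] V}

/-- The Clifford relation between the `(0,1)` direction `x + iJx` and the `(1,0)` direction `y -
iJy`. -/
theorem covDeriv01_covDeriv10 (hJ : ∀ x, J (J x) = -x) (hg : ∀ x y, ⟪J x, J y⟫_ℝ = ⟪x, y⟫_ℝ)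
    (x y : V) (ψ : Forms V) :
    (covDerivReal x (covDerivReal y ψ - Complex.I • covDerivReal (J y) ψ) +
      Complex.I • covDerivReal (J x) (covDerivReal y ψ - Complex.I • covDerivReal (J y) ψ)) +
    (covDerivReal y (covDerivReal x ψ + Complex.I • covDerivReal (J x) ψ) -
      Complex.I • covDerivReal (J y) (covDerivReal x ψ + Complex.I • covDerivReal (J x) ψ)) =
    (-2 * (⟪x, y⟫_ℝ : ℂ) - 2 * Complex.I * (⟪J x, y⟫_ℝ : ℂ)) • ψ := by
  have hs := skew_of_isometry hJ hg
  have h1 := covDerivReal_clifford x y ψ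
  have h2 := covDerivReal_clifford (J x) y ψ
  have h3 := covDerivReal_clifford x (J y) ψ
  have h4 := covDerivReal_clifford (J x) (J y) ψ
  rw [← eq_sub_iff_add_eq] at h1 h2 h3 h4
  have h5 : ⟪x, J y⟫_ℝ = -⟪J x, y⟫_ℝ := by rw [hs, neg_neg]
  simp only [map_sub, map_add, map_smul, h1, h2, h3, h4, hg, h5, smul_sub, smul_add, smul_smul,
    Complex.I_mul_I]
  push_cast
  match_scalars
  all_goals first
    | ring1
    | linear_combination (⟪x, y⟫_ℝ : ℂ) * Complex.I_mul_I

theorem kernelOp_covDerivReal (hJ : ∀ x, J (J x) = -x) (hg : ∀ x y, ⟪J x, J y⟫_ℝ = ⟪x, y⟫_ℝ)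
    (x : V) (ψ : Forms V) : kernelOp e J (covDerivReal x ψ) =
      (1 / 2 : ℂ) • kernelOp e J (covDerivReal x ψ + Complex.I • covDerivReal (J x) ψ) := by
  have h := kernelOp_covDeriv10 (e := e) (skew_of_isometry hJ hg) hJ x ψ
  have h2 : covDerivReal x ψ = (1 / 2 : ℂ) • ((covDerivReal x ψ + Complex.I • covDerivReal (J x) ψ)
      + (covDerivReal x ψ - Complex.I • covDerivReal (J x) ψ)) := by module
  conv_lhs => rw [h2, map_smul, map_add, h, add_zero]

/-- `hψ` trades the `(0,1)` derivative of `ψ` along `x` for a multiple of a `(1,0)` derivative.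
Anticommuting the outer `(0,1)` derivative past it leaves a scalar, as the kernel operator kills the
other order. -/
theorem kernelOp_covDerivReal_covDerivReal (hJ : ∀ x, J (J x) = -x)
    (hg : ∀ x y, ⟪J x, J y⟫_ℝ = ⟪x, y⟫_ℝ) (hA : ∀ x y, ⟪A x, y⟫_ℝ = -⟪x, A y⟫_ℝ)
    (hAJ : ∀ x, A (J x) = -J (A x)) {x : V} {c s : ℝ} (hc : c ≠ 0) {ψ : Forms V}
    (hψ : (c : ℂ) • (covDerivReal x ψ + Complex.I • covDerivReal (J x) ψ) +
      (s : ℂ) • (covDerivReal (A x) ψ - Complex.I • covDerivReal (J (A x)) ψ) = 0) :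
    kernelOp e J (covDerivReal (A x) (covDerivReal x ψ)) =
      ((s / c * ⟪A x, A x⟫_ℝ / 2 : ℝ) : ℂ) • kernelOp e J ψ := by
  have hs := skew_of_isometry hJ hg
  have hK := fun x ψ => kernelOp_covDeriv10 (e := e) hs hJ x ψ
  have hAx : ⟪A x, x⟫_ℝ = 0 := by
    have := hA x x
    rw [real_inner_comm (A x) x] at this
    linarith [real_inner_comm (A x) x]
  have hJAx : ⟪J (A x), x⟫_ℝ = 0 := by
    have h1 : ⟪J (A x), x⟫_ℝ = -⟪J (A x), x⟫_ℝ := by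
      conv_lhs => rw [hs, hA, hAJ, inner_neg_right, neg_neg, real_inner_comm]
    linarith
  have hJAA : ⟪J (A x), A x⟫_ℝ = 0 := by
    have h1 := hs (A x) (A x)
    rw [real_inner_comm (J (A x))] at h1
    linarith [real_inner_comm (J (A x)) (A x)]
  have h01 : covDerivReal x ψ + Complex.I • covDerivReal (J x) ψ =
      ((-(s / c) : ℝ) : ℂ) • (covDerivReal (A x) ψ - Complex.I • covDerivReal (J (A x)) ψ) := by
    have hc' : (c : ℂ) ≠ 0 := by exact_mod_cast hc
    have h := congrArg (fun f => (c : ℂ)⁻¹ • f) (eq_neg_of_add_eq_zero_left hψ)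
    rw [smul_smul, inv_mul_cancel₀ hc', one_smul] at h
    rw [h, smul_neg, smul_smul, ← neg_smul]
    congr 1
    push_cast
    ring
  set T : Forms V →ₗ[ℂ] Forms V :=
    kernelOp e J ∘ₗ (covDerivReal (A x) + Complex.I • covDerivReal (J (A x))) with hT
  -- The scalar vanishes here: `A` and `J A` are skew, so `A x` and `J (A x)` are orthogonal to `x`.
  have e1 : T (covDerivReal x ψ - Complex.I • covDerivReal (J x) ψ) = 0 := by
    have e1 := congrArg (kernelOp e J) (covDeriv01_covDeriv10 hJ hg (A x) x ψ)
    rw [map_add, hK, add_zero, map_smul, hAx, hJAx] at e1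
    refine e1.trans ?_
    simp
  have e2 : T (covDerivReal (A x) ψ - Complex.I • covDerivReal (J (A x)) ψ) =
      (-2 * (⟪A x, A x⟫_ℝ : ℂ)) • kernelOp e J ψ := by
    have e2 := congrArg (kernelOp e J) (covDeriv01_covDeriv10 hJ hg (A x) (A x) ψ)
    rw [map_add, hK, add_zero, map_smul, hJAA] at e2
    refine e2.trans ?_
    simp
  have h2 : covDerivReal x ψ = (1 / 2 : ℂ) • ((covDerivReal x ψ + Complex.I • covDerivReal (J x) ψ)
      + (covDerivReal x ψ - Complex.I • covDerivReal (J x) ψ)) := by module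
  have h3 : T (covDerivReal x ψ) =
      ((s / c * ⟪A x, A x⟫_ℝ : ℝ) : ℂ) • kernelOp e J ψ := by
    rw [h2, map_smul, map_add, e1, add_zero, h01, map_smul, e2, smul_smul, smul_smul]
    congr 1
    push_cast
    ring
  rw [kernelOp_covDerivReal hJ hg]
  change (1 / 2 : ℂ) • T (covDerivReal x ψ) = _
  rw [h3, smul_smul]
  congr 1
  push_cast
  ring

/-- Under the kernel operator the generator acts as `-¼ ∑ lam k tan (t lam k)`, the logarithmic
derivative of `(∏ cos (t lam k))^{1/4}`. -/
theorem kernelOp_flow (hJ : ∀ x, J (J x) = -x) (hg : ∀ x y, ⟪J x, J y⟫_ℝ = ⟪x, y⟫_ℝ)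
    (hA : ∀ x y, ⟪A x, y⟫_ℝ = -⟪x, A y⟫_ℝ) (hAJ : ∀ x, A (J x) = -J (A x))
    {lam : Fin (2 * n) → ℝ} (hv : ∀ k, A (A (v k)) = -(lam k ^ 2) • v k)
    (hcos : ∀ t ∈ Set.Icc (0 : ℝ) 1, ∀ k, 0 < Real.cos (t * lam k))
    {U : ℝ → Module.End ℂ (Forms V)} (hU0 : U 0 = 1)
    (hU : ∀ (ψ : Forms V) (l : Forms V →ₗ[ℂ] ℂ) (t : ℝ),
      HasDerivAt (fun s => l (U s ψ)) (l (spinOp v A (U t ψ))) t)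
    (hUD : ∀ t x ψ, covDerivReal (NormedSpace.exp (t • A) x) (U t ψ) = U t (covDerivReal x ψ))
    {ψ : Forms V} (hψ : ψ ∈ quantumH J) :
    kernelOp e J (U 1 ψ) =
      (((∏ k, Real.cos (lam k)) ^ (1 / 4 : ℝ) : ℝ) : ℂ) • kernelOp e J ψ := by
  have : FiniteDimensional ℝ V := v.toBasis.finiteDimensional_of_finite
  have hAv : ∀ k, ⟪A (v k), A (v k)⟫_ℝ = lam k ^ 2 := by
    intro k
    rw [hA, hv, inner_smul_right, real_inner_self_eq_norm_sq, v.norm_eq_one]; ring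
  have hA0 : ∀ k, lam k = 0 → A (v k) = 0 := by
    intro k hk
    rw [← inner_self_eq_zero (𝕜 := ℝ), hAv, hk]; ring
  rw [mem_quantumH_iff hJ] at hψ
  have hz : ∀ t x, covDerivReal (flow A t x) (U t ψ) +
      Complex.I • covDerivReal (flow A t (J x)) (U t ψ) = 0 := by
    intro t x
    rw [flow, hUD, hUD, ← map_smul, ← map_add, hψ, map_zero]
  -- This is `hz` expressed through the fixed `J`. As `exp (tA) J = J exp (-tA)`, the cosine
  -- multiplies a `(0,1)` derivative and the sine a `(1,0)` derivative.
  have hz' : ∀ t k, (Real.cos (t * lam k) : ℂ) • (covDerivReal (v k) (U t ψ) +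
        Complex.I • covDerivReal (J (v k)) (U t ψ)) +
      ((Real.sin (t * lam k) / lam k : ℝ) : ℂ) • (covDerivReal (A (v k)) (U t ψ) -
        Complex.I • covDerivReal (J (A (v k))) (U t ψ)) = 0 := by
    intro t k
    have h := hz t (v k)
    rw [flow_anticomm hAJ, flow_apply_of_sq (hv k) (hA0 k), flow_apply_of_sq (hv k) (hA0 k),
      neg_mul, Real.cos_neg, Real.sin_neg, map_add J, map_smul J, map_smul J,
      covDerivReal_add, covDerivReal_add, covDerivReal_smul, covDerivReal_smul, covDerivReal_smul,
      covDerivReal_smul, neg_div] at h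
    rw [← h]
    push_cast
    module
  have hKD : ∀ t ∈ Set.Icc (0 : ℝ) 1, ∀ k,
      kernelOp e J (covDerivReal (A (v k)) (covDerivReal (v k) (U t ψ))) =
      ((lam k * Real.tan (t * lam k) / 2 : ℝ) : ℂ) • kernelOp e J (U t ψ) := by
    intro t ht k
    rw [kernelOp_covDerivReal_covDerivReal hJ hg hA hAJ (hcos t ht k).ne' (hz' t k), hAv,
      Real.tan_eq_sin_div_cos]
    congr 3
    rcases eq_or_ne (lam k) 0 with h' | h'
    · simp [h']
    · field_simp
  set L : ℝ → ℝ := fun t => ∑ k, Real.log (Real.cos (t * lam k)) with hL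
  have hLd : ∀ t ∈ Set.Icc (0 : ℝ) 1,
      HasDerivAt L (∑ k, -(lam k * Real.tan (t * lam k))) t := by
    intro t ht
    refine HasDerivAt.fun_sum fun k _ => ?_
    have hm : HasDerivAt (fun t : ℝ => t * lam k) (lam k) t := by
      simpa using (hasDerivAt_id t).mul_const (lam k)
    refine (hm.cos.log (hcos t ht k).ne').congr_deriv ?_
    rw [Real.tan_eq_sin_div_cos]; ring
  refine eq_of_forall_dual fun l => ?_
  -- On `[0, 1]` the integrating factor is `(∏ cos (t lam k))^{-1/4}`.
  set f : ℝ → ℂ := fun t => ((Real.exp (-(1 / 4) * L t) : ℝ) : ℂ) * l (kernelOp e J (U t ψ)) with hf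
  have hfd : ∀ t ∈ Set.Icc (0 : ℝ) 1, HasDerivAt f 0 t := by
    intro t ht
    have h1 := (((hLd t ht).const_mul (-(1 / 4))).exp).ofReal_comp
    have h2 := hU ψ (l ∘ₗ kernelOp e J) t
    refine (h1.mul h2).congr_deriv ?_
    have h3 : l (kernelOp e J (spinOp v A (U t ψ))) =
        ((-(1 / 4) * ∑ k, lam k * Real.tan (t * lam k) : ℝ) : ℂ) * l (kernelOp e J (U t ψ)) := by
      rw [spinOp_apply, map_smul, map_sum, Finset.sum_congr rfl fun k _ => hKD t ht k,
        ← Finset.sum_smul, map_smul, map_smul, smul_eq_mul, smul_eq_mul, ← Complex.ofReal_sum,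
        ← Finset.sum_div]
      push_cast
      ring
    simp only [LinearMap.comp_apply]
    rw [h3, Finset.sum_neg_distrib]
    push_cast
    ring
  have hconst : f 1 = f 0 :=
    constant_of_has_deriv_right_zero
      (fun t ht => (hfd t ht).continuousAt.continuousWithinAt)
      (fun t ht => (hfd t ⟨ht.1, ht.2.le⟩).hasDerivWithinAt) 1 (Set.right_mem_Icc.2 zero_le_one)
  simp only [hf, hL, hU0, zero_mul, Real.cos_zero, Real.log_one, Finset.sum_const_zero, mul_zero,
    Real.exp_zero, Complex.ofReal_one, one_mul, Module.End.one_apply] at hconst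
  have hc1 : ∀ k, 0 < Real.cos (lam k) := fun k => by
    simpa using hcos 1 (Set.right_mem_Icc.2 zero_le_one) k
  rw [map_smul, smul_eq_mul, ← hconst, ← mul_assoc, ← Complex.ofReal_mul,
    Real.rpow_def_of_pos (Finset.prod_pos fun k _ => hc1 k), ← Real.exp_add,
    Real.log_prod fun k _ => (hc1 k).ne']
  have : (∑ k, Real.log (Real.cos (lam k))) * (1 / 4) +
      -(1 / 4) * ∑ k, Real.log (Real.cos (lam k)) = 0 := by ring
  rw [this]
  simp

end KernelFlow

end

end FermionQuant

namespace FermionQuant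

noncomputable section

attribute [local instance] ringCExt negCExt distribNegCExt addCommGroupCExt

variable {V : Type*} [NormedAddCommGroup V] [InnerProductSpace ℝ V]

/-! ### Parallel transport -/

section ParallelTransport

variable {n : ℕ} {e v : OrthonormalBasis (Fin (2 * n)) ℝ V} {A J : V →L[ℝ] V}

theorem flow_operator_comm [FiniteDimensional ℝ V] (t : ℝ) (x : V) :
    A (flow A t x) = flow A t (A x) := by
  have h : Commute A (flow A t) := ((Commute.refl A).smul_right t).exp_right
  exact congrArg (fun f : V →L[ℝ] V => f x) h.eq

/-- `γ t` is the conjugate of `J` by `exp (tA)`, so the flow stays in the fibres; `A` also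
anticommutes with `γ t`, so the velocity is orthogonal to them. -/
theorem isParallelSection_flow (hJ : ∀ x, J (J x) = -x) (hg : ∀ x y, ⟪J x, J y⟫_ℝ = ⟪x, y⟫_ℝ)
    (hA : ∀ x y, ⟪A x, y⟫_ℝ = -⟪x, A y⟫_ℝ) (hAJ : ∀ x, A (J x) = -J (A x))
    {γ : ℝ → V →L[ℝ] V} (hγ : ∀ t x, γ t x = flow A (2 * t) (J x))
    {U : ℝ → Module.End ℂ (Forms V)}
    (hU : ∀ (ψ : Forms V) (l : Forms V →ₗ[ℂ] ℂ) (t : ℝ),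
      HasDerivAt (fun s => l (U s ψ)) (l (spinOp v A (U t ψ))) t)
    (hUD : ∀ t x ψ, covDerivReal (NormedSpace.exp (t • A) x) (U t ψ) = U t (covDerivReal x ψ))
    {ψ : Forms V} (hψ : ψ ∈ quantumH J) : IsParallelSection e γ fun t => U t ψ := by
  have : FiniteDimensional ℝ V := v.toBasis.finiteDimensional_of_finite
  intro t _
  have h1 : ∀ x, γ t (flow A t x) = flow A t (J x) := by
    intro x
    have h := flow_anticomm hAJ (-t) x
    rw [neg_neg] at h
    rw [hγ, ← h, ← flow_add_apply]
    congr 2; ring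
  have h2 : ∀ x, ∃ y, x = flow A t y := fun x => ⟨flow A (-t) x, (flow_neg_apply t x).symm⟩
  have hJt : ∀ x, γ t (γ t x) = -x := by
    intro x
    obtain ⟨y, rfl⟩ := h2 x
    rw [h1, h1, hJ, map_neg]
  have hgt : ∀ x y, ⟪γ t x, γ t y⟫_ℝ = ⟪x, y⟫_ℝ := by
    intro x y
    obtain ⟨x, rfl⟩ := h2 x
    obtain ⟨y, rfl⟩ := h2 y
    rw [h1, h1, inner_flow hA, inner_flow hA, hg]
  have hAt : ∀ x, A (γ t x) = -γ t (A x) := by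
    intro x
    obtain ⟨y, rfl⟩ := h2 x
    rw [h1, flow_operator_comm, flow_operator_comm, h1, hAJ, map_neg]
  have hmem : U t ψ ∈ quantumH (γ t) := by
    rw [mem_quantumH_iff hJt]
    rw [mem_quantumH_iff hJ] at hψ
    intro x
    obtain ⟨y, rfl⟩ := h2 x
    rw [h1, flow, hUD, hUD, ← map_smul, ← map_add, hψ, map_zero]
  exact ⟨hmem, spinOp v A (U t ψ), fun l => (hU ψ l t).hasDerivWithinAt,
    fun ξ hξ => spinOp_orthogonal hJt hgt hAt hξ hmem⟩

theorem hasDerivWithinAt_herm₀ {Δ : ℝ → Forms V} {Δ' : Forms V} {s : Set ℝ} {t : ℝ}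
    (h : ∀ l : Forms V →ₗ[ℂ] ℂ, HasDerivWithinAt (fun s => l (Δ s)) (l Δ') s t) :
    HasDerivWithinAt (fun s => herm₀ e (Δ s) (Δ s)) (herm₀ e Δ' (Δ t) + herm₀ e (Δ t) Δ') s t := by
  have : FiniteDimensional ℝ V := e.toBasis.finiteDimensional_of_finite
  set b := Module.finBasis ℂ (Forms V)
  have hexp : ∀ x y : Forms V, herm₀ e x y =
      ∑ i, ∑ j, starRingEnd ℂ (b.coord i x) * b.coord j y * herm₀ e (b i) (b j) := by
    intro x y
    have hx : ∀ z, herm₀ e x z = ∑ i, starRingEnd ℂ (b.coord i x) * herm₀ e (b i) z := by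
      intro z
      conv_lhs => rw [← b.sum_repr x, herm₀_eq, map_sum, Finset.sum_mul, map_sum]
      refine Finset.sum_congr rfl fun i _ => ?_
      rw [conjForm_smul, smul_mul_assoc, map_smul, smul_eq_mul, herm₀_eq]; rfl
    rw [hx]
    refine Finset.sum_congr rfl fun i _ => ?_
    conv_lhs => rw [← b.sum_repr y, herm₀_eq, map_sum, Finset.mul_sum, map_sum, Finset.mul_sum]
    refine Finset.sum_congr rfl fun j _ => ?_
    rw [map_smul, mul_smul_comm, map_smul, smul_eq_mul, herm₀_eq, mul_assoc]; rfl
  rw [hexp Δ', hexp (Δ t), ← Finset.sum_add_distrib, funext fun s => hexp (Δ s) (Δ s)]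
  refine HasDerivWithinAt.fun_sum fun i _ => ?_
  rw [← Finset.sum_add_distrib]
  refine HasDerivWithinAt.fun_sum fun j _ => ?_
  refine (((h (b.coord i)).star.mul (h (b.coord j))).mul_const _).congr_deriv ?_
  simp only [starRingEnd_apply]
  ring

/-- The difference of two parallel sections lies in the fibre to which its derivative is orthogonal,
so its norm is constant. -/
theorem isParallelTransport_unique {γ : ℝ → V →L[ℝ] V} (hJ : ∀ t x, γ t (γ t x) = -x)
    {ψ ψ₁ ψ₂ : Forms V} (h₁ : IsParallelTransport e γ ψ ψ₁) (h₂ : IsParallelTransport e γ ψ ψ₂) :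
    ψ₁ = ψ₂ := by
  obtain ⟨Ψ, hΨ, hΨ0, rfl⟩ := h₁
  obtain ⟨Φ, hΦ, hΦ0, rfl⟩ := h₂
  set h : ℝ → ℂ := fun s => herm₀ e (Ψ s - Φ s) (Ψ s - Φ s) with hh
  have hd : ∀ t ∈ Set.Icc (0 : ℝ) 1, HasDerivWithinAt h 0 (Set.Icc 0 1) t := by
    intro t ht
    obtain ⟨m1, D1, d1, o1⟩ := hΨ t ht
    obtain ⟨m2, D2, d2, o2⟩ := hΦ t ht
    have hm : Ψ t - Φ t ∈ quantumH (γ t) := sub_mem m1 m2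
    have horth : herm₀ e (Ψ t - Φ t) (D1 - D2) = 0 := by
      rw [herm₀_sub_right, o1 _ hm, o2 _ hm, sub_zero]
    have h3 := hasDerivWithinAt_herm₀ (e := e) (Δ := fun s => Ψ s - Φ s) (Δ' := D1 - D2)
      (s := Set.Icc 0 1) (t := t) fun l => by
        simp only [map_sub]
        exact (d1 l).sub (d2 l)
    rw [← herm₀_conj (Ψ t - Φ t), horth, map_zero, zero_add] at h3
    exact h3
  have hconst : h 1 = h 0 := by
    refine constant_of_has_deriv_right_zero (fun t ht => (hd t ht).continuousWithinAt)
      (fun t ht => ?_) 1 (Set.right_mem_Icc.2 zero_le_one)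
    exact (hd t ⟨ht.1, ht.2.le⟩).mono_of_mem_nhdsWithin (Icc_mem_nhdsGE_of_mem ht)
  have h0 : h 0 = 0 := by rw [hh]; simp only [hΨ0, hΦ0, sub_self, herm₀_zero_left]
  rw [h0] at hconst
  have h1 := (herm₀_self_pos (e := e) (hJ 1) (Ψ 1 - Φ 1)).2
    (by rw [show herm₀ e (Ψ 1 - Φ 1) (Ψ 1 - Φ 1) = 0 from hconst]; rfl)
  exact sub_eq_zero.1 h1

end ParallelTransport

end

end FermionQuant

namespace FermionQuant

noncomputable section

variable {V : Type*} [NormedAddCommGroup V] [InnerProductSpace ℝ V]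

/-! ### Geodesics of `𝒥_g` -/

section Geodesics

variable {n : ℕ} {o : Orientation ℝ V (Fin (2 * n))}

theorem metricJ_self (v : OrthonormalBasis (Fin (2 * n)) ℝ V) {X : V →L[ℝ] V}
    (hX : ∀ x y, ⟪X x, y⟫_ℝ = -⟪x, X y⟫_ℝ) : metricJ X X = ∑ k, (‖X (v k)‖ / 2) ^ 2 := by
  rw [metricJ, LinearMap.trace_eq_sum_inner _ v, Finset.mul_sum]
  refine Finset.sum_congr rfl fun k _ => ?_
  have h := hX (v k) (X (v k))
  rw [real_inner_self_eq_norm_sq] at h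
  simp only [LinearMap.comp_apply, ContinuousLinearMap.coe_coe]
  linarith

/-- Vanishing covariant acceleration means that `γ''` commutes with `γ`. With the second derivative
of `γ² = -1` this makes `γ γ'` constant, and the geodesic equation becomes linear, `γ' = C γ`. -/
theorem exists_generator_of_isGeodesicJ (e : OrthonormalBasis (Fin (2 * n)) ℝ V)
    {γ : ℝ → V →L[ℝ] V} (hγ : IsGeodesicJ o γ) : ∃ A : V →L[ℝ] V,
      (∀ x y, ⟪A x, y⟫_ℝ = -⟪x, A y⟫_ℝ) ∧ (∀ x, A (γ 0 x) = -γ 0 (A x)) ∧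
      (∀ t x, γ t x = flow A (2 * t) (γ 0 x)) := by
  have : FiniteDimensional ℝ V := e.toBasis.finiteDimensional_of_finite
  obtain ⟨hsm, hmem, hacc⟩ := hγ
  have hJ : ∀ t, γ t * γ t = -1 := fun t => ContinuousLinearMap.ext fun x => (hmem t).1 x
  have hs : ∀ t x y, ⟪γ t x, y⟫_ℝ = -⟪x, γ t y⟫_ℝ := fun t =>
    skew_of_isometry (hmem t).1 (hmem t).2.1
  have hd1 : ∀ t, HasDerivAt γ (deriv γ t) t := fun t =>
    (hsm.differentiable (by norm_num) t).hasDerivAt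
  have hsm1 : ContDiff ℝ 1 (deriv γ) := by
    have : ContDiff ℝ (1 + 1) γ := by simpa [one_add_one_eq_two] using hsm
    exact (contDiff_succ_iff_deriv.1 this).2.2
  have hd2 : ∀ t, HasDerivAt (deriv γ) (deriv (deriv γ) t) t := fun t =>
    (hsm1.differentiable (by norm_num) t).hasDerivAt
  have hskew : ∀ {c : ℝ → V →L[ℝ] V} {c' : V →L[ℝ] V} {t : ℝ}, HasDerivAt c c' t →
      (∀ s x y, ⟪c s x, y⟫_ℝ = -⟪x, c s y⟫_ℝ) → ∀ x y, ⟪c' x, y⟫_ℝ = -⟪x, c' y⟫_ℝ := by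
    intro c c' t hc hcs x y
    have e1 := (hc.clm_apply (hasDerivAt_const t x)).inner ℝ (hasDerivAt_const t y)
    have e2 := ((hasDerivAt_const t x).inner ℝ (hc.clm_apply (hasDerivAt_const t y))).neg
    have e3 : (fun s => ⟪c s x, y⟫_ℝ) = -fun s => ⟪x, c s y⟫_ℝ := by
      funext s; exact hcs s x y
    rw [e3] at e1
    simpa using e1.unique e2
  have hs1 : ∀ t x y, ⟪deriv γ t x, y⟫_ℝ = -⟪x, deriv γ t y⟫_ℝ := fun t => hskew (hd1 t) hs
  have hs2 : ∀ t x y, ⟪deriv (deriv γ) t x, y⟫_ℝ = -⟪x, deriv (deriv γ) t y⟫_ℝ :=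
    fun t => hskew (hd2 t) hs1
  have hac : ∀ t, deriv γ t * γ t + γ t * deriv γ t = 0 := by
    intro t
    have h := (hd1 t).mul (hd1 t)
    have e : (γ * γ) = fun _ => (-1 : V →L[ℝ] V) := funext hJ
    rw [e] at h
    exact h.unique (hasDerivAt_const t _)
  have hac2 : ∀ t, deriv (deriv γ) t * γ t + 2 • (deriv γ t * deriv γ t) +
      γ t * deriv (deriv γ) t = 0 := by
    intro t
    have h := ((hd2 t).mul (hd1 t)).add ((hd1 t).mul (hd2 t))
    have e : (deriv γ * γ + γ * deriv γ) = fun _ => (0 : V →L[ℝ] V) := funext hac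
    rw [e] at h
    have h' := h.unique (hasDerivAt_const t _)
    rw [← h', two_nsmul]; abel
  have hcomm : ∀ t, γ t * deriv (deriv γ) t = deriv (deriv γ) t * γ t := by
    intro t
    set J := γ t
    set M := deriv (deriv γ) t
    -- The part of `M` that anticommutes with `J` is a tangent vector; testing the acceleration
    -- against it gives `metricJ X X = 0`.
    set X : V →L[ℝ] V := (1 / 2 : ℝ) • (M + J * M * J) with hX
    have hXs : ∀ x y, ⟪X x, y⟫_ℝ = -⟪x, X y⟫_ℝ := by
      intro x y
      have : ⟪J (M (J x)), y⟫_ℝ = -⟪x, J (M (J y))⟫_ℝ := by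
        rw [hs, hs2, hs]; ring
      have hMs : ⟪M x, y⟫_ℝ = -⟪x, M y⟫_ℝ := hs2 t x y
      simp only [hX, smul_apply, add_apply,
        mul_apply_eq_comp, inner_smul_left, inner_smul_right, inner_add_left,
        inner_add_right, this, hMs]
      simp only [conj_trivial]
      ring
    have hXJ : X * J = -(J * X) := by
      have e1 : J * M * J * J = -(J * M) := by rw [mul_assoc, hJ]; simp
      have e2 : J * (J * M * J) = -(M * J) := by rw [← mul_assoc, ← mul_assoc, hJ]; simp
      rw [hX, smul_mul_assoc, mul_smul_comm, add_mul, mul_add, e1, e2, ← smul_neg]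
      congr 1; abel
    have h0 : metricJ M X = 0 := hacc t X ⟨hXs, fun x => congrArg (fun f : V →L[ℝ] V => f x) hXJ⟩
    have htr : LinearMap.trace ℝ V ((J * M * J).toLinearMap ∘ₗ X.toLinearMap) =
        LinearMap.trace ℝ V (M.toLinearMap ∘ₗ X.toLinearMap) := by
      have e1 : (J * M * J).toLinearMap ∘ₗ X.toLinearMap =
          J.toLinearMap * (M * J * X).toLinearMap := rfl
      have e2 : M.toLinearMap ∘ₗ X.toLinearMap = (M * J * X).toLinearMap * J.toLinearMap := by
        have : M * J * X * J = M * X := by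
          rw [mul_assoc, hXJ, mul_neg, mul_assoc, ← mul_assoc J J, hJ]; simp
        exact congrArg ContinuousLinearMap.toLinearMap this.symm
      rw [e1, e2, LinearMap.trace_mul_comm]
    have hXX : metricJ X X = 0 := by
      have e1 : X.toLinearMap ∘ₗ X.toLinearMap = (1 / 2 : ℝ) • (M.toLinearMap ∘ₗ X.toLinearMap +
          (J * M * J).toLinearMap ∘ₗ X.toLinearMap) := by
        apply LinearMap.ext; intro x
        rfl
      rw [metricJ, e1, map_smul, map_add, htr]
      rw [metricJ] at h0
      rw [smul_eq_mul]; linarith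
    rw [metricJ_self e hXs, Finset.sum_eq_zero_iff_of_nonneg fun k _ => sq_nonneg _] at hXX
    have hX0 : X = 0 := by
      apply ContinuousLinearMap.coe_injective
      refine e.toBasis.ext fun k => ?_
      have := hXX k (Finset.mem_univ k)
      simpa using this
    have hM : M = -(J * M * J) := by
      have := congrArg (fun Y => (2 : ℝ) • Y) hX0
      simp only [hX, smul_smul, smul_zero] at this
      norm_num at this
      exact eq_neg_of_add_eq_zero_left this
    have : J * (J * M * J) = -(M * J) := by rw [← mul_assoc, ← mul_assoc, hJ]; simp
    conv_lhs => rw [hM, mul_neg, this, neg_neg]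
  have hconst : ∀ t, γ t * deriv γ t = γ 0 * deriv γ 0 := by
    intro t
    have h : ∀ s, HasDerivAt (γ * deriv γ) 0 s := by
      intro s
      refine ((hd1 s).mul (hd2 s)).congr_deriv ?_
      have h2 := hac2 s
      rw [← hcomm s] at h2
      have h3 : (2 : ℝ) • (deriv γ s * deriv γ s + γ s * deriv (deriv γ) s) = 0 := by
        rw [← h2, two_smul, two_nsmul]; abel
      exact (smul_eq_zero.1 h3).resolve_left (by norm_num)
    exact is_const_of_deriv_eq_zero (fun s => (h s).differentiableAt) (fun s => (h s).deriv) t 0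
  have hd0 : ∀ t, deriv γ t = -(deriv γ 0 * γ 0) * γ t := by
    intro t
    have h1 : deriv γ 0 * γ 0 = -(γ t * deriv γ t) := by
      rw [hconst t]; exact eq_neg_of_add_eq_zero_left (hac 0)
    have h2 : γ t * deriv γ t = -(deriv γ t * γ t) := eq_neg_of_add_eq_zero_right (hac t)
    rw [h1, h2, neg_neg, neg_mul, mul_assoc, hJ]; simp
  -- Half of `C = -γ'(0) γ(0)`, so that `γ t` is the conjugate of `γ 0` by `flow A t`.
  refine ⟨(-1 / 2 : ℝ) • (deriv γ 0 * γ 0), fun x y => ?_, fun x => ?_, fun t x => ?_⟩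
  · have h : ⟪deriv γ 0 (γ 0 x), y⟫_ℝ = -⟪x, deriv γ 0 (γ 0 y)⟫_ℝ := by
      have h2 : deriv γ 0 (γ 0 y) = -γ 0 (deriv γ 0 y) :=
        congrArg (fun f : V →L[ℝ] V => f y) (eq_neg_of_add_eq_zero_left (hac 0))
      rw [hs1, hs, h2, inner_neg_right]
    simp only [smul_apply, mul_apply_eq_comp, inner_smul_left,
      inner_smul_right, h, conj_trivial]
    ring
  · have h : deriv γ 0 * γ 0 * γ 0 = -(γ 0 * (deriv γ 0 * γ 0)) := by
      have h2 : γ 0 * deriv γ 0 = -(deriv γ 0 * γ 0) := eq_neg_of_add_eq_zero_right (hac 0)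
      rw [← mul_assoc, h2, neg_mul, neg_neg]
    have h' := congrArg (fun f : V →L[ℝ] V => f x) h
    simp only [mul_apply_eq_comp, neg_apply] at h'
    simp only [smul_apply, mul_apply_eq_comp, map_smul, h']
    module
  · set C := -(deriv γ 0 * γ 0) with hC
    have h := eq_flow_of_hasDerivAt (A := C) (y := fun t => γ t x) (fun s => by
      refine ((hd1 s).clm_apply (hasDerivAt_const s x)).congr_deriv ?_
      rw [hd0 s]; simp) t
    rw [h]
    congr 1
    rw [flow, flow]
    congr 1
    rw [hC, smul_smul, smul_neg, ← neg_smul]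
    congr 1; ring

/-- Diagonalising the non-negative symmetric operator `-A²` suffices; no normal form of `A` itself
is needed. -/
theorem exists_eigenbasis (e : OrthonormalBasis (Fin (2 * n)) ℝ V) {A : V →L[ℝ] V}
    (hA : ∀ x y, ⟪A x, y⟫_ℝ = -⟪x, A y⟫_ℝ) :
    ∃ (v : OrthonormalBasis (Fin (2 * n)) ℝ V) (lam : Fin (2 * n) → ℝ),
      (∀ k, 0 ≤ lam k) ∧ ∀ k, A (A (v k)) = -(lam k ^ 2) • v k := by
  have : FiniteDimensional ℝ V := e.toBasis.finiteDimensional_of_finite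
  have hS : (-(A.toLinearMap ∘ₗ A.toLinearMap)).IsSymmetric := by
    intro x y
    simp only [LinearMap.neg_apply, LinearMap.comp_apply, ContinuousLinearMap.coe_coe,
      inner_neg_left, inner_neg_right, hA, neg_neg]
  have hfr : Module.finrank ℝ V = 2 * n := by
    rw [Module.finrank_eq_card_basis e.toBasis, Fintype.card_fin]
  set v := hS.eigenvectorBasis hfr
  have hv : ∀ k, A (A (v k)) = -(hS.eigenvalues hfr k) • v k := by
    intro k
    have h := hS.apply_eigenvectorBasis hfr k
    simp only [LinearMap.neg_apply, LinearMap.comp_apply, ContinuousLinearMap.coe_coe] at h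
    rw [neg_smul, ← neg_eq_iff_eq_neg]
    exact h
  have hpos : ∀ k, 0 ≤ hS.eigenvalues hfr k := by
    intro k
    have h := hA (v k) (A (v k))
    rw [hv, inner_smul_right, real_inner_self_eq_norm_sq, real_inner_self_eq_norm_sq,
      v.norm_eq_one] at h
    nlinarith [sq_nonneg ‖A (v k)‖]
  refine ⟨v, fun k => √(hS.eigenvalues hfr k), fun k => Real.sqrt_nonneg _, fun k => ?_⟩
  rw [Real.sq_sqrt (hpos k)]
  exact hv k

/-- `c` is the conjugate of `J` by `flow A t`, which is orthogonal with positive determinant. -/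
theorem flow_conj_mem_compatibleJ (e : OrthonormalBasis (Fin (2 * n)) ℝ V) {A J c : V →L[ℝ] V}
    (hJ : J ∈ compatibleJ o)
    (hA : ∀ x y, ⟪A x, y⟫_ℝ = -⟪x, A y⟫_ℝ) (hAJ : ∀ x, A (J x) = -J (A x)) (t : ℝ)
    (hc : ∀ x, c x = flow A (2 * t) (J x)) : c ∈ compatibleJ o := by
  have : FiniteDimensional ℝ V := e.toBasis.finiteDimensional_of_finite
  obtain ⟨hJ2, hg, B, hBo, hB⟩ := hJ
  have h1 : ∀ x, c (flow A t x) = flow A t (J x) := by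
    intro x
    have h := flow_anticomm hAJ (-t) x
    rw [neg_neg] at h
    rw [hc, ← h, ← flow_add_apply]
    congr 2; ring
  have h2 : ∀ x, ∃ y, x = flow A t y := fun x => ⟨flow A (-t) x, (flow_neg_apply t x).symm⟩
  refine ⟨fun x => ?_, fun x y => ?_, ?_⟩
  · obtain ⟨y, rfl⟩ := h2 x
    rw [h1, h1, hJ2, map_neg]
  · obtain ⟨x, rfl⟩ := h2 x
    obtain ⟨y, rfl⟩ := h2 y
    rw [h1, h1, inner_flow hA, inner_flow hA, hg]
  · let E : V ≃ₗ[ℝ] V := LinearEquiv.ofLinearMap (flow A t).toLinearMap (flow A (-t)).toLinearMap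
      (LinearMap.ext fun x => flow_neg_apply t x) (LinearMap.ext fun x => flow_neg_apply' t x)
    have hE : ∀ x, E x = flow A t x := fun x => rfl
    refine ⟨B.map E, ?_, fun k => ?_⟩
    · rw [Module.Basis.orientation_map, hBo,
        Orientation.map_eq_iff_det_pos _ _ (Module.finrank_eq_card_basis e.toBasis).symm]
      exact det_flow_pos t
    · rw [Module.Basis.map_apply, Module.Basis.map_apply, hE, hE, h1, hB]

end Geodesics

end

end FermionQuant

namespace FermionQuant

noncomputable section

variable {V : Type*} [NormedAddCommGroup V] [InnerProductSpace ℝ V]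

/-! ### Lengths of curves -/

section Length

variable {n : ℕ} {o : Orientation ℝ V (Fin (2 * n))}

/-- A curve on the unit sphere is at least as long as the angle between its end points. -/
theorem angle_le_integral_norm_deriv {u : ℝ → V} (hu : ContDiff ℝ 1 u)
    (hu1 : ∀ s ∈ Set.Icc (0 : ℝ) 1, ‖u s‖ = 1) {θ : ℝ} (h0 : 0 ≤ θ) (hπ : θ ≤ Real.pi)
    (hθ : ⟪u 0, u 1⟫_ℝ = Real.cos θ) : θ ≤ ∫ s in (0 : ℝ)..1, ‖deriv u s‖ := by
  have hd : ∀ s, HasDerivAt u (deriv u s) s := fun s =>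
    (hu.differentiable (by norm_num) s).hasDerivAt
  have hcd : Continuous (deriv u) := hu.continuous_deriv le_rfl
  have h01 : (0 : ℝ) ∈ Set.Icc (0 : ℝ) 1 := Set.left_mem_Icc.2 zero_le_one
  have horth : ∀ s ∈ Set.Ioo (0 : ℝ) 1, ⟪u s, deriv u s⟫_ℝ = 0 := by
    intro s hs
    have e1 := (hd s).inner ℝ (hd s)
    have e2 : HasDerivAt (fun s => ⟪u s, u s⟫_ℝ) 0 s := by
      refine (hasDerivAt_const s (1 : ℝ)).congr_of_eventuallyEq ?_
      filter_upwards [Icc_mem_nhds hs.1 hs.2] with r hr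
      rw [real_inner_self_eq_norm_sq, hu1 r hr, one_pow]
    have := e1.unique e2
    rw [real_inner_comm (u s)] at this
    linarith [real_inner_comm (u s) (deriv u s)]
  have habs : ∀ s ∈ Set.Icc (0 : ℝ) 1, |⟪u 0, u s⟫_ℝ| ≤ 1 := by
    intro s hs
    have := abs_real_inner_le_norm (u 0) (u s)
    rwa [hu1 0 h01, hu1 s hs, one_mul] at this
  -- The factor `k < 1` keeps the argument away from `±1`, where `arccos` is not differentiable; the
  -- limit `k → 1` is taken at the end.
  have key : ∀ k ∈ Set.Ioo (0 : ℝ) 1,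
      Real.arccos (k * Real.cos θ) - Real.arccos k ≤ ∫ s in (0 : ℝ)..1, ‖deriv u s‖ := by
    intro k hk
    have hlt : ∀ s ∈ Set.Icc (0 : ℝ) 1, |k * ⟪u 0, u s⟫_ℝ| < 1 := by
      intro s hs
      rw [abs_mul, abs_of_pos hk.1]
      nlinarith [habs s hs, hk.1, hk.2]
    have hcont : Continuous fun s => Real.arccos (k * ⟪u 0, u s⟫_ℝ) :=
      Real.continuous_arccos.comp (continuous_const.mul (continuous_const.inner hu.continuous))
    have h := intervalIntegral.sub_le_integral_of_hasDeriv_right_of_le (a := 0) (b := 1)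
      (g := fun s => Real.arccos (k * ⟪u 0, u s⟫_ℝ))
      (g' := fun s => -(1 / √(1 - (k * ⟪u 0, u s⟫_ℝ) ^ 2)) * (k * ⟪u 0, deriv u s⟫_ℝ))
      (φ := fun s => ‖deriv u s‖) zero_le_one hcont.continuousOn (fun s hs => ?_)
      (hcd.norm.continuousOn.integrableOn_Icc) (fun s hs => ?_)
    · have h1 : ⟪u 0, u 0⟫_ℝ = 1 := by rw [real_inner_self_eq_norm_sq, hu1 0 h01, one_pow]
      simpa only [hθ, h1, mul_one] using h
    · have hs' := abs_lt.1 (hlt s (Set.Ioo_subset_Icc_self hs))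
      have e1 : HasDerivAt (fun s => k * ⟪u 0, u s⟫_ℝ) (k * ⟪u 0, deriv u s⟫_ℝ) s := by
        have := ((hasDerivAt_const s (u 0)).inner ℝ (hd s)).const_mul k
        simpa using this
      exact ((Real.hasDerivAt_arccos hs'.1.ne' hs'.2.ne).comp s e1).hasDerivWithinAt
    · set a := ⟪u 0, u s⟫_ℝ with ha
      set b := ⟪u 0, deriv u s⟫_ℝ with hb
      have hs' := abs_lt.1 (hlt s (Set.Ioo_subset_Icc_self hs))
      have hpos : 0 < 1 - (k * a) ^ 2 := by nlinarith
      have hus := hu1 s (Set.Ioo_subset_Icc_self hs)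
      -- The velocity is tangent to the sphere, so only the component of `u 0` orthogonal to `u s`
      -- enters Cauchy–Schwarz.
      have hcs : |b| ≤ √(1 - a ^ 2) * ‖deriv u s‖ := by
        have e1 : b = ⟪u 0 - a • u s, deriv u s⟫_ℝ := by
          rw [inner_sub_left, inner_smul_left, horth s hs]; simp [hb]
        have e2 : ‖u 0 - a • u s‖ = √(1 - a ^ 2) := by
          rw [← Real.sqrt_sq (norm_nonneg (u 0 - a • u s)), norm_sub_sq_real, inner_smul_right,
            norm_smul, hus, hu1 0 h01, ← ha, mul_one, Real.norm_eq_abs, sq_abs]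
          congr 1; ring
        rw [e1, ← e2]
        exact abs_real_inner_le_norm _ _
      have hk2 : k * √(1 - a ^ 2) ≤ √(1 - (k * a) ^ 2) := by
        rw [← Real.sqrt_sq hk.1.le, ← Real.sqrt_mul (sq_nonneg k)]
        refine Real.sqrt_le_sqrt ?_
        rw [Real.sqrt_sq hk.1.le]
        nlinarith [hk.1, hk.2]
      have hsq : 0 < √(1 - (k * a) ^ 2) := Real.sqrt_pos.2 hpos
      have e3 : -(1 / √(1 - (k * a) ^ 2)) * (k * b) = (k * -b) / √(1 - (k * a) ^ 2) := by ring
      rw [e3, div_le_iff₀ hsq]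
      calc k * -b ≤ k * (√(1 - a ^ 2) * ‖deriv u s‖) :=
            mul_le_mul_of_nonneg_left ((neg_le_abs b).trans hcs) hk.1.le
        _ = (k * √(1 - a ^ 2)) * ‖deriv u s‖ := by ring
        _ ≤ √(1 - (k * a) ^ 2) * ‖deriv u s‖ := mul_le_mul_of_nonneg_right hk2 (norm_nonneg _)
        _ = _ := mul_comm _ _
  have hlim : Filter.Tendsto (fun k => Real.arccos (k * Real.cos θ) - Real.arccos k)
      (nhdsWithin 1 (Set.Iio 1)) (nhds θ) := by
    have hc : Continuous fun k => Real.arccos (k * Real.cos θ) - Real.arccos k :=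
      (Real.continuous_arccos.comp (continuous_id.mul continuous_const)).sub Real.continuous_arccos
    have := hc.tendsto 1
    simp only [one_mul, Real.arccos_cos h0 hπ, Real.arccos_one, sub_zero] at this
    exact this.mono_left nhdsWithin_le_nhds
  refine le_of_tendsto hlim ?_
  filter_upwards [Ioo_mem_nhdsLT (zero_lt_one' ℝ)] with k hk using key k hk

theorem skew_deriv {c : ℝ → V →L[ℝ] V} (hc : ContDiff ℝ 1 c)
    (hcs : ∀ s ∈ Set.Icc (0 : ℝ) 1, ∀ x y, ⟪c s x, y⟫_ℝ = -⟪x, c s y⟫_ℝ) {t : ℝ}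
    (ht : t ∈ Set.Ioo (0 : ℝ) 1) (x y : V) : ⟪deriv c t x, y⟫_ℝ = -⟪x, deriv c t y⟫_ℝ := by
  have hd : HasDerivAt c (deriv c t) t := (hc.differentiable (by norm_num) t).hasDerivAt
  have e1 := (hd.clm_apply (hasDerivAt_const t x)).inner ℝ (hasDerivAt_const t y)
  have e2 := ((hasDerivAt_const t x).inner ℝ (hd.clm_apply (hasDerivAt_const t y))).neg
  have e3 : (fun s => ⟪c s x, y⟫_ℝ) =ᶠ[nhds t] -fun s => ⟪x, c s y⟫_ℝ := by
    filter_upwards [Icc_mem_nhds ht.1 ht.2] with s hs using hcs s hs x y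
  have := e1.unique (e2.congr_of_eventuallyEq e3)
  simpa using this

variable {v : OrthonormalBasis (Fin (2 * n)) ℝ V} {A J : V →L[ℝ] V}
  {lam : Fin (2 * n) → ℝ}

theorem norm_sq_apply_eigenbasis (hA : ∀ x y, ⟪A x, y⟫_ℝ = -⟪x, A y⟫_ℝ)
    (hv : ∀ k, A (A (v k)) = -(lam k ^ 2) • v k) (k : Fin (2 * n)) : ‖A (v k)‖ ^ 2 = lam k ^ 2 := by
  rw [← real_inner_self_eq_norm_sq, hA, hv, inner_smul_right, real_inner_self_eq_norm_sq,
    v.norm_eq_one]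
  ring

theorem contDiff_flow_mul [FiniteDimensional ℝ V] {c : ℝ → V →L[ℝ] V} {m : WithTop ℕ∞}
    (hc : ∀ t x, c t x = flow A (2 * t) (J x)) : ContDiff ℝ m c := by
  have : c = fun t => flow A (2 * t) * J := funext fun t => ContinuousLinearMap.ext fun x => hc t x
  rw [this]
  exact (contDiff_flow.comp (contDiff_const.mul contDiff_id)).mul contDiff_const

theorem deriv_flow_mul [FiniteDimensional ℝ V] {c : ℝ → V →L[ℝ] V}
    (hc : ∀ t x, c t x = flow A (2 * t) (J x)) (t : ℝ) (x : V) :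
    deriv c t x = (2 : ℝ) • A (c t x) := by
  have : c = fun t => flow A (2 * t) * J := funext fun t => ContinuousLinearMap.ext fun x => hc t x
  have hm : HasDerivAt (fun t : ℝ => 2 * t) 2 t := by simpa using (hasDerivAt_id t).const_mul 2
  have h := ((hasDerivAt_flow (A := A) (2 * t)).scomp t hm).mul_const J
  have h' : HasDerivAt c (((2 : ℝ) • (A * flow A (2 * t))) * J) t := by
    rw [this]; exact h
  rw [h'.deriv, hc]
  rfl

/-- The velocity is `2 A (c t)`; as `c t` is orthogonal and anticommutes with `A`, the speed is the
constant `√(∑ lam k ^ 2)`. -/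
theorem curveLength_flow [FiniteDimensional ℝ V] (hJ : ∀ x, J (J x) = -x)
    (hg : ∀ x y, ⟪J x, J y⟫_ℝ = ⟪x, y⟫_ℝ)
    (hA : ∀ x y, ⟪A x, y⟫_ℝ = -⟪x, A y⟫_ℝ) (hAJ : ∀ x, A (J x) = -J (A x))
    (hv : ∀ k, A (A (v k)) = -(lam k ^ 2) • v k) {c : ℝ → V →L[ℝ] V}
    (hc : ∀ t x, c t x = flow A (2 * t) (J x)) (a b : ℝ) :
    curveLength c a b = (b - a) * √(∑ k, lam k ^ 2) := by
  have hAc : ∀ t x, A (c t x) = -c t (A x) := by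
    intro t x
    rw [hc, hc, flow_operator_comm, hAJ, map_neg]
  have hcg : ∀ t x y, ⟪c t x, c t y⟫_ℝ = ⟪x, y⟫_ℝ := by
    intro t x y
    rw [hc, hc, inner_flow hA, hg]
  have hm : ∀ t, metricJ (deriv c t) (deriv c t) = ∑ k, lam k ^ 2 := by
    intro t
    rw [metricJ_self v]
    · refine Finset.sum_congr rfl fun k _ => ?_
      have e1 : ‖c t (A (v k))‖ ^ 2 = ‖A (v k)‖ ^ 2 := by
        rw [← real_inner_self_eq_norm_sq, hcg, real_inner_self_eq_norm_sq]
      rw [← norm_sq_apply_eigenbasis hA hv k, ← e1, deriv_flow_mul hc, hAc, norm_smul, norm_neg]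
      simp
    · intro x y
      have hcc : ∀ x, c t (c t x) = -x := by
        intro x
        have e1 := flow_anticomm hAJ (-(2 * t)) (J x)
        rw [neg_neg, hJ, map_neg] at e1
        rw [hc, hc, ← e1, map_neg, flow_neg_apply]
      rw [deriv_flow_mul hc, deriv_flow_mul hc, inner_smul_left, inner_smul_right, hA,
        skew_of_isometry hcc (hcg t), hAc t y, inner_neg_right]
      simp
  simp only [curveLength, hm]
  rw [intervalIntegral.integral_const, smul_eq_mul]

/-- Each `c s (v k)` moves on the unit sphere between points at angle `2 T lam k ≤ π`, which bounds
its length from below. Cauchy–Schwarz with weights `lam k` combines these bounds into the length of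
the geodesic. -/
theorem le_curveLength (hv : ∀ k, A (A (v k)) = -(lam k ^ 2) • v k) (hlam : ∀ k, 0 ≤ lam k)
    (hA : ∀ x y, ⟪A x, y⟫_ℝ = -⟪x, A y⟫_ℝ) (hAJ : ∀ x, A (J x) = -J (A x))
    (hg : ∀ x y, ⟪J x, J y⟫_ℝ = ⟪x, y⟫_ℝ) {T : ℝ} (hT : 0 ≤ T)
    (hlt : ∀ k, T * lam k ≤ Real.pi / 2) {c : ℝ → V →L[ℝ] V} (hc : ContDiff ℝ 1 c)
    (hmem : ∀ s ∈ Set.Icc (0 : ℝ) 1, c s ∈ compatibleJ o) (h0 : c 0 = J)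
    (h1 : ∀ x, c 1 x = flow A (2 * T) (J x)) :
    T * √(∑ k, lam k ^ 2) ≤ curveLength c 0 1 := by
  have : FiniteDimensional ℝ V := v.toBasis.finiteDimensional_of_finite
  have hcd : Continuous (deriv c) := hc.continuous_deriv le_rfl
  have hA0 : ∀ k, lam k = 0 → A (v k) = 0 := by
    intro k hk
    have h := norm_sq_apply_eigenbasis hA hv k
    rw [hk] at h
    simpa using h
  have hvA : ∀ k, ⟪v k, A (v k)⟫_ℝ = 0 := by
    intro k
    have h := hA (v k) (v k)
    rw [real_inner_comm] at h
    linarith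
  have hangle : ∀ k, 2 * T * lam k ≤ ∫ s in (0 : ℝ)..1, ‖deriv c s (v k)‖ := by
    intro k
    have hu : ContDiff ℝ 1 fun s => c s (v k) := hc.clm_apply contDiff_const
    have hud : ∀ s, deriv (fun s => c s (v k)) s = deriv c s (v k) := by
      intro s
      have hd : HasDerivAt c (deriv c s) s := (hc.differentiable (by norm_num) s).hasDerivAt
      simpa using (hd.clm_apply (hasDerivAt_const s (v k))).deriv
    have h := angle_le_integral_norm_deriv hu (fun s hs => ?_) (θ := 2 * T * lam k)
      (by have := hlam k; positivity) (by linarith [hlt k]) ?_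
    · simpa only [hud] using h
    · have h2 := (hmem s hs).2.1 (v k) (v k)
      rw [real_inner_self_eq_norm_sq, real_inner_self_eq_norm_sq, v.norm_eq_one] at h2
      nlinarith [norm_nonneg (c s (v k))]
    · rw [h0, h1, flow_anticomm hAJ, hg, flow_apply_of_sq (hv k) (hA0 k), inner_add_right,
        inner_smul_right, inner_smul_right, hvA, real_inner_self_eq_norm_sq, v.norm_eq_one, neg_mul,
        Real.cos_neg]
      ring
  set R := √(∑ k, lam k ^ 2) with hR
  have hsum : 0 ≤ ∑ k, lam k ^ 2 := Finset.sum_nonneg fun k _ => sq_nonneg _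
  have hR2 : R * R = ∑ k, lam k ^ 2 := Real.mul_self_sqrt hsum
  have hmetric : ∀ s ∈ Set.Ioo (0 : ℝ) 1,
      metricJ (deriv c s) (deriv c s) = ∑ k, (‖deriv c s (v k)‖ / 2) ^ 2 := fun s hs =>
    metricJ_self v (skew_deriv hc
      (fun s hs => skew_of_isometry (hmem s hs).1 (hmem s hs).2.1) hs)
  have hnc : ∀ k, Continuous fun s => ‖deriv c s (v k)‖ := fun k =>
    (hcd.clm_apply continuous_const).norm
  have hlen : curveLength c 0 1 = ∫ s in (0 : ℝ)..1, √(∑ k, (‖deriv c s (v k)‖ / 2) ^ 2) := by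
    rw [curveLength, intervalIntegral.integral_of_le zero_le_one,
      intervalIntegral.integral_of_le zero_le_one, MeasureTheory.integral_Ioc_eq_integral_Ioo,
      MeasureTheory.integral_Ioc_eq_integral_Ioo]
    exact MeasureTheory.setIntegral_congr_fun measurableSet_Ioo fun s hs => by
      simp only [hmetric s hs]
  have hCS : ∀ s, ∑ k, lam k / 2 * ‖deriv c s (v k)‖ ≤
      R * √(∑ k, (‖deriv c s (v k)‖ / 2) ^ 2) := by
    intro s
    have h := Real.sum_mul_le_sqrt_mul_sqrt Finset.univ lam fun k => ‖deriv c s (v k)‖ / 2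
    refine le_trans (le_of_eq ?_) h
    exact Finset.sum_congr rfl fun k _ => by ring
  have hint : ∫ s in (0 : ℝ)..1, ∑ k, lam k / 2 * ‖deriv c s (v k)‖ ≤ R * curveLength c 0 1 := by
    rw [hlen, ← intervalIntegral.integral_const_mul]
    refine intervalIntegral.integral_mono_on zero_le_one
      (Continuous.intervalIntegrable (by fun_prop) _ _)
      (Continuous.intervalIntegrable (by fun_prop) _ _) fun s _ => hCS s
  rw [intervalIntegral.integral_finsetSum fun k _ =>
    Continuous.intervalIntegrable (by fun_prop) _ _] at hint
  simp only [intervalIntegral.integral_const_mul] at hint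
  have hlow : T * (R * R) ≤ R * curveLength c 0 1 := by
    refine le_trans ?_ hint
    rw [hR2, Finset.mul_sum]
    refine Finset.sum_le_sum fun k _ => ?_
    refine le_trans (le_of_eq ?_)
      (mul_le_mul_of_nonneg_left (hangle k) (div_nonneg (hlam k) zero_le_two))
    ring
  rcases (Real.sqrt_nonneg (∑ k, lam k ^ 2)).eq_or_lt with h | h
  · rw [← hR] at h
    rw [← h, mul_zero, hlen]
    exact intervalIntegral.integral_nonneg zero_le_one fun s _ => Real.sqrt_nonneg _
  · rw [← hR] at h
    refine le_of_mul_le_mul_left ?_ h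
    linarith

end Length

end

end FermionQuant

namespace FermionQuant

noncomputable section

variable {V : Type*} [NormedAddCommGroup V] [InnerProductSpace ℝ V]

/-! ### Cut points along geodesics -/

section CutLocus

variable {n : ℕ} {o : Orientation ℝ V (Fin (2 * n))}

/-- The operator with eigenvectors `v_k` and eigenvalues `p k`. -/
def diagonalOp (v : OrthonormalBasis (Fin (2 * n)) ℝ V) (p : Fin (2 * n) → ℝ) : V →L[ℝ] V :=
  ∑ k, p k • (innerSL ℝ (v k)).smulRight (v k)

variable {v : OrthonormalBasis (Fin (2 * n)) ℝ V} {A J : V →L[ℝ] V}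
  {lam : Fin (2 * n) → ℝ}

theorem diagonalOp_apply (p : Fin (2 * n) → ℝ) (x : V) :
    diagonalOp v p x = ∑ k, (p k * ⟪v k, x⟫_ℝ) • v k := by
  simp [diagonalOp, smul_smul]

theorem diagonalOp_basis (p : Fin (2 * n) → ℝ) (k : Fin (2 * n)) :
    diagonalOp v p (v k) = p k • v k := by
  rw [diagonalOp_apply, Finset.sum_eq_single k]
  · rw [real_inner_self_eq_norm_sq, v.norm_eq_one]; simp
  · intro j _ hj
    rw [v.inner_eq_zero hj]; simp
  · simp

theorem inner_diagonalOp (p : Fin (2 * n) → ℝ) (x y : V) :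
    ⟪diagonalOp v p x, y⟫_ℝ = ⟪x, diagonalOp v p y⟫_ℝ := by
  rw [diagonalOp_apply, diagonalOp_apply, sum_inner, inner_sum]
  refine Finset.sum_congr rfl fun k _ => ?_
  rw [inner_smul_left, inner_smul_right, real_inner_comm (v k) x]
  simp only [conj_trivial]
  ring

theorem ext_basis {B C : V →L[ℝ] V} (h : ∀ k, B (v k) = C (v k)) : B = C :=
  ContinuousLinearMap.coe_injective (v.toBasis.ext fun k => by simpa using h k)

/-- A function of `A²` commutes with everything that commutes with `A²`; non-negativity makes `lam
k` a function of the eigenvalue. -/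
theorem diagonalOp_comm (hA : ∀ x y, ⟪A x, y⟫_ℝ = -⟪x, A y⟫_ℝ)
    (hv : ∀ k, A (A (v k)) = -(lam k ^ 2) • v k) (hlam : ∀ k, 0 ≤ lam k) (q : ℝ → ℝ)
    {C : V →L[ℝ] V} (hC : ∀ x, C (A (A x)) = A (A (C x))) (x : V) :
    diagonalOp v (fun k => q (lam k)) (C x) = C (diagonalOp v (fun k => q (lam k)) x) := by
  have h : diagonalOp v (fun k => q (lam k)) * C = C * diagonalOp v fun k => q (lam k) := by
    refine ext_basis (v := v) fun k => ?_
    rw [mul_apply_eq_comp, mul_apply_eq_comp, diagonalOp_basis, map_smul, diagonalOp_apply]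
    conv_rhs => rw [← v.sum_repr' (C (v k)), Finset.smul_sum]
    refine Finset.sum_congr rfl fun j _ => ?_
    rw [smul_smul]
    congr 1
    have h1 : A (A (C (v k))) = -(lam k ^ 2) • C (v k) := by rw [← hC, hv, map_smul]
    have h2 : ⟪A (A (v j)), C (v k)⟫_ℝ = ⟪v j, A (A (C (v k)))⟫_ℝ := by rw [hA, hA, neg_neg]
    rw [h1, hv, inner_smul_left, inner_smul_right] at h2
    simp only [conj_trivial] at h2
    have h3 : (lam j ^ 2 - lam k ^ 2) * ⟪v j, C (v k)⟫_ℝ = 0 := by linarith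
    rcases mul_eq_zero.1 h3 with h | h
    · rw [(sq_eq_sq₀ (hlam j) (hlam k)).1 (sub_eq_zero.1 h)]
    · rw [h, mul_zero, mul_zero]
  exact congrArg (fun f : V →L[ℝ] V => f x) h

/-- The end point depends on the angles `t lam k` only modulo `π`. Replacing `t lam j > π/2` by a
representative in `[-π/2, π/2]` keeps the end points and lowers the speed. -/
theorem exists_shorter_curve (hJ : J ∈ compatibleJ o)
    (hA : ∀ x y, ⟪A x, y⟫_ℝ = -⟪x, A y⟫_ℝ) (hAJ : ∀ x, A (J x) = -J (A x))
    (hv : ∀ k, A (A (v k)) = -(lam k ^ 2) • v k) (hlam : ∀ k, 0 ≤ lam k) {t : ℝ}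
    (ht : 0 < t) {j : Fin (2 * n)} (hj : Real.pi / 2 < t * lam j) :
    ∃ c : ℝ → V →L[ℝ] V, ContDiff ℝ 1 c ∧ (∀ s, c s ∈ compatibleJ o) ∧ c 0 = J ∧
      (∀ x, c 1 x = flow A (2 * t) (J x)) ∧ curveLength c 0 1 < t * √(∑ k, lam k ^ 2) := by
  have : FiniteDimensional ℝ V := v.toBasis.finiteDimensional_of_finite
  have hA0 : ∀ k, lam k = 0 → A (v k) = 0 := by
    intro k hk
    have h := norm_sq_apply_eigenbasis hA hv k
    rw [hk] at h
    simpa using h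
  have hπ := Real.pi_pos
  have hj0 : 0 < lam j := by
    by_contra h
    have : lam j = 0 := le_antisymm (not_lt.1 h) (hlam j)
    rw [this] at hj
    linarith
  -- `m * π` is the multiple of `π` nearest to `t * lam j`.
  set m : ℤ := round (t * lam j / Real.pi) with hm
  -- All eigenvalues equal to `lam j` are changed at once, so that `P` is a function of `A²` and
  -- commutes with `A` and `J`.
  set q : ℝ → ℝ := fun μ => if μ = lam j then t - m * Real.pi / μ else t with hq
  set P := diagonalOp v fun k => q (lam k) with hP
  have hPA : ∀ x, P (A x) = A (P x) := diagonalOp_comm hA hv hlam q fun x => rfl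
  have hPJ : ∀ x, P (J x) = J (P x) := diagonalOp_comm hA hv hlam q fun x => by
    rw [hAJ, map_neg, hAJ, neg_neg]
  set B := A * P with hB
  have hBapp : ∀ x, B x = A (P x) := fun x => rfl
  have hBv : ∀ k, B (v k) = q (lam k) • A (v k) := by
    intro k
    rw [hBapp, hP, diagonalOp_basis, map_smul]
  have hBs : ∀ x y, ⟪B x, y⟫_ℝ = -⟪x, B y⟫_ℝ := by
    intro x y
    rw [hBapp, hBapp, hA, hP, inner_diagonalOp, ← hP, hPA]
  have hBJ : ∀ x, B (J x) = -J (B x) := by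
    intro x
    rw [hBapp, hBapp, hPJ, hAJ]
  have hBB : ∀ k, B (B (v k)) = -((q (lam k) * lam k) ^ 2) • v k := by
    intro k
    rw [hBv, map_smul, hBapp, hPA, hP, diagonalOp_basis, map_smul, map_smul, hv, smul_smul,
      smul_smul]
    congr 1; ring
  have hqm : ∀ k, ∃ i : ℤ, q (lam k) * lam k = t * lam k - i * Real.pi := by
    intro k
    by_cases h : lam k = lam j
    · refine ⟨m, ?_⟩
      simp only [hq, h, if_true]
      field_simp
    · exact ⟨0, by simp [hq, h]⟩
  have hflow : flow B 2 = flow A (2 * t) := by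
    refine ext_basis (v := v) fun k => ?_
    have hB0 : q (lam k) * lam k = 0 → B (v k) = 0 := by
      intro h
      rcases mul_eq_zero.1 h with h | h
      · rw [hBv, h, zero_smul]
      · rw [hBv, hA0 k h, smul_zero]
    obtain ⟨i, hi⟩ := hqm k
    have e1 : 2 * (q (lam k) * lam k) = 2 * t * lam k - i * (2 * Real.pi) := by rw [hi]; ring
    rw [flow_apply_of_sq (hBB k) hB0, flow_apply_of_sq (hv k) (hA0 k), hBv, smul_smul, e1,
      Real.cos_sub_int_mul_two_pi, Real.sin_sub_int_mul_two_pi]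
    congr 1
    rcases eq_or_ne (lam k) 0 with h | h
    · rw [hA0 k h, smul_zero, smul_zero]
    · congr 1
      rcases eq_or_ne (q (lam k)) 0 with h' | h'
      · have e2 : Real.sin (2 * t * lam k) = 0 := by
          have := Real.sin_sub_int_mul_two_pi (2 * t * lam k) i
          rw [← e1, h', zero_mul, mul_zero, Real.sin_zero] at this
          exact this.symm
        rw [e2]; simp
      · field_simp
  refine ⟨fun s => flow B (2 * s) * J, contDiff_flow_mul fun _ _ => rfl,
    fun s => flow_conj_mem_compatibleJ v hJ hBs hBJ s fun x => rfl, ?_, fun x => ?_, ?_⟩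
  · simp only [mul_zero, flow_zero, one_mul]
  · rw [← hflow]
    change flow B (2 * 1) (J x) = _
    rw [mul_one]
  · rw [curveLength_flow hJ.1 hJ.2.1 hBs hBJ hBB (fun _ _ => rfl), sub_zero, one_mul,
      ← Real.sqrt_sq ht.le, ← Real.sqrt_mul (sq_nonneg t)]
    refine Real.sqrt_lt_sqrt (Finset.sum_nonneg fun k _ => sq_nonneg _) ?_
    rw [Finset.mul_sum]
    have hjlt : (q (lam j) * lam j) ^ 2 < t ^ 2 * lam j ^ 2 := by
      have e1 : q (lam j) * lam j = (t * lam j / Real.pi - m) * Real.pi := by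
        simp only [hq, if_true]
        field_simp
      have e2 := abs_sub_round (t * lam j / Real.pi)
      rw [← hm] at e2
      have e3 : |q (lam j) * lam j| ≤ Real.pi / 2 := by
        rw [e1, abs_mul, abs_of_pos hπ]
        nlinarith
      rw [← mul_pow, ← sq_abs]
      exact pow_lt_pow_left₀ (e3.trans_lt hj) (abs_nonneg _) two_ne_zero
    refine Finset.sum_lt_sum (fun k _ => ?_) ⟨j, Finset.mem_univ j, hjlt⟩
    by_cases h : lam k = lam j
    · rw [h]; exact hjlt.le
    · simp only [hq, h, if_false]
      exact (mul_pow _ _ _).le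

/-- If the largest `lam j` were at least `π/2`, then `T = π / (2 lam j) ≤ 1` would be a cut time:
the length bound makes `γ` minimising up to `T`, and every later time admits a shorter curve. -/
theorem lt_pi_div_two_of_notMem_cutLocusJ {γ : ℝ → V →L[ℝ] V} (hγ : IsGeodesicJ o γ)
    (hcut : ∀ t ∈ Set.Icc (0 : ℝ) 1, γ t ∉ cutLocusJ o (γ 0))
    (hA : ∀ x y, ⟪A x, y⟫_ℝ = -⟪x, A y⟫_ℝ) (hAJ : ∀ x, A (γ 0 x) = -γ 0 (A x))
    (hγA : ∀ t x, γ t x = flow A (2 * t) (γ 0 x))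
    (hv : ∀ k, A (A (v k)) = -(lam k ^ 2) • v k) (hlam : ∀ k, 0 ≤ lam k) (k : Fin (2 * n)) :
    lam k < Real.pi / 2 := by
  have : FiniteDimensional ℝ V := v.toBasis.finiteDimensional_of_finite
  by_contra! hk
  have hπ := Real.pi_pos
  obtain ⟨j, -, hj⟩ := Finset.exists_max_image Finset.univ lam ⟨k, Finset.mem_univ k⟩
  have hj2 : Real.pi / 2 ≤ lam j := hk.trans (hj k (Finset.mem_univ k))
  have hj0 : 0 < lam j := by linarith
  set T := Real.pi / 2 / lam j with hT
  have hT0 : 0 < T := by positivity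
  have hTj : T * lam j = Real.pi / 2 := by rw [hT]; field_simp
  have hJ := hγ.2.1 0
  have hlen : ∀ t, curveLength γ 0 t = t * √(∑ k, lam k ^ 2) := by
    intro t
    rw [curveLength_flow hJ.1 hJ.2.1 hA hAJ hv hγA, sub_zero]
  refine hcut T ⟨hT0.le, by rw [hT, div_le_one hj0]; exact hj2⟩
    ⟨γ, hγ, rfl, fun h => ?_, T, hT0, rfl, ?_, fun t ht h => ?_⟩
  -- A vanishing initial velocity would force `A (v j) = 0`, against `lam j > 0`.
  · have h1 := deriv_flow_mul hγA 0 (v j)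
    have h2 : ‖A (γ 0 (v j))‖ = 0 := by
      rw [h] at h1
      have := (smul_eq_zero.1 h1.symm).resolve_left two_ne_zero
      rw [this, norm_zero]
    have h3 : ⟪γ 0 (A (v j)), γ 0 (A (v j))⟫_ℝ = lam j ^ 2 := by
      rw [hJ.2.1, real_inner_self_eq_norm_sq, norm_sq_apply_eigenbasis hA hv]
    rw [real_inner_self_eq_norm_sq, ← norm_neg, ← hAJ, h2] at h3
    have : 0 < lam j ^ 2 := by positivity
    rw [← h3] at this
    simp at this
  · intro c hc hcm h0 h1
    rw [hlen]
    refine le_curveLength hv hlam hA hAJ hJ.2.1 hT0.le (fun i => ?_) hc hcm h0 fun x => ?_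
    · rw [← hTj]
      exact mul_le_mul_of_nonneg_left (hj i (Finset.mem_univ i)) hT0.le
    · rw [h1, hγA]
  · have htj : Real.pi / 2 < t * lam j := by
      rw [← hTj]; exact mul_lt_mul_of_pos_right ht hj0
    obtain ⟨c, hc, hcm, h0, h1, hlt⟩ :=
      exists_shorter_curve hJ hA hAJ hv hlam (hT0.trans ht) htj
    have := h c hc (fun s _ => hcm s) h0 
      (ContinuousLinearMap.ext fun x => (h1 x).trans (hγA t x).symm)
    rw [hlen] at this
    exact absurd hlt (not_lt.2 this)

end CutLocus

end

end FermionQuant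

namespace FermionQuant

noncomputable section

attribute [local instance] ringCExt negCExt distribNegCExt addCommGroupCExt

variable {V : Type*} [NormedAddCommGroup V] [InnerProductSpace ℝ V]

/-! ### The kernel of parallel transport -/

section Transport

variable {n : ℕ} {e v : OrthonormalBasis (Fin (2 * n)) ℝ V} {A J : V →L[ℝ] V}
  {lam : Fin (2 * n) → ℝ}

theorem det_eq_prod_of_eigenbasis {C : V →ₗ[ℝ] V} {p : Fin (2 * n) → ℝ}
    (hC : ∀ k, C (v k) = p k • v k) : LinearMap.det C = ∏ k, p k := by
  rw [← LinearMap.det_toMatrix v.toBasis, ← Matrix.det_diagonal]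
  congr 1
  ext i j
  rw [LinearMap.toMatrix_apply, OrthonormalBasis.coe_toBasis, hC, map_smul, Finsupp.smul_apply,
    ← OrthonormalBasis.coe_toBasis, Module.Basis.repr_self, Matrix.diagonal_apply,
    Finsupp.single_apply]
  by_cases h : i = j
  · simp [h]
  · simp [h, Ne.symm h]

/-- `(J + J₁)/2 = exp A · ½ (exp A + exp (-A)) · J`, and the middle factor is `cos (lam k)` on `v
k`. The outer factors have determinant one: `J` because `J² = -1` and `J` commutes with itself as a
complex structure, `exp A` because `J` conjugates it to its inverse. -/
theorem det_half_add (hJ : ∀ x, J (J x) = -x) (hA : ∀ x y, ⟪A x, y⟫_ℝ = -⟪x, A y⟫_ℝ)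
    (hAJ : ∀ x, A (J x) = -J (A x)) (hv : ∀ k, A (A (v k)) = -(lam k ^ 2) • v k)
    {J₁ : V →L[ℝ] V} (hJ₁ : ∀ x, J₁ x = flow A 2 (J x)) :
    ((1 / 2 : ℝ) • (J + J₁)).det = ∏ k, Real.cos (lam k) := by
  have : FiniteDimensional ℝ V := v.toBasis.finiteDimensional_of_finite
  have hA0 : ∀ k, lam k = 0 → A (v k) = 0 := by
    intro k hk
    have h := norm_sq_apply_eigenbasis hA hv k
    rw [hk] at h
    simpa using h
  set C : V →ₗ[ℝ] V := (1 / 2 : ℝ) • ((flow A 1).toLinearMap + (flow A (-1)).toLinearMap) with hC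
  have hCapp : ∀ x, C x = (1 / 2 : ℝ) • (flow A 1 x + flow A (-1) x) := fun x => rfl
  have hCv : ∀ k, C (v k) = Real.cos (lam k) • v k := by
    intro k
    rw [hCapp, flow_apply_of_sq (hv k) (hA0 k), flow_apply_of_sq (hv k) (hA0 k), neg_mul,
      Real.cos_neg, Real.sin_neg, one_mul, neg_div]
    module
  have hdJ2 : LinearMap.det J.toLinearMap * LinearMap.det J.toLinearMap = 1 := by
    rw [← LinearMap.det_comp]
    have h1 : J.toLinearMap ∘ₗ J.toLinearMap = (-1 : ℝ) • LinearMap.id := by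
      apply LinearMap.ext; intro x
      simp [hJ]
    rw [h1, LinearMap.det_smul, LinearMap.det_id, Module.finrank_eq_card_basis v.toBasis,
      Fintype.card_fin, pow_mul]
    simp
  have hdJ : LinearMap.det J.toLinearMap = 1 := by
    have h0 := det_nonneg_of_commute_complex (J := J.toLinearMap) (L := J.toLinearMap) hJ
      fun _ => rfl
    nlinarith
  have hdF : LinearMap.det (flow A 1).toLinearMap = 1 := by
    have h1 : LinearMap.det (flow A 1).toLinearMap * LinearMap.det (flow A (-1)).toLinearMap = 1 := by
      rw [← LinearMap.det_comp]
      have : (flow A 1).toLinearMap ∘ₗ (flow A (-1)).toLinearMap = LinearMap.id :=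
        LinearMap.ext fun x => flow_neg_apply _ _
      rw [this, LinearMap.det_id]
    have h2 : LinearMap.det (flow A 1).toLinearMap = LinearMap.det (flow A (-1)).toLinearMap := by
      have h3 : (flow A 1).toLinearMap ∘ₗ J.toLinearMap =
          J.toLinearMap ∘ₗ (flow A (-1)).toLinearMap :=
        LinearMap.ext fun x => flow_anticomm hAJ 1 x
      have h4 := congrArg LinearMap.det h3
      rw [LinearMap.det_comp, LinearMap.det_comp, hdJ, mul_one, one_mul] at h4
      exact h4
    have h0 : 0 < LinearMap.det (flow A 1).toLinearMap := det_flow_pos 1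
    rw [← h2] at h1
    nlinarith
  have hcomp : ((1 / 2 : ℝ) • (J + J₁)).toLinearMap =
      (flow A 1).toLinearMap ∘ₗ C ∘ₗ J.toLinearMap := by
    apply LinearMap.ext; intro x
    simp only [LinearMap.comp_apply, ContinuousLinearMap.coe_coe, hCapp, map_smul, map_add]
    rw [flow_neg_apply, ← flow_add_apply, one_add_one_eq_two, ← hJ₁]
    simp [add_comm]
  rw [ContinuousLinearMap.det, hcomp, LinearMap.det_comp, LinearMap.det_comp, hdF, hdJ, one_mul,
    mul_one, det_eq_prod_of_eigenbasis hCv]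

theorem kernelOp_exp_mul (J₀ J₁ : V →L[ℝ] V) (φ : Forms V) :
    kernelOp e J₁ (IsNilpotent.exp ((Complex.I / 2) • varpi e J₀) * φ) =
      IsNilpotent.exp ((Complex.I / 4) • varpiVar e J₁) *
        berezinChi e
          (IsNilpotent.exp
              (gThetaChi e J₁ + (Complex.I / 4) • inChi (varpiVar e J₁)
                + (Complex.I / 4) • inChi (varpiVar e J₀)) *
            inChi φ) := by
  have h1 : (Complex.I / 2) • varpi e J₀ = (Complex.I / 4) • varpiVar e J₀ := by
    rw [varpi, smul_smul]; congr 1; ring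
  have hq : (Complex.I / 4) • varpiVar e J₀ ∈ quadr (Module.Dual ℝ V) :=
    Submodule.smul_mem _ _ (varpiVar_mem_quadr J₀)
  have h2 : inChi (IsNilpotent.exp ((Complex.I / 4) • varpiVar e J₀)) =
      IsNilpotent.exp ((Complex.I / 4) • inChi (varpiVar e J₀)) := by
    rw [← map_smul]
    exact mapC_exp _ hq
  have hq2 : (Complex.I / 4) • inChi (varpiVar e J₀) ∈
      quadr (Module.Dual ℝ V × Module.Dual ℝ V) :=
    Submodule.smul_mem _ _ (inChi_mem_quadr (varpiVar_mem_quadr J₀))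
  rw [kernelOp_apply, h1, map_mul inChi, h2, ← mul_assoc (IsNilpotent.exp (kernelExponent _ _ _)),
    ← exp_add_quadr (kernelExponent_mem_quadr _) hq2]
  rfl

/-- The flow is followed backwards: `kernelOp_flow` for `-A` at `J₁` starts from `U 1 ψ`, which the
kernel operator fixes as an element of `ℋ_{J₁}`, and ends at `ψ`. -/
theorem isParallelTransport_iff {o : Orientation ℝ V (Fin (2 * n))}
    (he : e.toBasis.orientation = o) {J₀ J₁ : V →L[ℝ] V} {γ : ℝ → V →L[ℝ] V}
    (hγ : ∀ t, γ t ∈ compatibleJ o) (hγ0 : γ 0 = J₀) (hγ1 : γ 1 = J₁)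
    (hA : ∀ x y, ⟪A x, y⟫_ℝ = -⟪x, A y⟫_ℝ) (hAJ : ∀ x, A (J₀ x) = -J₀ (A x))
    (hγA : ∀ t x, γ t x = flow A (2 * t) (J₀ x))
    (hv : ∀ k, A (A (v k)) = -(lam k ^ 2) • v k)
    (hcos : ∀ t ∈ Set.Icc (0 : ℝ) 1, ∀ k, 0 < Real.cos (t * lam k)) {ψ : Forms V}
    (hψ : ψ ∈ quantumH J₀) (ψ₁ : Forms V) :
    IsParallelTransport e γ ψ ψ₁ ↔
      ψ₁ = (((∏ k, Real.cos (lam k)) ^ (-(1 / 4) : ℝ) : ℝ) : ℂ) • kernelOp e J₁ ψ := by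
  have : FiniteDimensional ℝ V := v.toBasis.finiteDimensional_of_finite
  have hJ₀ : J₀ ∈ compatibleJ o := hγ0 ▸ hγ 0
  have hJ₁ : J₁ ∈ compatibleJ o := hγ1 ▸ hγ 1
  obtain ⟨U, hU0, hUadd, hU, hUS⟩ := exists_flow (spinOp v A)
  have hUD := flow_intertwine hA hU0 hUadd hUS
  have hpar := isParallelSection_flow (e := e) hJ₀.1 hJ₀.2.1 hA hAJ hγA hU hUD hψ
  have hex : IsParallelTransport e γ ψ (U 1 ψ) := ⟨fun t => U t ψ, hpar, by simp [hU0], rfl⟩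
  have hmem : U 1 ψ ∈ quantumH J₁ := hγ1 ▸ (hpar 1 (Set.right_mem_Icc.2 zero_le_one)).1
  have hAJ₁ : ∀ x, (-A) (J₁ x) = -J₁ ((-A) x) := by
    intro x
    have h := hγA 1
    rw [hγ1] at h
    rw [neg_apply, neg_apply, map_neg, h, h, flow_operator_comm, hAJ, map_neg]
  have hker := kernelOp_flow (e := e) (v := v) (A := -A) (lam := lam) (U := fun t => U (-t))
    (ψ := U 1 ψ) hJ₁.1 hJ₁.2.1 (fun x y => by
      rw [neg_apply, neg_apply, inner_neg_left, inner_neg_right, hA]) hAJ₁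
    (fun k => by rw [neg_apply, neg_apply, map_neg, neg_neg, hv]) hcos (by simp [hU0])
    (fun ψ l t => by
      have h := (hU ψ l (-t)).scomp t (hasDerivAt_neg t)
      refine h.congr_deriv ?_
      rw [spinOp_neg]
      simp)
    (fun t x ψ => by
      have h := hUD (-t) x ψ
      rwa [neg_smul, ← smul_neg] at h) hmem
  have hU1 : U (-1) (U 1 ψ) = ψ := by
    rw [← Module.End.mul_apply, ← hUadd, neg_add_cancel, hU0, Module.End.one_apply]
  rw [kernelOp_eq_self (skew_of_isometry hJ₁.1 hJ₁.2.1) hJ₁.1 (pfaffian_eq_one hJ₁ he) hmem]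
    at hker
  simp only [hU1] at hker
  have hprod : 0 < ∏ k, Real.cos (lam k) := Finset.prod_pos fun k _ => by
    simpa using hcos 1 (Set.right_mem_Icc.2 zero_le_one) k
  have hres : U 1 ψ = (((∏ k, Real.cos (lam k)) ^ (-(1 / 4) : ℝ) : ℝ) : ℂ) • kernelOp e J₁ ψ := by
    rw [hker, smul_smul, ← Complex.ofReal_mul, ← Real.rpow_add hprod]
    simp
  rw [← hres]
  constructor
  · intro h
    exact isParallelTransport_unique (fun t => (hγ t).1) h hex
  · rintro rfl
    exact hex

end Transport

end

end FermionQuant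
theorem mainTheorem8 {n : ℕ} {V : Type*} [NormedAddCommGroup V] [InnerProductSpace ℝ V]
    (o : Orientation ℝ V (Fin (2 * n)))
    (e : OrthonormalBasis (Fin (2 * n)) ℝ V) (he : e.toBasis.orientation = o)
    (J₀ J₁ : V →L[ℝ] V) (γ : ℝ → V →L[ℝ] V)
    (hγ : IsGeodesicJ o γ) (hγ0 : γ 0 = J₀) (hγ1 : γ 1 = J₁)
    (hcut : ∀ t ∈ Set.Icc (0 : ℝ) 1, γ t ∉ cutLocusJ o J₀)
    (φ : Forms V)
    (hψ : IsNilpotent.exp ((Complex.I / 2) • varpi e J₀) * φ ∈ quantumH J₀) :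
    0 < ((1 / 2 : ℝ) • (J₀ + J₁)).det ∧
    ∀ ψ₁ : Forms V,
      IsParallelTransport e γ (IsNilpotent.exp ((Complex.I / 2) • varpi e J₀) * φ) ψ₁ ↔
        ψ₁ = ((((1 / 2 : ℝ) • (J₀ + J₁)).det ^ (-(1 / 4) : ℝ) : ℝ) : ℂ) •
          (IsNilpotent.exp ((Complex.I / 4) • varpiVar e J₁) *
            berezinChi e
              (IsNilpotent.exp
                  (gThetaChi e J₁ + (Complex.I / 4) • inChi (varpiVar e J₁)
                    + (Complex.I / 4) • inChi (varpiVar e J₀)) *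
                inChi φ)) := by
  obtain ⟨A, hA, hAJ, hγA⟩ := exists_generator_of_isGeodesicJ e hγ
  obtain ⟨v, lam, hlam, hv⟩ := exists_eigenbasis e hA
  have hcut' : ∀ t ∈ Set.Icc (0 : ℝ) 1, γ t ∉ cutLocusJ o (γ 0) := by rwa [hγ0]
  have hlt := lt_pi_div_two_of_notMem_cutLocusJ hγ hcut' hA hAJ hγA hv hlam
  rw [hγ0] at hAJ
  simp only [hγ0] at hγA
  -- The angles `t * lam k` stay in `[0, π/2)`; this is where avoidance of the cut locus is felt.
  have hcos : ∀ t ∈ Set.Icc (0 : ℝ) 1, ∀ k, 0 < Real.cos (t * lam k) := by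
    intro t ht k
    have h1 : 0 ≤ t * lam k := mul_nonneg ht.1 (hlam k)
    have h2 : t * lam k ≤ lam k := mul_le_of_le_one_left (hlam k) ht.2
    exact Real.cos_pos_of_mem_Ioo ⟨by linarith [Real.pi_pos], by linarith [hlt k]⟩
  have hdet : ((1 / 2 : ℝ) • (J₀ + J₁)).det = ∏ k, Real.cos (lam k) := by
    refine det_half_add (hγ0 ▸ hγ.2.1 0).1 hA hAJ hv fun x => ?_
    rw [← hγ1, hγA, mul_one]
  refine ⟨?_, fun ψ₁ => ?_⟩
  · rw [hdet]
    exact Finset.prod_pos fun k _ => by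
      simpa using hcos 1 (Set.right_mem_Icc.2 zero_le_one) k
  · rw [hdet, ← kernelOp_exp_mul]
    exact isParallelTransport_iff he hγ.2.1 hγ0 hγ1 hA hAJ hγA hv hcos hψ ψ₁
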